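/- Let $n\ge 0$. Let $\mathcal G\mathrm{Diff}(n)$ be the associative $\mathbb C$-algebra with generators $\zeta^i,\delta_i$ $(1\le i\le n)$ and relations $\zeta^i\zeta^j+\zeta^j\zeta^i=\delta_i\delta_j+\delta_j\delta_i=0$, $\zeta^i\delta_j+\delta_j\zeta^i=\delta_j^i$ (the Kronecker symbol). Let $e_{ij}$ be the standard generators of $\mathrm U(\mathfrak{gl}_n)$, put $\mathcal A=\mathcal G\mathrm{Diff}(n)\otimes \mathrm U(\mathfrak{gl}_n)$ and $E_{ij}=\zeta^i\delta_j\otimes 1+1\otimes e_{ij}\in\mathcal A$. Let $\mathrm U(\mathfrak h)=\mathbb C[h_1,\dots,h_n]$, embedded in $\mathcal A$ by $h_i\mapsto E_{ii}$, let $\mathrm K$ be the multiplicative set of finite products of elements $h_i-h_j+k$ ($i\ne j$, $k\in\mathbb Z$), and let $\bar{\mathrm U}(\mathfrak h)$ and $\bar{\mathcal A}$ be the rings of fractions of $\mathrm U(\mathfrak h)$ and $\mathcal A$ with respect to $\mathrm K$. Let $\varepsilon$ be the anti-involution of $\bar{\mathcal A}$ with $\varepsilon(\zeta^i\otimes1)=\delta_i\otimes1$,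 $\varepsilon(\delta_i\otimes1)=\zeta^i\otimes1$, $\varepsilon(1\otimes e_{ij})=1\otimes e_{ji}$. Let $\bar{\mathrm J}_+$ be the left ideal of $\bar{\mathcal A}$ generated by the $E_{ij}$ with $i<j$, let $\bar{\mathrm J}_-$ be the right ideal generated by the $E_{ij}$ with $i>j$, and let $\bar{\mathrm Z}=\bar{\mathcal A}/(\bar{\mathrm J}_-+\bar{\mathrm J}_+)$ be the reduction algebra (the algebra of odd $\mathfrak h$-differential operators), with the multiplication $x\diamond y=$ the class of $ab$, where $a\in\bar{\mathcal A}$ represents $x$ and $b\in\bar{\mathcal A}$ is a representative of $y$ with $\bar{\mathrm J}_+b\subset\bar{\mathrm J}_+$ (equivalently $x\diamond y = x\mathrm P y$ with the extremal projector $\mathrm P$ of $\mathfrak{gl}_n$). Denote by $:\!d\!:$ the image of $d\otimes 1$ in $\bar{\mathrm Z}$ for $d\in\mathcal G\mathrm{Diff}(n)$. Let $\mathrm I_\delta$ be the left ideal of $\bar{\mathrm Z}$ generated by all $:\!\delta_i\!:$, let $\mathrm I_\zeta$ be the right ideal generated by all $:\!\zeta^i\!:$, and let $\mathcal G_{\mathfrak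 h}(n)=\bar{\mathrm Z}/\mathrm I_\delta$. For $z\in\bar{\mathrm Z}$ let $z^{(0)}$ denote the unique element of $\bar{\mathrm U}(\mathfrak h)$ with $z-z^{(0)}\in \mathrm I_\delta+\mathrm I_\zeta$. **Proposition.** The formula $(x,y)=(\varepsilon(x)\diamond y)^{(0)}$ defines a $\bar{\mathrm U}(\mathfrak h)$-valued form on $\mathcal G_{\mathfrak h}(n)$ (the contravariant form). For $\nu,\nu'\in\{0,1\}^n$ the images in $\mathcal G_{\mathfrak h}(n)$ of the monomials $:\!\zeta^\nu\!:\;=\;:\!(\zeta^1)^{\nu_1}\cdots(\zeta^n)^{\nu_n}\!:$ have the scalar products $$(:\!\zeta^{\nu}\!:,:\!\zeta^{\nu'}\!:)=\delta_{\nu,\nu'}\prod_{i<j}\frac{(\mathring h_{ij}-\nu_j)^{1-\nu_i}}{(\mathring h_{ij})^{1-\nu_i}}=\delta_{\nu,\nu'}\prod_{i<j}\frac{(\mathring h_{ij}-1+\nu_i)^{\nu_j}}{(\mathring h_{ij})^{\nu_j}},$$ where $\mathring h_{ij}=(h_i-i)-(h_j-j)$. -/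

import Mathlib

open scoped TensorProduct

noncomputable section

namespace HGrassmann

section Construction

attribute [local instance] LieRing.ofAssociativeRing
attribute [local instance] LieAlgebra.ofAssociativeAlgebra

/-! ### The ring of Grassmann differential operators -/

/-- The free algebra on the symbols `ζ^i` (`Sum.inl i`) and `δ_i` (`Sum.inr i`). -/
abbrev FreeGen (n : ℕ) : Type := FreeAlgebra ℂ (Fin n ⊕ Fin n)

/-- The defining relations `ζ^i ζ^j + ζ^j ζ^i = δ_i δ_j + δ_j δ_i = 0` and
`ζ^i δ_j + δ_j ζ^i = δ_{ij}` of the ring of Grassmann differential operators. -/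
inductive GDiffRel (n : ℕ) : FreeGen n → FreeGen n → Prop
  | zeta_zeta (i j : Fin n) : GDiffRel n
      (FreeAlgebra.ι ℂ (Sum.inl i) * FreeAlgebra.ι ℂ (Sum.inl j)
        + FreeAlgebra.ι ℂ (Sum.inl j) * FreeAlgebra.ι ℂ (Sum.inl i)) 0
  | delta_delta (i j : Fin n) : GDiffRel n
      (FreeAlgebra.ι ℂ (Sum.inr i) * FreeAlgebra.ι ℂ (Sum.inr j)
        + FreeAlgebra.ι ℂ (Sum.inr j) * FreeAlgebra.ι ℂ (Sum.inr i)) 0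
  | zeta_delta (i j : Fin n) : GDiffRel n
      (FreeAlgebra.ι ℂ (Sum.inl i) * FreeAlgebra.ι ℂ (Sum.inr j)
        + FreeAlgebra.ι ℂ (Sum.inr j) * FreeAlgebra.ι ℂ (Sum.inl i))
      (if i = j then 1 else 0)

/-- The ring `GDiff(n)` of Grassmann differential operators in `n` odd variables. -/
def GDiff (n : ℕ) : Type := RingQuot (GDiffRel n)

instance (n : ℕ) : Ring (GDiff n) := inferInstanceAs (Ring (RingQuot (GDiffRel n)))

instance (n : ℕ) : Algebra ℂ (GDiff n) := inferInstanceAs (Algebra ℂ (RingQuot (GDiffRel n)))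

/-- The quotient map from the free algebra onto `GDiff(n)`. -/
def GDiff.mk (n : ℕ) : FreeGen n →ₐ[ℂ] GDiff n := RingQuot.mkAlgHom ℂ (GDiffRel n)

theorem GDiff.mk_rel {n : ℕ} {x y : FreeGen n} (h : GDiffRel n x y) :
    GDiff.mk n x = GDiff.mk n y := RingQuot.mkAlgHom_rel ℂ h

theorem GDiff.mk_surjective (n : ℕ) : Function.Surjective (GDiff.mk n) :=
  RingQuot.mkAlgHom_surjective ℂ (GDiffRel n)

/-- The universal property of `GDiff(n)`. -/
def GDiff.lift {n : ℕ} {B : Type} [Ring B] [Algebra ℂ B] (f : FreeGen n →ₐ[ℂ] B)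
    (hf : ∀ ⦃x y⦄, GDiffRel n x y → f x = f y) : GDiff n →ₐ[ℂ] B :=
  RingQuot.liftAlgHom ℂ ⟨f, hf⟩

theorem GDiff.lift_mk {n : ℕ} {B : Type} [Ring B] [Algebra ℂ B] (f : FreeGen n →ₐ[ℂ] B)
    (hf : ∀ ⦃x y⦄, GDiffRel n x y → f x = f y) (x : FreeGen n) :
    GDiff.lift f hf (GDiff.mk n x) = f x :=
  RingQuot.liftAlgHom_mkAlgHom_apply ℂ f hf x

/-- The odd coordinate `ζ^i`. -/
def zeta {n : ℕ} (i : Fin n) : GDiff n :=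
  GDiff.mk n (FreeAlgebra.ι ℂ (Sum.inl i))

/-- The odd derivative `δ_i`. -/
def delta {n : ℕ} (i : Fin n) : GDiff n :=
  GDiff.mk n (FreeAlgebra.ι ℂ (Sum.inr i))

theorem zeta_zeta {n : ℕ} (i j : Fin n) : zeta i * zeta j + zeta j * zeta i = 0 := by
  have h := GDiff.mk_rel (GDiffRel.zeta_zeta i j)
  rw [map_add, map_mul, map_mul, map_zero] at h
  exact h

theorem delta_delta {n : ℕ} (i j : Fin n) : delta i * delta j + delta j * delta i = 0 := by
  have h := GDiff.mk_rel (GDiffRel.delta_delta i j)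
  rw [map_add, map_mul, map_mul, map_zero] at h
  exact h

theorem zeta_delta {n : ℕ} (i j : Fin n) :
    zeta i * delta j + delta j * zeta i = if i = j then 1 else 0 := by
  have h := GDiff.mk_rel (GDiffRel.zeta_delta i j)
  rw [map_add, map_mul, map_mul, apply_ite (GDiff.mk n), map_one, map_zero] at h
  exact h

theorem GDiff.induction {n : ℕ} {C : GDiff n → Prop}
    (algebraMap : ∀ r : ℂ, C (algebraMap ℂ (GDiff n) r))
    (zeta : ∀ i, C (zeta i)) (delta : ∀ i, C (delta i))
    (mul : ∀ a b, C a → C b → C (a * b)) (add : ∀ a b, C a → C b → C (a + b))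
    (a : GDiff n) : C a := by
  obtain ⟨x, rfl⟩ := GDiff.mk_surjective n a
  induction x using FreeAlgebra.induction with
  | grade0 r => rw [AlgHom.commutes]; exact algebraMap r
  | grade1 s => cases s with
    | inl i => exact zeta i
    | inr i => exact delta i
  | mul a b ha hb => rw [map_mul]; exact mul _ _ ha hb
  | add a b ha hb => rw [map_add]; exact add _ _ ha hb

/-! ### The universal enveloping algebra of `gl_n` -/

/-- The Lie algebra `gl_n` (with the commutator bracket). -/
abbrev gl (n : ℕ) : Type := Matrix (Fin n) (Fin n) ℂ

/-- The universal enveloping algebra `U(gl_n)`. -/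
abbrev Ugl (n : ℕ) : Type := UniversalEnvelopingAlgebra ℂ (gl n)

/-- The standard generator `e_{ij}` in `U(gl_n)`. -/
def e {n : ℕ} (i j : Fin n) : Ugl n :=
  UniversalEnvelopingAlgebra.ι ℂ (Matrix.single i j (1 : ℂ))

theorem e_comm {n : ℕ} (i j k l : Fin n) :
    e i j * e k l - e k l * e i j
      = (if j = k then e i l else 0) - (if l = i then e k j else 0) := by
  have h := (UniversalEnvelopingAlgebra.ι ℂ (L := gl n)).map_lie
    (Matrix.single i j (1 : ℂ)) (Matrix.single k l (1 : ℂ))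
  rw [LieRing.of_associative_ring_bracket, LieRing.of_associative_ring_bracket] at h
  rw [e, e, ← h, map_sub]
  congr 1
  · split_ifs with hjk
    · subst hjk; simp [e]
    · simp [hjk]
  · split_ifs with hjk
    · subst hjk; simp [e]
    · simp [hjk]

theorem Ugl.induction {n : ℕ} {C : Ugl n → Prop}
    (algebraMap : ∀ r : ℂ, C (algebraMap ℂ (Ugl n) r))
    (gen : ∀ i j, C (e i j))
    (mul : ∀ a b, C a → C b → C (a * b)) (add : ∀ a b, C a → C b → C (a + b))
    (a : Ugl n) : C a := by
  let S : Subalgebra ℂ (Ugl n) :=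
    { carrier := {a | C a}
      mul_mem' := fun ha hb => mul _ _ ha hb
      add_mem' := fun ha hb => add _ _ ha hb
      algebraMap_mem' := algebraMap }
  have hι : ∀ x : gl n, UniversalEnvelopingAlgebra.ι ℂ x ∈ S := by
    intro x
    rw [Matrix.matrix_eq_sum_single x, map_sum]
    refine Subalgebra.sum_mem _ fun i _ => ?_
    rw [map_sum]
    refine Subalgebra.sum_mem _ fun j _ => ?_
    have : Matrix.single i j (x i j) = x i j • Matrix.single i j (1 : ℂ) := by simp
    rw [this, map_smul]
    exact Subalgebra.smul_mem _ (gen i j) _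
  let f : gl n →ₗ⁅ℂ⁆ S :=
    { toFun := fun x => ⟨UniversalEnvelopingAlgebra.ι ℂ x, hι x⟩
      map_add' := fun x y => Subtype.ext (by simp)
      map_smul' := fun r x => Subtype.ext (by simp)
      map_lie' := fun {x y} => Subtype.ext (by
        rw [LieRing.of_associative_ring_bracket (A := S)]
        exact ((UniversalEnvelopingAlgebra.ι ℂ (L := gl n)).map_lie x y).trans
          (LieRing.of_associative_ring_bracket _ _)) }
  have h : S.val.comp (UniversalEnvelopingAlgebra.lift ℂ f) = AlgHom.id ℂ (Ugl n) := by
    apply UniversalEnvelopingAlgebra.hom_ext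
    ext x
    change S.val (UniversalEnvelopingAlgebra.lift ℂ f (UniversalEnvelopingAlgebra.ι ℂ _)) = _
    rw [UniversalEnvelopingAlgebra.lift_ι_apply]
    rfl
  have h2 : ((UniversalEnvelopingAlgebra.lift ℂ f a : S) : Ugl n) = a :=
    congrArg (fun g : Ugl n →ₐ[ℂ] Ugl n => g a) h
  rw [← h2]
  exact (UniversalEnvelopingAlgebra.lift ℂ f a : S).2

/-! ### The algebra `A = GDiff(n) ⊗ U(gl_n)` and its diagonal `gl_n` -/

/-- The algebra `A = GDiff(n) ⊗ U(gl_n)`. -/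
abbrev A (n : ℕ) : Type := GDiff n ⊗[ℂ] Ugl n

/-- The diagonal generator `E_{ij} = ζ^i δ_j ⊗ 1 + 1 ⊗ e_{ij}` of `A`. -/
def E {n : ℕ} (i j : Fin n) : A n := (zeta i * delta j) ⊗ₜ 1 + 1 ⊗ₜ e i j

theorem A.induction {n : ℕ} {C : A n → Prop}
    (algebraMap : ∀ r : ℂ, C (algebraMap ℂ (A n) r))
    (zeta : ∀ i, C (zeta i ⊗ₜ 1)) (delta : ∀ i, C (delta i ⊗ₜ 1)) (gen : ∀ i j, C (1 ⊗ₜ e i j))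
    (mul : ∀ a b, C a → C b → C (a * b)) (add : ∀ a b, C a → C b → C (a + b))
    (a : A n) : C a := by
  have h1 : ∀ x : GDiff n, C (x ⊗ₜ 1) := by
    intro x
    induction x using GDiff.induction with
    | algebraMap r => exact algebraMap r
    | zeta i => exact zeta i
    | delta i => exact delta i
    | mul a b ha hb =>
      have := mul _ _ ha hb
      rwa [Algebra.TensorProduct.tmul_mul_tmul, one_mul] at this
    | add a b ha hb => rw [TensorProduct.add_tmul]; exact add _ _ ha hb
  have h2 : ∀ x : Ugl n, C (1 ⊗ₜ x) := by
    intro x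
    induction x using Ugl.induction with
    | algebraMap r =>
      have := algebraMap r
      rwa [Algebra.TensorProduct.algebraMap_apply, Algebra.algebraMap_eq_smul_one,
        TensorProduct.smul_tmul, ← Algebra.algebraMap_eq_smul_one] at this
    | gen i j => exact gen i j
    | mul a b ha hb =>
      have := mul _ _ ha hb
      rwa [Algebra.TensorProduct.tmul_mul_tmul, one_mul] at this
    | add a b ha hb => rw [TensorProduct.tmul_add]; exact add _ _ ha hb
  induction a using TensorProduct.induction_on with
  | zero => simpa using algebraMap 0
  | tmul x y =>
    have := mul _ _ (h1 x) (h2 y)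
    rwa [Algebra.TensorProduct.tmul_mul_tmul, one_mul, mul_one] at this
  | add a b ha hb => exact add _ _ ha hb

/-! #### Weights of the generators -/

theorem H_zeta {n : ℕ} (i k : Fin n) :
    E i i * (zeta k ⊗ₜ 1) = (zeta k ⊗ₜ 1) * (E i i + if i = k then 1 else 0 : A n) := by
  have h1 : zeta i * delta i * zeta k
      = zeta k * (zeta i * delta i) + if i = k then zeta k else 0 := by
    have a := zeta_delta k i
    have b := zeta_zeta i k
    have a' : delta i * zeta k = (if k = i then 1 else 0) - zeta k * delta i :=
      eq_sub_of_add_eq' a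
    have b' : zeta i * zeta k = - (zeta k * zeta i) := eq_neg_of_add_eq_zero_left b
    rw [mul_assoc, a', mul_sub, ← mul_assoc, b']
    by_cases h : i = k
    · subst h
      simp [mul_assoc]
      abel
    · simp [h, Ne.symm h, mul_assoc]
  simp only [E, add_mul, mul_add, Algebra.TensorProduct.tmul_mul_tmul, one_mul, mul_one, h1,
    TensorProduct.add_tmul]
  split_ifs <;> simp <;> abel

theorem H_delta {n : ℕ} (i k : Fin n) :
    E i i * (delta k ⊗ₜ 1) = (delta k ⊗ₜ 1) * (E i i - if i = k then 1 else 0 : A n) := by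
  have h1 : zeta i * delta i * delta k
      = delta k * (zeta i * delta i) - if i = k then delta k else 0 := by
    have a := zeta_delta i k
    have b := delta_delta i k
    have a' : zeta i * delta k = (if i = k then 1 else 0) - delta k * zeta i :=
      eq_sub_of_add_eq a
    have b' : delta i * delta k = - (delta k * delta i) := eq_neg_of_add_eq_zero_left b
    rw [mul_assoc, b', mul_neg, ← mul_assoc, a', sub_mul]
    by_cases h : i = k
    · subst h; simp [mul_assoc]
    · simp [h, mul_assoc]
  simp only [E, add_mul, mul_add, mul_sub, Algebra.TensorProduct.tmul_mul_tmul, one_mul, mul_one,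
    h1, TensorProduct.sub_tmul]
  split_ifs <;> simp <;> abel

theorem H_e {n : ℕ} (i k l : Fin n) :
    E i i * (1 ⊗ₜ e k l)
      = (1 ⊗ₜ e k l) * (E i i + (if i = k then 1 else 0) - (if i = l then 1 else 0) : A n) := by
  have h1 : e i i * e k l
      = e k l * e i i + (if i = k then e k l else 0) - (if i = l then e k l else 0) := by
    have a := e_comm i i k l
    rw [sub_eq_iff_eq_add] at a
    rw [a]
    by_cases h : i = k <;> by_cases h' : i = l
    · subst h; subst h'; simp
    · subst h; simp [h', Ne.symm h']; abel
    · subst h'; simp [h]; abel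
    · simp [h, h', Ne.symm h']
  simp only [E, add_mul, mul_add, mul_sub, Algebra.TensorProduct.tmul_mul_tmul, one_mul, mul_one,
    h1, TensorProduct.tmul_add, TensorProduct.tmul_sub]
  split_ifs <;> simp <;> abel

theorem H_comm {n : ℕ} (i j : Fin n) : E i i * E j j = E j j * (E i i : A n) := by
  have h : (E j j : A n) = (zeta j ⊗ₜ 1) * (delta j ⊗ₜ 1) + 1 ⊗ₜ e j j := by
    simp [E]
  have h3 := H_e i j j
  rw [add_sub_cancel_right] at h3
  rw [h, mul_add, h3, ← mul_assoc, H_zeta, mul_assoc, add_mul, H_delta, add_mul, mul_assoc]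
  congr 2
  rw [mul_sub]
  split_ifs <;> simp

/-! ### Cartan subalgebra and denominators -/

/-- `U(h)`, the polynomial algebra in `h_1, …, h_n` (the variable `X i` stands for `h_i`). -/
abbrev Uh (n : ℕ) : Type := MvPolynomial (Fin n) ℂ

/-- The multiplicative set of finite products of the elements `h_i - h_j + k`,
with `i ≠ j` and `k` an integer. -/
def K (n : ℕ) : Submonoid (Uh n) :=
  Submonoid.closure {p | ∃ (i j : Fin n) (k : ℤ), i ≠ j ∧
    p = MvPolynomial.X i - MvPolynomial.X j + MvPolynomial.C (k : ℂ)}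

/-- The ring of fractions of `U(h)` with denominators in `K`. -/
abbrev UhBar (n : ℕ) : Type := Localization (K n)

theorem isMulCommutative_cartan (n : ℕ) :
    IsMulCommutative (Algebra.adjoin ℂ (Set.range fun i : Fin n => (E i i : A n))) :=
  Algebra.isMulCommutative_adjoin ℂ (by
    rintro _ ⟨i, rfl⟩ _ ⟨j, rfl⟩
    exact H_comm i j)

open scoped IsMulCommutative in
/-- The embedding of `U(h)` in `A` with `h_i ↦ E_{ii}`. -/
def cartan (n : ℕ) : Uh n →ₐ[ℂ] A n :=
  have := isMulCommutative_cartan n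
  (Algebra.adjoin ℂ (Set.range fun i : Fin n => (E i i : A n))).val.comp
    (MvPolynomial.aeval fun i =>
      (⟨E i i, Algebra.subset_adjoin ⟨i, rfl⟩⟩ :
        Algebra.adjoin ℂ (Set.range fun i : Fin n => (E i i : A n))))

@[simp]
theorem cartan_X {n : ℕ} (i : Fin n) : cartan n (MvPolynomial.X i) = E i i := by
  simp [cartan]

/-- The substitution `h_i ↦ h_i + w_i`. -/
def shift {n : ℕ} (w : Fin n → ℤ) : Uh n →ₐ[ℂ] Uh n :=
  MvPolynomial.aeval fun i => MvPolynomial.X i + MvPolynomial.C (w i : ℂ)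

theorem shift_mem {n : ℕ} (w : Fin n → ℤ) {p : Uh n} (hp : p ∈ K n) : shift w p ∈ K n := by
  induction hp using Submonoid.closure_induction with
  | mem x hx =>
    obtain ⟨i, j, k, hij, rfl⟩ := hx
    refine Submonoid.subset_closure ⟨i, j, w i - w j + k, hij, ?_⟩
    simp only [shift, map_add, map_sub, MvPolynomial.aeval_X, MvPolynomial.aeval_C,
      MvPolynomial.algebraMap_eq, Int.cast_add, Int.cast_sub]
    ring
  | one => simp
  | mul x y _ _ hx hy => rw [map_mul]; exact mul_mem hx hy

theorem shift_neg {n : ℕ} (w : Fin n → ℤ) (p : Uh n) : shift w (shift (-w) p) = p := by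
  have h : (shift w).comp (shift (-w)) = AlgHom.id ℂ (Uh n) := by
    apply MvPolynomial.algHom_ext
    intro i
    simp [shift]
  exact congrArg (fun g : Uh n →ₐ[ℂ] Uh n => g p) h

theorem cartan_mul {n : ℕ} {a : A n} {w : Fin n → ℤ}
    (ha : ∀ i, E i i * a = a * (E i i + (w i : A n))) (p : Uh n) :
    cartan n p * a = a * cartan n (shift w p) := by
  induction p using MvPolynomial.induction_on with
  | C r =>
    simp only [shift, MvPolynomial.aeval_C, MvPolynomial.algebraMap_eq]
    rw [← MvPolynomial.algebraMap_eq, AlgHom.commutes, Algebra.commutes]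
  | add p q hp hq => simp only [map_add, add_mul, mul_add, hp, hq]
  | mul_X p i hp =>
    rw [map_mul, mul_assoc, cartan_X, ha i, ← mul_assoc, hp, map_mul, map_mul, mul_assoc]
    congr 2
    simp only [shift, MvPolynomial.aeval_X, map_add, cartan_X]
    rw [← MvPolynomial.algebraMap_eq, AlgHom.commutes, map_intCast]

/-- The weight spaces of the adjoint action of the Cartan subalgebra on `A`. -/
def weightSpace {n : ℕ} (w : Fin n → ℤ) : Submodule ℂ (A n) :=
  ⨅ i, Module.End.eigenspace
    (LinearMap.mulLeft ℂ (E i i : A n) - LinearMap.mulRight ℂ (E i i : A n)) ((w i : ℤ) : ℂ)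

theorem mem_weightSpace {n : ℕ} {w : Fin n → ℤ} {a : A n} :
    a ∈ weightSpace w ↔ ∀ i, E i i * a = a * (E i i + (w i : A n)) := by
  simp only [weightSpace, Submodule.mem_iInf, Module.End.mem_eigenspace_iff,
    LinearMap.sub_apply, LinearMap.mulLeft_apply, LinearMap.mulRight_apply]
  refine forall_congr' fun i => ?_
  rw [mul_add, sub_eq_iff_eq_add', ← map_intCast (algebraMap ℂ (A n)), ← Algebra.commutes,
    ← Algebra.smul_def]

theorem iSupIndep_weightSpace (n : ℕ) :
    iSupIndep (fun w : Fin n → ℤ => (weightSpace w : Submodule ℂ (A n))) := by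
  let f : Fin n → Module.End ℂ (A n) := fun i =>
    (LinearMap.mulLeft ℂ (E i i : A n)) - LinearMap.mulRight ℂ (E i i : A n)
  have hc : ∀ i j, Commute (f i) (f j) := by
    intro i j
    have h : ∀ a : A n, f i (f j a) = f j (f i a) := by
      intro a
      simp only [f, LinearMap.sub_apply, LinearMap.mulLeft_apply, LinearMap.mulRight_apply,
        mul_sub, sub_mul, mul_assoc]
      rw [← mul_assoc (E i i) (E j j) a, H_comm i j, mul_assoc]
      abel
    exact LinearMap.ext h
  have h1 : iSupIndep fun χ : Fin n → ℂ => ⨅ i, (f i).maxGenEigenspace (χ i) :=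
    Module.End.independent_iInf_maxGenEigenspace_of_forall_mapsTo f fun i j φ =>
      Module.End.mapsTo_maxGenEigenspace_of_comm (hc j i) φ
  have h2 : Function.Injective fun (w : Fin n → ℤ) (i : Fin n) => ((w i : ℤ) : ℂ) := by
    intro w w' h
    funext i
    exact Int.cast_injective (α := ℂ) (congrFun h i)
  refine (h1.comp h2).mono fun w => ?_
  exact iInf_mono fun i => (f i).genEigenspace_le_maximal _ 1

theorem weight_mul {n : ℕ} {w w' : Fin n → ℤ} {a b : A n} (ha : a ∈ weightSpace w)
    (hb : b ∈ weightSpace w') : a * b ∈ weightSpace (w + w') := by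
  rw [mem_weightSpace] at *
  intro i
  have h := hb i
  have hc : ((w i : ℤ) : A n) * b = b * (w i : A n) := Int.cast_comm _ _
  rw [← mul_assoc, ha i, mul_assoc, mul_assoc, add_mul, h, hc]
  simp only [Pi.add_apply, Int.cast_add, mul_add]
  abel

theorem iSup_weightSpace (n : ℕ) (a : A n) : a ∈ ⨆ w : Fin n → ℤ, (weightSpace w) := by
  have hin : ∀ (w : Fin n → ℤ) (a : A n), a ∈ weightSpace w →
      a ∈ ⨆ w : Fin n → ℤ, (weightSpace w : Submodule ℂ (A n)) := fun w a h =>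
    Submodule.mem_iSup_of_mem w h
  induction a using A.induction with
  | algebraMap r =>
    refine hin 0 _ (mem_weightSpace.2 fun i => ?_)
    rw [Pi.zero_apply, Int.cast_zero, add_zero, Algebra.commutes]
  | zeta k =>
    refine hin (Pi.single k 1) _ (mem_weightSpace.2 fun i => ?_)
    rw [H_zeta]
    by_cases h : i = k <;> simp [h]
  | delta k =>
    refine hin (-Pi.single k 1) _ (mem_weightSpace.2 fun i => ?_)
    rw [H_delta]
    by_cases h : i = k <;> simp [h, sub_eq_add_neg]
  | gen k l =>
    refine hin (Pi.single k 1 - Pi.single l 1) _ (mem_weightSpace.2 fun i => ?_)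
    rw [H_e]
    simp only [Pi.sub_apply, Pi.single_apply]
    split_ifs <;> simp [sub_eq_add_neg]
  | mul a b ha hb =>
    induction ha using Submodule.iSup_induction' with
    | zero => simp
    | add x y _ _ hx hy => rw [add_mul]; exact add_mem hx hy
    | mem w x hx =>
      induction hb using Submodule.iSup_induction' with
      | zero => simp
      | add x y _ _ hx hy => rw [mul_add]; exact add_mem hx hy
      | mem w' y hy => exact hin _ _ (weight_mul hx hy)
  | add a b ha hb => exact add_mem ha hb

/-- The multiplicative set of denominators inside `A`. -/
def KA (n : ℕ) : Submonoid (A n) := (K n).map (cartan n)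

theorem ore_condition {n : ℕ} (a : A n) {p : Uh n} (hp : p ∈ K n) :
    ∃ q ∈ K n, ∃ a' : A n, cartan n q * a = a' * cartan n p := by
  have h := iSup_weightSpace n a
  induction h using Submodule.iSup_induction' with
  | zero => exact ⟨1, one_mem _, 0, by simp⟩
  | mem w x hx =>
    refine ⟨shift (-w) p, shift_mem _ hp, x, ?_⟩
    rw [cartan_mul (mem_weightSpace.1 hx), shift_neg]
  | add x y _ _ hx hy =>
    obtain ⟨q, hq, x', hx'⟩ := hx
    obtain ⟨r, hr, y', hy'⟩ := hy
    refine ⟨q * r, mul_mem hq hr, cartan n r * x' + cartan n q * y', ?_⟩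
    rw [mul_add, add_mul, mul_assoc _ x', mul_assoc _ y', ← hx', ← hy', ← mul_assoc, ← mul_assoc,
      ← map_mul, ← map_mul, mul_comm r q]

theorem ore_cancel {n : ℕ} (a : A n) {p : Uh n} (hp : p ∈ K n) (h : a * cartan n p = 0) :
    ∃ q ∈ K n, cartan n q * a = 0 := by
  obtain ⟨f, hf, rfl⟩ := (Submodule.mem_iSup_iff_exists_finsupp _ _).1 (iSup_weightSpace n a)
  have hc : ∀ w, f w * cartan n p = cartan n (shift (-w) p) * f w := fun w => by
    rw [cartan_mul (mem_weightSpace.1 (hf w)), shift_neg]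
  have hp0 : ∀ i : Fin n, E i i * cartan n p = cartan n p * E i i := fun i => by
    rw [← cartan_X, ← map_mul, ← map_mul, mul_comm]
  have hz : ∀ w ∈ f.support, f w * cartan n p = 0 := by
    refine (iSupIndep_iff_finsetSum_eq_zero_imp_eq_zero _).1 (iSupIndep_weightSpace n) f.support
      (fun w => f w * cartan n p) (fun w _ => ?_) ?_
    · have h0 : cartan n p ∈ weightSpace (0 : Fin n → ℤ) := mem_weightSpace.2 fun i => by
        simpa using hp0 i
      simpa using weight_mul (hf w) h0
    · rw [← Finset.sum_mul]; exact h
  refine ⟨∏ w ∈ f.support, shift (-w) p, prod_mem fun w _ => shift_mem _ hp, ?_⟩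
  rw [Finsupp.sum, Finset.mul_sum]
  refine Finset.sum_eq_zero fun w hw => ?_
  rw [← Finset.prod_erase_mul _ _ hw, map_mul, mul_assoc, ← hc, hz w hw, mul_zero]

instance (n : ℕ) : OreLocalization.OreSet (KA n) :=
  Classical.choice (OreLocalization.nonempty_oreSet_iff.2 (by
    constructor
    · rintro r₁ r₂ ⟨_, p, hp, rfl⟩ h
      obtain ⟨q, hq, hq'⟩ := ore_cancel (r₁ - r₂) hp (by
        rw [sub_mul]; exact sub_eq_zero.2 h)
      refine ⟨⟨cartan n q, q, hq, rfl⟩, ?_⟩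
      rw [mul_sub] at hq'
      exact sub_eq_zero.1 hq'
    · rintro r ⟨_, p, hp, rfl⟩
      obtain ⟨q, hq, r', h⟩ := ore_condition r hp
      exact ⟨r', ⟨cartan n q, q, hq, rfl⟩, h⟩))

/-- The ring of fractions of `A` with denominators in `K`. -/
abbrev ABar (n : ℕ) : Type := OreLocalization (KA n) (A n)

/-- The canonical map from `A` to its ring of fractions. -/
def toBar (n : ℕ) : A n →+* ABar n := OreLocalization.numeratorRingHom

theorem isUnit_toBar_cartan {n : ℕ} (p : K n) :
    IsUnit (((toBar n).comp (cartan n : Uh n →+* A n)).toMonoidHom.comp (K n).subtype p) :=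
  OreLocalization.numerator_isUnit (⟨cartan n p, p, p.2, rfl⟩ : KA n)

/-- The map from the localized `U(h)` to the localized `A` with `h_i ↦ E_{ii}`. -/
def cartanBar (n : ℕ) : UhBar n →+* ABar n :=
  OreLocalization.universalHom ((toBar n).comp (cartan n : Uh n →+* A n))
    (IsUnit.liftRight _ isUnit_toBar_cartan) fun _ => rfl

theorem cartanBar_algebraMap {n : ℕ} (p : Uh n) :
    cartanBar n (algebraMap (Uh n) (UhBar n) p) = toBar n (cartan n p) :=
  OreLocalization.universalHom_commutes _ _ _

/-! ### The anti-involution `ε` -/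

/-- The anti-involution of `GDiff(n)` with `ζ^i ↦ δ_i` and `δ_i ↦ ζ^i`. -/
def epsGDiff (n : ℕ) : GDiff n →ₐ[ℂ] (GDiff n)ᵐᵒᵖ :=
  GDiff.lift
    (FreeAlgebra.lift ℂ (Sum.elim (fun i => MulOpposite.op (delta i))
      (fun i => MulOpposite.op (zeta i)))) (by
    intro x y h
    cases h with
    | zeta_zeta i j =>
      simp only [map_add, map_mul, map_zero, FreeAlgebra.lift_ι_apply, Sum.elim_inl]
      rw [← MulOpposite.op_mul, ← MulOpposite.op_mul, ← MulOpposite.op_add, delta_delta,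
        MulOpposite.op_zero]
    | delta_delta i j =>
      simp only [map_add, map_mul, map_zero, FreeAlgebra.lift_ι_apply, Sum.elim_inr]
      rw [← MulOpposite.op_mul, ← MulOpposite.op_mul, ← MulOpposite.op_add, zeta_zeta,
        MulOpposite.op_zero]
    | zeta_delta i j =>
      rw [apply_ite (FreeAlgebra.lift ℂ _), map_one, map_zero]
      simp only [map_add, map_mul, FreeAlgebra.lift_ι_apply, Sum.elim_inr, Sum.elim_inl]
      rw [← MulOpposite.op_mul, ← MulOpposite.op_mul, ← MulOpposite.op_add, zeta_delta]
      by_cases h : i = j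
      · simp [h]
      · simp [h, Ne.symm h])

@[simp]
theorem epsGDiff_zeta {n : ℕ} (i : Fin n) : epsGDiff n (zeta i) = MulOpposite.op (delta i) := by
  rw [epsGDiff, zeta, GDiff.lift_mk, FreeAlgebra.lift_ι_apply]; rfl

@[simp]
theorem epsGDiff_delta {n : ℕ} (i : Fin n) : epsGDiff n (delta i) = MulOpposite.op (zeta i) := by
  rw [epsGDiff, delta, GDiff.lift_mk, FreeAlgebra.lift_ι_apply]; rfl

/-- The Cartan anti-involution of `U(gl_n)`, with `e_{ij} ↦ e_{ji}`. -/
def epsUgl (n : ℕ) : Ugl n →ₐ[ℂ] (Ugl n)ᵐᵒᵖ :=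
  UniversalEnvelopingAlgebra.lift ℂ
    { toFun := fun x => MulOpposite.op (UniversalEnvelopingAlgebra.ι ℂ x.transpose)
      map_add' := fun x y => by simp
      map_smul' := fun r x => by simp
      map_lie' := fun {x y} => by
        have h := (UniversalEnvelopingAlgebra.ι ℂ (L := gl n)).map_lie y.transpose x.transpose
        rw [LieRing.of_associative_ring_bracket, LieRing.of_associative_ring_bracket,
          ← Matrix.transpose_mul, ← Matrix.transpose_mul, ← Matrix.transpose_sub] at h
        rw [LieRing.of_associative_ring_bracket, LieRing.of_associative_ring_bracket,
          ← MulOpposite.op_mul, ← MulOpposite.op_mul, ← MulOpposite.op_sub, ← h] }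

@[simp]
theorem epsUgl_e {n : ℕ} (i j : Fin n) : epsUgl n (e i j) = MulOpposite.op (e j i) := by
  rw [epsUgl, e, UniversalEnvelopingAlgebra.lift_ι_apply]
  change MulOpposite.op (UniversalEnvelopingAlgebra.ι ℂ (Matrix.single i j (1 : ℂ)).transpose) = _
  rw [Matrix.transpose_single, e]

/-- The anti-involution `ε ⊗ ε` of `A = GDiff(n) ⊗ U(gl_n)`. -/
def epsA (n : ℕ) : A n →ₐ[ℂ] (A n)ᵐᵒᵖ :=
  Algebra.TensorProduct.lift
    ((AlgHom.op (Algebra.TensorProduct.includeLeft : GDiff n →ₐ[ℂ] A n)).comp (epsGDiff n))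
    ((AlgHom.op (Algebra.TensorProduct.includeRight : Ugl n →ₐ[ℂ] A n)).comp (epsUgl n))
    (fun x y => by
      change MulOpposite.op _ * MulOpposite.op _ = MulOpposite.op _ * MulOpposite.op _
      rw [← MulOpposite.op_mul, ← MulOpposite.op_mul]
      simp)

theorem epsA_tmul {n : ℕ} (x : GDiff n) (y : Ugl n) :
    epsA n (x ⊗ₜ y) = MulOpposite.op ((epsGDiff n x).unop ⊗ₜ (epsUgl n y).unop) := by
  rw [epsA, Algebra.TensorProduct.lift_tmul]
  change MulOpposite.op _ * MulOpposite.op _ = _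
  rw [← MulOpposite.op_mul]
  simp

theorem epsA_E {n : ℕ} (i j : Fin n) : epsA n (E i j) = MulOpposite.op (E j i) := by
  simp [E, epsA_tmul]

theorem epsA_cartan {n : ℕ} (p : Uh n) : epsA n (cartan n p) = MulOpposite.op (cartan n p) := by
  induction p using MvPolynomial.induction_on with
  | C r => rw [← MvPolynomial.algebraMap_eq, AlgHom.commutes, AlgHom.commutes]; rfl
  | add p q hp hq => rw [map_add, map_add, hp, hq]; rfl
  | mul_X p i hp =>
    rw [map_mul, map_mul, hp, cartan_X, epsA_E, ← MulOpposite.op_mul, ← cartan_X, ← map_mul,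
      ← map_mul, mul_comm]

theorem isUnit_epsA {n : ℕ} (s : KA n) :
    IsUnit ((((RingHom.op (toBar n)).comp (epsA n : A n →+* (A n)ᵐᵒᵖ)).toMonoidHom.comp
      (KA n).subtype) s) := by
  obtain ⟨_, p, hp, rfl⟩ := s
  change IsUnit (RingHom.op (toBar n) (epsA n (cartan n p)))
  rw [epsA_cartan]
  exact (isUnit_toBar_cartan ⟨p, hp⟩).op

/-- The anti-involution `ε` of the localized algebra, as a homomorphism to the opposite ring. -/
def epsHom (n : ℕ) : ABar n →+* (ABar n)ᵐᵒᵖ :=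
  OreLocalization.universalHom ((RingHom.op (toBar n)).comp (epsA n : A n →+* (A n)ᵐᵒᵖ))
    (IsUnit.liftRight _ isUnit_epsA) fun _ => rfl

/-- The anti-involution `ε` of the localized algebra. -/
def eps {n : ℕ} (x : ABar n) : ABar n := (epsHom n x).unop

theorem eps_toBar {n : ℕ} (x : A n) : eps (toBar n x) = toBar n (epsA n x).unop := by
  have h : epsHom n (toBar n x) = RingHom.op (toBar n) (epsA n x) :=
    OreLocalization.universalHom_commutes _ _ _
  rw [eps, h]
  rfl

/-! ### The reduction algebra -/

/-- The left ideal `J₊` generated by the diagonal `n₊`, that is by all `E_{ij}` with `i < j`. -/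
def Jplus (n : ℕ) : Submodule ℂ (ABar n) :=
  Submodule.span ℂ {x | ∃ (a : ABar n) (i j : Fin n), i < j ∧ x = a * toBar n (E i j)}

/-- The right ideal `J₋` generated by the diagonal `n₋`, that is by all `E_{ij}` with `j < i`. -/
def Jminus (n : ℕ) : Submodule ℂ (ABar n) :=
  Submodule.span ℂ {x | ∃ (a : ABar n) (i j : Fin n), j < i ∧ x = toBar n (E i j) * a}

/-- The double coset space of the localized algebra modulo `J₋ + J₊`, which underlies the reduction
algebra `GDiff_h(n)`. -/
abbrev ZBar (n : ℕ) : Type := ABar n ⧸ (Jminus n ⊔ Jplus n)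

/-- The double coset of an element. -/
def cls {n : ℕ} : ABar n →ₗ[ℂ] ZBar n := (Jminus n ⊔ Jplus n).mkQ

/-- `b` belongs to the normalizer of the left ideal `J₊`. -/
def IsNormalizing {n : ℕ} (b : ABar n) : Prop := ∀ a ∈ Jplus n, a * b ∈ Jplus n

theorem Jminus_mul {n : ℕ} (b : ABar n) {a : ABar n} (ha : a ∈ Jminus n) : a * b ∈ Jminus n := by
  induction ha using Submodule.span_induction with
  | mem x hx =>
    obtain ⟨a, i, j, hij, rfl⟩ := hx
    exact Submodule.subset_span ⟨a * b, i, j, hij, mul_assoc _ _ _⟩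
  | zero => simp
  | add x y _ _ hx hy => rw [add_mul]; exact add_mem hx hy
  | smul r x _ hx => rw [smul_mul_assoc]; exact Submodule.smul_mem _ _ hx

/-- Right multiplication of double cosets by an element normalizing `J₊`. -/
def rightMul {n : ℕ} (b : ABar n) (hb : IsNormalizing b) : ZBar n →ₗ[ℂ] ZBar n :=
  Submodule.mapQ _ _ (LinearMap.mulRight ℂ b) (by
    rw [sup_le_iff]
    exact ⟨fun a ha => Submodule.mem_sup_left (Jminus_mul b ha),
      fun a ha => Submodule.mem_sup_right (hb a ha)⟩)

theorem rightMul_cls {n : ℕ} (b : ABar n) (hb : IsNormalizing b) (a : ABar n) :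
    rightMul b hb (cls a) = cls (a * b) := rfl

open scoped Classical in
/-- The multiplication `x ⋄ y` of the reduction algebra: the double coset of `a * b`, where `a` is
any representative of `x` and `b` is a representative of `y` which normalizes the left ideal `J₊`.
Such a `b` exists in every double coset (`b = P y` with the extremal projector `P` is one), so that
the second branch is never used, and the result does not depend on its choice: as `P b ≡ b` modulo
`J₊`, it is the double coset of `a P b`. -/
def diamond {n : ℕ} (x y : ZBar n) : ZBar n :=
  if h : ∃ b : ABar n, IsNormalizing b ∧ cls b = y then rightMul h.choose h.choose_spec.1 x else 0

/-- The image in the reduction algebra of an element of `GDiff(n)`. -/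
def image {n : ℕ} (d : GDiff n) : ZBar n := cls (toBar n (d ⊗ₜ 1))

/-- The left ideal of the reduction algebra generated by all `δ_i`. -/
def Idelta (n : ℕ) : Submodule ℂ (ZBar n) :=
  Submodule.span ℂ {w | ∃ (z : ZBar n) (i : Fin n), w = diamond z (image (delta i))}

/-- The right ideal of the reduction algebra generated by all `ζ^i`. -/
def Izeta (n : ℕ) : Submodule ℂ (ZBar n) :=
  Submodule.span ℂ {w | ∃ (z : ZBar n) (i : Fin n), w = diamond (image (zeta i)) z}

/-- The module `G_h(n)`, the quotient of the reduction algebra by the left ideal generated by all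
`δ_i`. -/
abbrev GH (n : ℕ) : Type := ZBar n ⧸ Idelta n

/-- The image in `G_h(n)` of an element of the reduction algebra. -/
def toGH {n : ℕ} : ZBar n →ₗ[ℂ] GH n := (Idelta n).mkQ

/-- The Harish-Chandra projection `z ↦ z^{(0)}` of the reduction algebra takes the value `c` at `z`:
`c` is the unique element of the localized `U(h)` with `z - c ∈ I_δ + I_ζ`. -/
def HarishChandra {n : ℕ} (z : ZBar n) (c : UhBar n) : Prop :=
  ∀ c' : UhBar n, z - cls (cartanBar n c') ∈ Idelta n ⊔ Izeta n ↔ c' = c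

/-- `B` is the contravariant form of `G_h(n)`: its value at the images of `x` and `y` is
`(ε(x) ⋄ y)^{(0)}`. This determines `B`. -/
def IsContravariantForm {n : ℕ} (B : GH n → GH n → UhBar n) : Prop :=
  ∀ x y : ABar n, HarishChandra (diamond (cls (eps x)) (cls y)) (B (toGH (cls x)) (toGH (cls y)))

/-- The image in `G_h(n)` of the monomial `(ζ^1)^{ν_1} ⋯ (ζ^n)^{ν_n}`. -/
def monomial {n : ℕ} (ν : Fin n → ℕ) : GH n :=
  toGH (image (List.ofFn fun i => zeta i ^ ν i).prod)

/-- The element `h̊_{ij} = (h_i - i) - (h_j - j)` of the localized `U(h)`. -/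
def hring {n : ℕ} (i j : Fin n) : UhBar n :=
  algebraMap (Uh n) (UhBar n)
    ((MvPolynomial.X i - MvPolynomial.C (i : ℂ)) - (MvPolynomial.X j - MvPolynomial.C (j : ℂ)))

theorem isUnit_hring {n : ℕ} {i j : Fin n} (hij : i ≠ j) : IsUnit (hring i j) := by
  refine IsLocalization.map_units (UhBar n) (⟨_, Submonoid.subset_closure
    ⟨i, j, (j : ℤ) - (i : ℤ), hij, ?_⟩⟩ : K n)
  simp only [Int.cast_sub, Int.cast_natCast, map_sub]
  ring

end Construction

end HGrassmann

end

/-! The extremal projector is never formed. A representative is singular (`Sing`) when every raising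
operator sends it into the left ideal `Jp`, and singular representatives come from finite matrix
products. Let ψ_j be a family that transforms like the vector representation: ψ_j = ζ^j x, or after
reversal of the indices δ_j x, with x singular. Modulo `Jp` the matrix (E_ij) acts on ψ
triangularly, with diagonal entries α_j whose differences have the form h_a - h_b + k with a ≠ b and
are therefore invertible. The product (E - α_{j-1})⋯(E - α_0) kills the components before j, so its
j-th component is singular, with leading term ψ_j ∏_{k<j} (α_j - α_k). Induction on the number of
odd generators then gives a singular representative of every double coset (`exists_sing_sub_mem`),
and the anti-involution shows that ⋄ does not depend on the choice (`Sing.mul_sub_mem_Q`).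

The preimage of I_δ + I_ζ in the localized algebra is the sum `M` of the left ideal generated by n₊
and the δ_i and the right ideal generated by n₋ and the ζ^i (`Idel_sup_Izet`). Normal ordering gives
each element a Cartan part modulo `M` (`exists_sub_C_mem`). It is unique because the Fock vacuum
expectation, tensored with a highest weight functional on U(gl_n), kills the numerators of elements
of `M` and evaluates polynomials in the h_i at a dominant weight, and these weights are Zariski
dense (`eq_zero_of_cartanBar_mem_M`).

Distinct monomials have distinct weights, hence are orthogonal. For the scalar square the factors
ζ^p are inserted one after another. A suitable combination of the matrix coefficients ε(ζ^s) δ_j ψ_j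
is an eigenvector, with eigenvalue α_p, of multiplication of ψ by E. Comparing its values at the two
ends of the matrix product shows that the new factor multiplies the scalar square by ∏ (1 -
1/h̊_ip), over i < p with ν_i = 0 (`exists_coeff`, `coeffSum_ladder`, `exists_sing_Z_mon`). In both
displayed products a pair i < j contributes a factor other than 1 only when ν_i = 0 and ν_j = 1, and
that factor is this one. -/

namespace HGrassmann

/-! ### Generators of the localized algebra -/

/-- The diagonal generator `E_{ij}` in the localized algebra. -/
noncomputable def Eb {n : ℕ} (i j : Fin n) : ABar n := toBar n (E i j)

/-- The odd coordinate in the localized algebra. -/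
noncomputable def Zb {n : ℕ} (i : Fin n) : ABar n := toBar n (zeta i ⊗ₜ 1)

/-- The odd derivative in the localized algebra. -/
noncomputable def Db {n : ℕ} (i : Fin n) : ABar n := toBar n (delta i ⊗ₜ 1)

/-- The Cartan variable `h_i` in the localized polynomial algebra. -/
noncomputable def hvar {n : ℕ} (i : Fin n) : UhBar n :=
  algebraMap (Uh n) (UhBar n) (MvPolynomial.X i)

theorem cartanBar_hvar {n : ℕ} (i : Fin n) : cartanBar n (hvar i) = Eb i i := by
  rw [hvar, cartanBar_algebraMap, cartan_X, Eb]

theorem E_mul_zeta {n : ℕ} (k l j : Fin n) :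
    (E k l : A n) * (zeta j ⊗ₜ 1)
      = (zeta j ⊗ₜ 1) * E k l + if l = j then zeta k ⊗ₜ 1 else 0 := by
  have h1 : zeta k * delta l * zeta j
      = zeta j * (zeta k * delta l) + if l = j then zeta k else 0 := by
    have a' : delta l * zeta j = (if j = l then 1 else 0) - zeta j * delta l :=
      eq_sub_of_add_eq' (zeta_delta j l)
    have b' : zeta k * zeta j = - (zeta j * zeta k) := eq_neg_of_add_eq_zero_left (zeta_zeta k j)
    rw [mul_assoc, a', mul_sub, ← mul_assoc, b']
    by_cases h : l = j
    · subst h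
      simp [mul_assoc]
      abel
    · simp [h, Ne.symm h, mul_assoc]
  simp only [E, add_mul, mul_add, Algebra.TensorProduct.tmul_mul_tmul, one_mul, mul_one, h1,
    TensorProduct.add_tmul]
  split_ifs
  · abel
  · rw [TensorProduct.zero_tmul]; abel

theorem E_mul_delta {n : ℕ} (k l m : Fin n) :
    (E k l : A n) * (delta m ⊗ₜ 1)
      = (delta m ⊗ₜ 1) * E k l - if k = m then delta l ⊗ₜ 1 else 0 := by
  have h1 : zeta k * delta l * delta m
      = delta m * (zeta k * delta l) - if k = m then delta l else 0 := by
    have a' : zeta k * delta m = (if k = m then 1 else 0) - delta m * zeta k :=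
      eq_sub_of_add_eq (zeta_delta k m)
    have b' : delta l * delta m = - (delta m * delta l) :=
      eq_neg_of_add_eq_zero_left (delta_delta l m)
    rw [mul_assoc, b', mul_neg, ← mul_assoc, a', sub_mul]
    by_cases h : k = m
    · subst h; simp [mul_assoc]
    · simp [h, mul_assoc]
  simp only [E, add_mul, mul_add, Algebra.TensorProduct.tmul_mul_tmul, one_mul, mul_one,
    h1, TensorProduct.sub_tmul]
  split_ifs
  · abel
  · rw [TensorProduct.zero_tmul]; abel

theorem E_mul_e {n : ℕ} (k l p q : Fin n) :
    (E k l : A n) * (1 ⊗ₜ e p q)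
      = (1 ⊗ₜ e p q) * E k l + (if l = p then 1 ⊗ₜ e k q else 0)
        - (if q = k then 1 ⊗ₜ e p l else 0) := by
  have h1 : e k l * e p q
      = e p q * e k l + ((if l = p then e k q else 0) - (if q = k then e p l else 0)) :=
    eq_add_of_sub_eq' (e_comm k l p q)
  simp only [E, add_mul, mul_add, Algebra.TensorProduct.tmul_mul_tmul, one_mul, mul_one,
    h1, TensorProduct.tmul_add, TensorProduct.tmul_sub]
  split_ifs <;> try simp
  all_goals abel

theorem E_eq {n : ℕ} (k l : Fin n) :
    (E k l : A n) = (zeta k ⊗ₜ 1) * (delta l ⊗ₜ 1) + 1 ⊗ₜ e k l := by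
  simp [E]

theorem E_comm {n : ℕ} (i j k l : Fin n) :
    (E i j : A n) * E k l
      = E k l * E i j + ((if j = k then E i l else 0) - (if l = i then E k j else 0)) := by
  conv_lhs => rw [E_eq k l]
  conv_rhs => rw [E_eq k l]
  rw [mul_add, E_mul_e, ← mul_assoc, E_mul_zeta, add_mul, mul_assoc, E_mul_delta, add_mul,
    mul_sub]
  have h1 : (if j = k then (E i l : A n) else 0) = (if j = k then zeta i ⊗ₜ 1 else 0) *
      (delta l ⊗ₜ 1) + (if j = k then 1 ⊗ₜ e i l else 0) := by
    split_ifs <;> simp [E_eq]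
  have h2 : (if l = i then (E k j : A n) else 0) = (zeta k ⊗ₜ 1) *
      (if i = l then delta j ⊗ₜ 1 else 0) + (if l = i then 1 ⊗ₜ e k j else 0) := by
    by_cases h : l = i
    · simp [h, E_eq]
    · simp [h, Ne.symm h]
  rw [h1, h2, mul_assoc]
  abel

theorem Eb_comm {n : ℕ} (i j k l : Fin n) :
    (Eb i j : ABar n) * Eb k l
      = Eb k l * Eb i j + ((if j = k then Eb i l else 0) - (if l = i then Eb k j else 0)) := by
  have h := congrArg (toBar n) (E_comm i j k l)
  simpa only [map_mul, map_add, map_sub, apply_ite (toBar n), map_zero, Eb, Zb, Db] using h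

theorem Eb_mul_Zb {n : ℕ} (k l j : Fin n) :
    (Eb k l : ABar n) * Zb j = Zb j * Eb k l + if l = j then Zb k else 0 := by
  have h := congrArg (toBar n) (E_mul_zeta k l j)
  simpa only [map_mul, map_add, map_sub, apply_ite (toBar n), map_zero, Eb, Zb, Db] using h

theorem Eb_mul_Db {n : ℕ} (k l m : Fin n) :
    (Eb k l : ABar n) * Db m = Db m * Eb k l - if k = m then Db l else 0 := by
  have h := congrArg (toBar n) (E_mul_delta k l m)
  simpa only [map_mul, map_add, map_sub, apply_ite (toBar n), map_zero, Eb, Zb, Db] using h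

theorem Zb_mul_Zb {n : ℕ} (i j : Fin n) : (Zb i : ABar n) * Zb j = -(Zb j * Zb i) := by
  rw [Zb, Zb, ← map_mul, ← map_mul, ← map_neg]
  congr 1
  simp only [Algebra.TensorProduct.tmul_mul_tmul, one_mul]
  rw [eq_neg_of_add_eq_zero_left (zeta_zeta i j), TensorProduct.neg_tmul]

theorem Db_mul_Zb {n : ℕ} (i j : Fin n) :
    (Db j : ABar n) * Zb i = (if i = j then 1 else 0) - Zb i * Db j := by
  have h := zeta_delta i j
  have h' : (delta j ⊗ₜ 1 : A n) * (zeta i ⊗ₜ 1)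
      = (if i = j then 1 else 0) - (zeta i ⊗ₜ 1) * (delta j ⊗ₜ 1) := by
    simp only [Algebra.TensorProduct.tmul_mul_tmul, one_mul]
    rw [eq_sub_of_add_eq' h, TensorProduct.sub_tmul]
    split_ifs <;> simp [Algebra.TensorProduct.one_def]
  have h'' := congrArg (toBar n) h'
  simpa only [map_mul, map_sub, apply_ite (toBar n), map_zero, map_one, Zb, Db] using h''

theorem zeta_mul_self {n : ℕ} (i : Fin n) : (zeta i * zeta i : GDiff n) = 0 := by
  have h := zeta_zeta i i
  rw [← two_smul ℂ] at h
  exact (smul_eq_zero.1 h).resolve_left two_ne_zero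

theorem Zb_mul_self {n : ℕ} (i : Fin n) : (Zb i : ABar n) * Zb i = 0 := by
  rw [Zb, ← map_mul, Algebra.TensorProduct.tmul_mul_tmul, zeta_mul_self, TensorProduct.zero_tmul, map_zero]

theorem oreDiv_eq {n : ℕ} (x : ABar n) : ∃ (a : A n) (p : Uh n), p ∈ K n ∧
    toBar n (cartan n p) * x = toBar n a := by
  induction x using OreLocalization.ind with
  | _ r s =>
    obtain ⟨_, p, hp, rfl⟩ := s
    refine ⟨r, p, hp, ?_⟩
    have := OreLocalization.smul_cancel (r := r) (s := (⟨cartan n p, p, hp, rfl⟩ : KA n))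
      (t := (1 : KA n))
    exact this

/-- An additive subgroup stable under left multiplication by generators is everything. -/
theorem left_induction {n : ℕ} (S : AddSubgroup (ABar n)) (one : 1 ∈ S)
    (hZ : ∀ i, ∀ x ∈ S, Zb i * x ∈ S) (hD : ∀ i, ∀ x ∈ S, Db i * x ∈ S)
    (hE : ∀ k l, k ≠ l → ∀ x ∈ S, Eb k l * x ∈ S)
    (hC : ∀ φ, ∀ x ∈ S, cartanBar n φ * x ∈ S) (x : ABar n) : x ∈ S := by
  have key : ∀ a : A n, ∀ x ∈ S, toBar n a * x ∈ S := by
    intro a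
    induction a using A.induction with
    | algebraMap r =>
      intro x hx
      have := hC (algebraMap (Uh n) _ (MvPolynomial.C r)) x hx
      rwa [cartanBar_algebraMap, ← MvPolynomial.algebraMap_eq, AlgHom.commutes] at this
    | zeta i => exact hZ i
    | delta i => exact hD i
    | gen i j =>
      intro x hx
      -- The closure properties concern the diagonal generators, so e_ij is rewritten through E_ij
      -- and the odd generators.
      have h : toBar n (1 ⊗ₜ e i j) = Eb i j - Zb i * Db j := by
        rw [Eb, E_eq, map_add, map_mul, Zb, Db]; abel
      rw [h, sub_mul, mul_assoc]
      refine sub_mem ?_ (hZ _ _ (hD _ _ hx))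
      by_cases hij : i = j
      · subst hij
        rw [← cartanBar_hvar]
        exact hC _ _ hx
      · exact hE _ _ hij _ hx
    | mul a b ha hb => intro x hx; rw [map_mul, mul_assoc]; exact ha _ (hb _ hx)
    | add a b ha hb => intro x hx; rw [map_add, add_mul]; exact add_mem (ha _ hx) (hb _ hx)
  obtain ⟨a, p, hp, h⟩ := oreDiv_eq x
  -- Denominators lie in the Cartan part, so their inverses are among the admissible left factors.
  have h1 : x = cartanBar n (IsLocalization.mk' (UhBar n) 1 ⟨p, hp⟩) * toBar n a := by
    rw [← h, ← mul_assoc, ← cartanBar_algebraMap, ← map_mul]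
    have : IsLocalization.mk' (UhBar n) 1 (⟨p, hp⟩ : K n) * algebraMap (Uh n) (UhBar n) p = 1 := by
      rw [IsLocalization.mk'_spec (UhBar n) 1 (⟨p, hp⟩ : K n), map_one]
    rw [this, map_one, one_mul]
  rw [h1]
  refine hC _ _ ?_
  simpa using key a 1 one

/-! ### Weights -/

/-- `x` is a weight vector of weight `w` for the adjoint action of the Cartan subalgebra. -/
def IsWt {n : ℕ} (w : Fin n → ℤ) (x : ABar n) : Prop :=
  ∀ i, Eb i i * x = x * (Eb i i + (w i : ABar n))

/-- The substitution `h_i ↦ h_i + w_i` on the localized polynomial algebra. -/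
noncomputable def shiftBar {n : ℕ} (w : Fin n → ℤ) : UhBar n →+* UhBar n :=
  IsLocalization.map (UhBar n) (shift w : Uh n →+* Uh n)
    (show K n ≤ (K n).comap (shift w : Uh n →+* Uh n) from fun _ hp => shift_mem w hp)

theorem shiftBar_algebraMap {n : ℕ} (w : Fin n → ℤ) (p : Uh n) :
    shiftBar w (algebraMap _ _ p) = algebraMap (Uh n) (UhBar n) (shift w p) :=
  IsLocalization.map_eq (S := UhBar n) (Q := UhBar n)
    (show K n ≤ (K n).comap (shift w : Uh n →+* Uh n) from fun _ hp => shift_mem w hp) p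

theorem shiftBar_neg {n : ℕ} (w : Fin n → ℤ) (φ : UhBar n) :
    shiftBar w (shiftBar (-w) φ) = φ := by
  have : (shiftBar w).comp (shiftBar (-w)) = RingHom.id (UhBar n) := by
    apply IsLocalization.ringHom_ext (K n)
    refine RingHom.ext fun p => ?_
    simp [shiftBar_algebraMap, shift_neg]
  exact congrArg (fun g : UhBar n →+* UhBar n => g φ) this

/-- For polynomials this is an induction from the weight relation. For a fraction, both sides are
multiplied on the right by the shifted denominator, which is a unit. -/
theorem IsWt.cartanBar_mul {n : ℕ} {w : Fin n → ℤ} {x : ABar n} (hx : IsWt w x) (φ : UhBar n) :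
    cartanBar n φ * x = x * cartanBar n (shiftBar w φ) := by
  have h1 : ∀ p : Uh n, toBar n (cartan n p) * x = x * toBar n (cartan n (shift w p)) := by
    intro p
    induction p using MvPolynomial.induction_on with
    | C r =>
      simp only [shift, MvPolynomial.aeval_C, MvPolynomial.algebraMap_eq]
      rw [← MvPolynomial.algebraMap_eq, AlgHom.commutes]
      have : ∀ a : ABar n, toBar n (algebraMap ℂ (A n) r) * a = a * toBar n (algebraMap ℂ (A n) r) :=
        fun a => Algebra.commutes (A := ABar n) r a
      exact this x
    | add p q hp hq => simp only [map_add, add_mul, mul_add, hp, hq]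
    | mul_X p i hp =>
      rw [map_mul, map_mul, mul_assoc, cartan_X, ← Eb, hx i, ← mul_assoc, hp, map_mul, map_mul,
        map_mul, mul_assoc]
      congr 2
      simp only [shift, MvPolynomial.aeval_X, map_add, cartan_X]
      rw [← MvPolynomial.algebraMap_eq, AlgHom.commutes, map_intCast, map_intCast, Eb]
  obtain ⟨p, s, rfl⟩ := IsLocalization.exists_mk'_eq (K n) φ
  have hs := IsLocalization.mk'_spec (UhBar n) p s
  have hu : IsUnit (cartanBar n (algebraMap _ _ (s : Uh n))) :=
    (IsLocalization.map_units (UhBar n) s).map _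
  have hu' : IsUnit (cartanBar n (shiftBar w (algebraMap _ _ (s : Uh n)))) :=
    ((IsLocalization.map_units (UhBar n) s).map _).map _
  apply hu'.mul_right_cancel
  rw [mul_assoc, mul_assoc, ← map_mul, ← map_mul, hs, shiftBar_algebraMap, shiftBar_algebraMap,
    cartanBar_algebraMap, cartanBar_algebraMap, ← h1, ← h1, ← mul_assoc, ← cartanBar_algebraMap,
    ← map_mul, hs, cartanBar_algebraMap]

/-! ### The anti-involution -/

theorem eps_mul {n : ℕ} (x y : ABar n) : eps (x * y) = eps y * eps x := by
  simp [eps]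

theorem eps_add {n : ℕ} (x y : ABar n) : eps (x + y) = eps x + eps y := by
  simp [eps]

theorem eps_sub {n : ℕ} (x y : ABar n) : eps (x - y) = eps x - eps y := by
  simp [eps]

theorem eps_neg {n : ℕ} (x : ABar n) : eps (-x) = - eps x := by
  simp [eps]

theorem eps_zero {n : ℕ} : eps (0 : ABar n) = 0 := by
  simp [eps]

theorem eps_one {n : ℕ} : eps (1 : ABar n) = 1 := by
  simp [eps]

theorem eps_Eb {n : ℕ} (i j : Fin n) : eps (Eb i j : ABar n) = Eb j i := by
  rw [Eb, eps_toBar, epsA_E]; rfl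

theorem eps_Zb {n : ℕ} (i : Fin n) : eps (Zb i : ABar n) = Db i := by
  rw [Zb, eps_toBar, epsA_tmul]; simp [Db]

theorem eps_Db {n : ℕ} (i : Fin n) : eps (Db i : ABar n) = Zb i := by
  rw [Db, eps_toBar, epsA_tmul]; simp [Zb]

/-- Since the Cartan part is commutative, its embedding is also a homomorphism into the opposite
ring. Two homomorphisms out of a localization need only be compared on polynomials. -/
theorem eps_cartanBar {n : ℕ} (φ : UhBar n) : eps (cartanBar n φ) = cartanBar n φ := by
  have h : (epsHom n).comp (cartanBar n) = (cartanBar n).toOpposite fun x y => by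
      rw [Commute, SemiconjBy, ← map_mul, ← map_mul, mul_comm] := by
    apply IsLocalization.ringHom_ext (K n)
    refine RingHom.ext fun p => ?_
    have h : eps (toBar n (cartan n p)) = toBar n (cartan n p) := by
      rw [eps_toBar, epsA_cartan]; rfl
    rw [RingHom.comp_apply, RingHom.comp_apply, RingHom.comp_apply, cartanBar_algebraMap]
    change MulOpposite.op (eps (toBar n (cartan n p))) = MulOpposite.op (cartanBar n _)
    rw [h, cartanBar_algebraMap]
  have := congrArg (fun g : UhBar n →+* (ABar n)ᵐᵒᵖ => (g φ).unop) h
  exact this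

theorem eps_eps {n : ℕ} (x : ABar n) : eps (eps x) = x := by
  let S : AddSubgroup (ABar n) :=
    { carrier := {x | eps (eps x) = x}
      add_mem' := fun {x y} hx hy => by
        change eps (eps _) = _ at *; rw [eps_add, eps_add, hx, hy]
      zero_mem' := by rw [Set.mem_ofPred_eq, eps_zero, eps_zero]
      neg_mem' := fun {x} hx => by
        change eps (eps _) = _ at *; rw [eps_neg, eps_neg, hx] }
  have hmul : ∀ a x : ABar n, eps (eps a) = a → x ∈ S → a * x ∈ S := by
    intro a x ha hx
    change eps (eps (a * x)) = a * x
    rw [eps_mul, eps_mul, ha, hx]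
  refine left_induction S ?_ ?_ ?_ ?_ ?_ x
  · change eps (eps 1) = 1
    rw [eps_one, eps_one]
  · exact fun i x hx => hmul _ _ (by rw [eps_Zb, eps_Db]) hx
  · exact fun i x hx => hmul _ _ (by rw [eps_Db, eps_Zb]) hx
  · exact fun k l _ x hx => hmul _ _ (by rw [eps_Eb, eps_Eb]) hx
  · exact fun φ x hx => hmul _ _ (by rw [eps_cartanBar, eps_cartanBar]) hx

/-! ### The abstract algebra with odd generators and a diagonal gl_n -/

theorem mem_of_sub_mem {B : Type*} [AddCommGroup B] {H : AddSubgroup B} {a b : B}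
    (h : a - b ∈ H) (hb : b ∈ H) : a ∈ H := by
  simpa using add_mem h hb

/-- The structure of the localized algebra used in the study of its reduction algebra: odd
coordinates `Z`, odd derivatives `D`, a diagonal `gl_n` with generators `E`, a localized Cartan
subalgebra `C : R → B` and an anti-involution `eps`. -/
structure OddAlg (n : ℕ) (R B : Type*) [CommRing R] [Ring B] where
  E : Fin n → Fin n → B
  Z : Fin n → B
  D : Fin n → B
  C : R →+* B
  h : Fin n → R
  shift : (Fin n → ℤ) → R →+* R
  eps : B → B
  E_comm : ∀ i j k l, E i j * E k l
    = E k l * E i j + ((if j = k then E i l else 0) - (if l = i then E k j else 0))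
  E_Z : ∀ k l j, E k l * Z j = Z j * E k l + if l = j then Z k else 0
  E_D : ∀ k l m, E k l * D m = D m * E k l - if k = m then D l else 0
  Z_Z : ∀ i j, Z i * Z j = -(Z j * Z i)
  D_Z : ∀ i j, D j * Z i = (if i = j then 1 else 0) - Z i * D j
  Z_self : ∀ i, Z i * Z i = 0
  C_h : ∀ i, C (h i) = E i i
  C_mul : ∀ (w : Fin n → ℤ) (x : B), (∀ i, E i i * x = x * (E i i + (w i : B))) →
    ∀ φ, C φ * x = x * C (shift w φ)
  shift_neg : ∀ w φ, shift w (shift (-w) φ) = φ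
  -- These denominators make the differences of the ladder eigenvalues invertible.
  isUnit_h : ∀ (i j : Fin n) (k : ℤ), i ≠ j → IsUnit (h i - h j + (k : R))
  eps_add : ∀ x y, eps (x + y) = eps x + eps y
  eps_mul : ∀ x y, eps (x * y) = eps y * eps x
  eps_E : ∀ i j, eps (E i j) = E j i
  eps_Z : ∀ i, eps (Z i) = D i
  eps_D : ∀ i, eps (D i) = Z i
  eps_C : ∀ φ, eps (C φ) = C φ
  eps_eps : ∀ x, eps (eps x) = x
  left_induction : ∀ T : AddSubgroup B, 1 ∈ T → (∀ i, ∀ x ∈ T, Z i * x ∈ T) →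
    (∀ i, ∀ x ∈ T, D i * x ∈ T) → (∀ k l, k ≠ l → ∀ x ∈ T, E k l * x ∈ T) →
    (∀ φ, ∀ x ∈ T, C φ * x ∈ T) → ∀ x, x ∈ T

/-! ### Raising and lowering ideals, vector operators and the ladder -/

namespace OddAlg

variable {n : ℕ} {R B : Type*} [CommRing R] [Ring B] (S : OddAlg n R B)

/-- Weight vectors. -/
def Wt (w : Fin n → ℤ) (x : B) : Prop := ∀ i, S.E i i * x = x * (S.E i i + (w i : B))

variable {S} in
theorem Wt.mul {w w' : Fin n → ℤ} {x y : B} (hx : S.Wt w x) (hy : S.Wt w' y) :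
    S.Wt (w + w') (x * y) := by
  intro i
  have hc : ((w i : ℤ) : B) * y = y * (w i : B) := Int.cast_comm _ _
  rw [← mul_assoc, hx i, mul_assoc, mul_assoc, add_mul, hy i, hc]
  simp only [Pi.add_apply, Int.cast_add, mul_add]
  abel

variable {S} in
theorem Wt.neg {w : Fin n → ℤ} {x : B} (hx : S.Wt w x) : S.Wt w (-x) :=
  fun i => by rw [mul_neg, hx i, neg_mul]

theorem wt_C (φ : R) : S.Wt 0 (S.C φ) := by
  intro i
  rw [← S.C_h, Pi.zero_apply, Int.cast_zero, add_zero, ← map_mul, ← map_mul, mul_comm]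

theorem wt_one : S.Wt 0 (1 : B) := by simpa using S.wt_C 1

theorem wt_Z (k : Fin n) : S.Wt (Pi.single k 1) (S.Z k) := by
  intro i
  rw [S.E_Z, mul_add]
  by_cases h : i = k
  · subst h; simp
  · simp [h]

theorem wt_D (k : Fin n) : S.Wt (-Pi.single k 1) (S.D k) := by
  intro i
  rw [S.E_D, mul_add]
  by_cases h : i = k
  · subst h; simp [sub_eq_add_neg]
  · simp [h]

theorem wt_E (k l : Fin n) : S.Wt (Pi.single k 1 - Pi.single l 1) (S.E k l) := by
  intro i
  rw [S.E_comm, mul_add]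
  congr 1
  simp only [Pi.sub_apply, Pi.single_apply]
  by_cases h : i = k <;> by_cases h' : i = l
  · subst h; subst h'; simp
  · subst h; simp [h', Ne.symm h']
  · subst h'; simp [h]
  · simp [h, h', Ne.symm h']

variable {S} in
theorem Wt.C_mul {w : Fin n → ℤ} {x : B} (hx : S.Wt w x) (φ : R) :
    S.C φ * x = x * S.C (S.shift w φ) := S.C_mul w x hx φ

variable {S} in
theorem Wt.mul_C {w : Fin n → ℤ} {x : B} (hx : S.Wt w x) (φ : R) :
    x * S.C φ = S.C (S.shift (-w) φ) * x := by rw [hx.C_mul, S.shift_neg]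

/-! ### The ideals generated by the nilpotent subalgebras -/

/-- The left ideal generated by the raising operators. -/
def Jp : AddSubgroup B := AddSubgroup.closure {x | ∃ a i j, i < j ∧ x = a * S.E i j}

/-- The right ideal generated by the lowering operators. -/
def Jm : AddSubgroup B := AddSubgroup.closure {x | ∃ a i j, j < i ∧ x = S.E i j * a}

theorem mul_E_mem_Jp (a : B) {i j : Fin n} (h : i < j) : a * S.E i j ∈ S.Jp :=
  AddSubgroup.subset_closure ⟨a, i, j, h, rfl⟩

theorem E_mul_mem_Jm (a : B) {i j : Fin n} (h : j < i) : S.E i j * a ∈ S.Jm :=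
  AddSubgroup.subset_closure ⟨a, i, j, h, rfl⟩

theorem mul_mem_Jp (a : B) {x : B} (hx : x ∈ S.Jp) : a * x ∈ S.Jp := by
  induction hx using AddSubgroup.closure_induction with
  | mem x hx =>
    obtain ⟨b, i, j, hij, rfl⟩ := hx
    rw [← mul_assoc]; exact S.mul_E_mem_Jp _ hij
  | zero => simp
  | add x y _ _ hx hy => rw [mul_add]; exact add_mem hx hy
  | neg x _ hx => rw [mul_neg]; exact neg_mem hx

theorem Jm_mul_mem (a : B) {x : B} (hx : x ∈ S.Jm) : x * a ∈ S.Jm := by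
  induction hx using AddSubgroup.closure_induction with
  | mem x hx =>
    obtain ⟨b, i, j, hij, rfl⟩ := hx
    rw [mul_assoc]; exact S.E_mul_mem_Jm _ hij
  | zero => simp
  | add x y _ _ hx hy => rw [add_mul]; exact add_mem hx hy
  | neg x _ hx => rw [neg_mul]; exact neg_mem hx

theorem Jp_mul_C (φ : R) {x : B} (hx : x ∈ S.Jp) : x * S.C φ ∈ S.Jp := by
  induction hx using AddSubgroup.closure_induction with
  | mem x hx =>
    obtain ⟨b, i, j, hij, rfl⟩ := hx
    rw [mul_assoc, (S.wt_E i j).mul_C, ← mul_assoc]; exact S.mul_E_mem_Jp _ hij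
  | zero => simp
  | add x y _ _ hx hy => rw [add_mul]; exact add_mem hx hy
  | neg x _ hx => rw [neg_mul]; exact neg_mem hx

theorem C_mul_Jm (φ : R) {x : B} (hx : x ∈ S.Jm) : S.C φ * x ∈ S.Jm := by
  induction hx using AddSubgroup.closure_induction with
  | mem x hx =>
    obtain ⟨b, i, j, hij, rfl⟩ := hx
    rw [← mul_assoc, (S.wt_E i j).C_mul, mul_assoc]; exact S.E_mul_mem_Jm _ hij
  | zero => simp
  | add x y _ _ hx hy => rw [mul_add]; exact add_mem hx hy
  | neg x _ hx => rw [mul_neg]; exact neg_mem hx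

/-- `b` is a singular vector modulo the left ideal of raising operators. -/
def Sing (b : B) : Prop := ∀ k l, k < l → S.E k l * b ∈ S.Jp

variable {S} in
-- As `Jp` is a left ideal, a test on the generators of n₊ suffices: singular elements normalize the
-- whole ideal.
theorem Sing.Jp_mul {b : B} (hb : S.Sing b) {x : B} (hx : x ∈ S.Jp) : x * b ∈ S.Jp := by
  induction hx using AddSubgroup.closure_induction with
  | mem x hx =>
    obtain ⟨a, i, j, hij, rfl⟩ := hx
    rw [mul_assoc]; exact S.mul_mem_Jp _ (hb i j hij)
  | zero => simp
  | add x y _ _ hx hy => rw [add_mul]; exact add_mem hx hy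
  | neg x _ hx => rw [neg_mul]; exact neg_mem hx

theorem sing_of_mem_Jp {b : B} (hb : b ∈ S.Jp) : S.Sing b := fun _ _ _ => S.mul_mem_Jp _ hb

theorem sing_C (φ : R) : S.Sing (S.C φ) := fun k l hkl => by
  rw [(S.wt_E k l).mul_C]; exact S.mul_E_mem_Jp _ hkl

variable {S} in
theorem Sing.mul {a b : B} (ha : S.Sing a) (hb : S.Sing b) : S.Sing (a * b) := fun k l hkl => by
  rw [← mul_assoc]; exact hb.Jp_mul (ha k l hkl)

variable {S} in
theorem Sing.add {a b : B} (ha : S.Sing a) (hb : S.Sing b) : S.Sing (a + b) := fun k l hkl => by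
  rw [mul_add]; exact add_mem (ha k l hkl) (hb k l hkl)

variable {S} in
theorem Sing.neg {a : B} (ha : S.Sing a) : S.Sing (-a) := fun k l hkl => by
  rw [mul_neg]; exact neg_mem (ha k l hkl)

/-! ### Vector operators -/

/-- `ψ` is a vector operator for the matrix `F` modulo the left ideal of raising operators. -/
structure IsVec (F : Fin n → Fin n → B) (η : Fin n → R) (ψ : Fin n → B) : Prop where
  raise : ∀ k l j, k < l → F k l * ψ j - (if l = j then ψ k else 0) ∈ S.Jp
  wt : ∀ k j, F k k * ψ j = ψ j * S.C (η k + if k = j then 1 else 0)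

/-- Multiplication of a vector operator by the matrix `F - c`. -/
def step (F : Fin n → Fin n → B) (c : R) (ψ : Fin n → B) (j : Fin n) : B :=
  ∑ i, F j i * ψ i - ψ j * S.C c

variable {S} {F : Fin n → Fin n → B} {η : Fin n → R} {ψ : Fin n → B}

/-- Commuting F_kl past row j of F yields two terms. One is the vector law of the new family; the
other, F_jl ψ_k, cancels against the vector law of ψ inside the sum. The Cartan factor acts on the
right and disturbs nothing. -/
theorem IsVec.step (hF : ∀ i j k l, F i j * F k l
      = F k l * F i j + ((if j = k then F i l else 0) - (if l = i then F k j else 0)))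
    (h : S.IsVec F η ψ) (c : R) : S.IsVec F η (S.step F c ψ) := by
  have key : ∀ k l j, F k l * ∑ i, F j i * ψ i = ∑ i, F j i * (F k l * ψ i)
      + (if l = j then ∑ i, F k i * ψ i else 0) - F j l * ψ k := by
    intro k l j
    have : ∀ i, F k l * (F j i * ψ i) = F j i * (F k l * ψ i)
        + (if l = j then F k i * ψ i else 0) - (if i = k then F j l * ψ i else 0) := by
      intro i
      rw [← mul_assoc, hF, add_mul, sub_mul, mul_assoc]
      split_ifs <;> simp [add_assoc, sub_eq_add_neg]
    rw [Finset.mul_sum, Finset.sum_congr rfl fun i _ => this i, Finset.sum_sub_distrib,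
      Finset.sum_add_distrib]
    congr 1
    · congr 1
      split_ifs <;> simp
    · simp
  refine ⟨fun k l j hkl => ?_, fun k j => ?_⟩
  -- The defect of the new family is a combination of defects of ψ, with left coefficients and a
  -- Cartan factor on the right; `Jp` is stable under both.
  · have h1 : F k l * S.step F c ψ j - (if l = j then S.step F c ψ k else 0)
        = ∑ i, F j i * (F k l * ψ i - if l = i then ψ k else 0)
          - (F k l * ψ j - if l = j then ψ k else 0) * S.C c := by
      have h2 : ∑ i, F j i * (F k l * ψ i - if l = i then ψ k else 0)
          = ∑ i, F j i * (F k l * ψ i) - F j l * ψ k := by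
        simp only [mul_sub, Finset.sum_sub_distrib]
        congr 1
        simp
      rw [h2]
      simp only [OddAlg.step, mul_sub, key, sub_mul, mul_assoc]
      split_ifs
      · abel
      · simp only [zero_mul]; abel
    rw [h1]
    refine sub_mem (sum_mem fun i _ => S.mul_mem_Jp _ (h.raise k l i hkl))
      (S.Jp_mul_C _ (h.raise k l j hkl))
  · simp only [OddAlg.step, mul_sub, key, h.wt k]
    have h2 : ∑ i, F j i * (ψ i * S.C (η k + if k = i then 1 else 0))
        = (∑ i, F j i * ψ i) * S.C (η k) + F j k * ψ k := by
      simp only [map_add, mul_add, Finset.sum_add_distrib, Finset.sum_mul, mul_assoc,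
        apply_ite S.C, map_one, map_zero]
      congr 1
      simp
    have h3 : F k k * (ψ j * S.C c) = ψ j * S.C c * S.C (η k + if k = j then 1 else 0) := by
      rw [← mul_assoc, h.wt, mul_assoc, mul_assoc, ← map_mul, ← map_mul, mul_comm c]
    rw [h2, h3, sub_mul, add_sub_right_comm, add_sub_cancel_right]
    congr 1
    rw [map_add, mul_add]
    congr 1
    split_ifs with hkj
    · subst hkj; simp
    · simp

variable (η) in
/-- The eigenvalues of the ladder. -/
def alpha (j : Fin n) : R := η j + 1 + ((n - 1 - (j : ℕ) : ℕ) : R)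

variable (η) in
/-- The eigenvalues of the ladder, indexed by natural numbers. -/
def alphaNat (p : ℕ) : R := if h : p < n then alpha η ⟨p, h⟩ else 0

theorem alphaNat_val (j : Fin n) : alphaNat η j = alpha η j := by
  simp [alphaNat]

/-- Modulo `Jp` the matrix F acts on ψ triangularly. Each entry F_ji with i > j is a raising
operator that turns ψ_i into ψ_j. There are n - 1 - j of these, and together with the diagonal
contribution η_j + 1 they make up `alpha η j`. -/
theorem IsVec.sum_sub_mem (h : S.IsVec F η ψ) (j : Fin n) :
    ∑ i, F j i * ψ i - (∑ i ∈ Finset.Iio j, F j i * ψ i + ψ j * S.C (alpha η j)) ∈ S.Jp := by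
  have h1 : ∑ i ∈ Finset.Iio j, F j i * ψ i + ψ j * S.C (alpha η j)
      = ∑ i, if i < j then F j i * ψ i else if i = j then ψ j * S.C (η j + 1) else ψ j := by
    rw [Finset.sum_ite, Finset.sum_ite]
    have e1 : Finset.univ.filter (fun i => i < j) = Finset.Iio j := by ext; simp
    have e2 : (Finset.univ.filter (fun i => ¬ i < j)).filter (fun i => i = j) = {j} := by
      ext i; simp only [Finset.mem_filter, Finset.mem_univ, Finset.mem_singleton]
      constructor
      · exact fun h => h.2
      · rintro rfl; simp
    have e3 : (Finset.univ.filter (fun i => ¬ i < j)).filter (fun i => ¬ i = j)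
        = Finset.Ioi j := by
      ext i; simp only [Finset.mem_filter, Finset.mem_univ, Finset.mem_Ioi, true_and, not_lt]
      exact ⟨fun h => lt_of_le_of_ne h.1 (Ne.symm h.2), fun h => ⟨h.le, h.ne'⟩⟩
    rw [e1, e2, e3, Finset.sum_singleton, Finset.sum_const, Fin.card_Ioi, nsmul_eq_mul, alpha,
      map_add, mul_add, map_natCast, (Nat.cast_commute _ (ψ j)).eq]
  rw [h1, ← Finset.sum_sub_distrib]
  refine sum_mem fun i _ => ?_
  split_ifs with h2 h3
  · simp
  · subst h3
    rw [h.wt, if_pos rfl, sub_self]; exact zero_mem _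
  · have := h.raise j i i (lt_of_le_of_ne (not_lt.1 h2) (Ne.symm h3))
    rwa [if_pos rfl] at this

variable (S F η ψ) in
/-- The successive multiplications of a vector operator by `F - α_0`, `F - α_1`, …. -/
def ladder : ℕ → Fin n → B
  | 0 => ψ
  | p + 1 => S.step F (alphaNat η p) (ladder p)

theorem IsVec.ladder (hF : ∀ i j k l, F i j * F k l
      = F k l * F i j + ((if j = k then F i l else 0) - (if l = i then F k j else 0)))
    (h : S.IsVec F η ψ) (p : ℕ) : S.IsVec F η (S.ladder F η ψ p) := by
  induction p with
  | zero => exact h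
  | succ p ih => exact ih.step hF _

/-- As in the Cayley–Hamilton theorem for a triangular matrix, once the components before p are gone
the factor F - α_p annihilates component p and revives none of the earlier ones. -/
theorem ladder_mem_Jp (hF : ∀ i j k l, F i j * F k l
      = F k l * F i j + ((if j = k then F i l else 0) - (if l = i then F k j else 0)))
    (h : S.IsVec F η ψ) {p : ℕ} {i : Fin n} (hi : (i : ℕ) < p) : S.ladder F η ψ p i ∈ S.Jp := by
  induction p generalizing i with
  | zero => exact absurd hi (Nat.not_lt_zero _)
  | succ p ih =>
    have hv := h.ladder hF p
    set φ := S.ladder F η ψ p with hφ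
    have h1 := hv.sum_sub_mem i
    have h2 : S.ladder F η ψ (p + 1) i
        = (∑ j, F i j * φ j - (∑ j ∈ Finset.Iio i, F i j * φ j + φ i * S.C (alpha η i)))
          + (∑ j ∈ Finset.Iio i, F i j * φ j + φ i * S.C (alpha η i - alphaNat η p)) := by
      rw [OddAlg.ladder, ← hφ, OddAlg.step, map_sub, mul_sub]
      abel
    rw [h2]
    refine add_mem h1 (add_mem (sum_mem fun j hj => S.mul_mem_Jp _ (ih ?_)) ?_)
    · have : j < i := Finset.mem_Iio.1 hj
      omega
    · rcases Nat.lt_succ_iff_lt_or_eq.1 hi with hi | hi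
      · exact S.Jp_mul_C _ (ih hi)
      · rw [← hi, alphaNat_val, sub_self, map_zero, mul_zero]
        exact zero_mem _

/-- A raising operator can send component j only to an earlier component, and after j steps these
have vanished modulo `Jp`. -/
theorem ladder_self_raise (hF : ∀ i j k l, F i j * F k l
      = F k l * F i j + ((if j = k then F i l else 0) - (if l = i then F k j else 0)))
    (h : S.IsVec F η ψ) (j k l : Fin n) (hkl : k < l) :
    F k l * S.ladder F η ψ j j ∈ S.Jp := by
  have h1 := (h.ladder hF j).raise k l j hkl
  by_cases hl : l = j
  · rw [if_pos hl] at h1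
    subst hl
    exact mem_of_sub_mem h1 (ladder_mem_Jp hF h hkl)
  · rwa [if_neg hl, sub_zero] at h1

/-- By `sum_sub_mem` the raising and diagonal entries of F reduce to Cartan factors on the right, so
stability has to be assumed only for these factors and for the lowering entries. -/
theorem ladder_mem (hF : ∀ i j k l, F i j * F k l
      = F k l * F i j + ((if j = k then F i l else 0) - (if l = i then F k j else 0)))
    (h : S.IsVec F η ψ) (X : Fin n → AddSubgroup B) (hJ : ∀ i, S.Jp ≤ X i)
    (hC : ∀ i, ∀ x ∈ X i, ∀ φ, x * S.C φ ∈ X i)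
    (hX : ∀ i j, i < j → ∀ x ∈ X i, F j i * x ∈ X j) (hψ : ∀ i, ψ i ∈ X i) (p : ℕ) (j : Fin n) :
    S.ladder F η ψ p j ∈ X j := by
  induction p generalizing j with
  | zero => exact hψ j
  | succ p ih =>
    have hv := (h.ladder hF p).sum_sub_mem j
    rw [OddAlg.ladder, OddAlg.step]
    refine sub_mem ?_ (hC _ _ (ih j) _)
    refine mem_of_sub_mem (hJ j hv) ?_
    exact add_mem (sum_mem fun i hi => hX i j (Finset.mem_Iio.1 hi) _ (ih i)) (hC _ _ (ih j) _)

/-- The diagonal of the triangular action produces the leading term; every other term carries a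
lowering entry on the left and is absorbed by `Y`. The families `X` and `Y` stay abstract because
three choices are needed: the filtration, the tail ideals of the δ_k, and lowering operators with
bounded row. -/
theorem ladder_sub_mem (hF : ∀ i j k l, F i j * F k l
      = F k l * F i j + ((if j = k then F i l else 0) - (if l = i then F k j else 0)))
    (h : S.IsVec F η ψ) (X : Fin n → AddSubgroup B) (hJ : ∀ i, S.Jp ≤ X i)
    (hC : ∀ i, ∀ x ∈ X i, ∀ φ, x * S.C φ ∈ X i)
    (hX : ∀ i j, i < j → ∀ x ∈ X i, F j i * x ∈ X j) (hψ : ∀ i, ψ i ∈ X i)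
    (Y : Fin n → AddSubgroup B) (hJY : ∀ i, S.Jp ≤ Y i)
    (hCY : ∀ i, ∀ x ∈ Y i, ∀ φ, x * S.C φ ∈ Y i)
    (hXY : ∀ i j, i < j → ∀ x ∈ X i, F j i * x ∈ Y j) (p : ℕ) (j : Fin n) :
    S.ladder F η ψ p j - ψ j * S.C (∏ k ∈ Finset.range p, (alpha η j - alphaNat η k)) ∈ Y j := by
  induction p with
  | zero => simp [OddAlg.ladder]
  | succ p ih =>
    have hv := (h.ladder hF p).sum_sub_mem j
    set φ := S.ladder F η ψ p with hφ
    have h2 : S.ladder F η ψ (p + 1) j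
        - ψ j * S.C (∏ k ∈ Finset.range (p + 1), (alpha η j - alphaNat η k))
        = (∑ i, F j i * φ i - (∑ i ∈ Finset.Iio j, F j i * φ i + φ j * S.C (alpha η j)))
          + (∑ i ∈ Finset.Iio j, F j i * φ i
          + (φ j - ψ j * S.C (∏ k ∈ Finset.range p, (alpha η j - alphaNat η k)))
            * S.C (alpha η j - alphaNat η p)) := by
      rw [OddAlg.ladder, ← hφ, OddAlg.step, sub_mul, Finset.prod_range_succ, map_mul, mul_assoc,
        map_sub _ (alpha η j), mul_sub (φ j)]
      abel
    rw [h2]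
    refine add_mem (hJY j hv) (add_mem (sum_mem fun i hi => ?_) (hCY _ _ ih _))
    exact hXY i j (Finset.mem_Iio.1 hi) _ (ladder_mem hF h X hJ hC hX hψ p i)

end OddAlg
-- Singular vectors with a given leading term, and singular representatives of double cosets
namespace OddAlg

variable {n : ℕ} {R B : Type*} [CommRing R] [Ring B] {S : OddAlg n R B}

section ExistsSing

variable {F : Fin n → Fin n → B} {η : Fin n → R} {ψ : Fin n → B}

theorem isUnit_alpha_sub (hη : ∀ i j, i ≠ j → ∃ a b, a ≠ b ∧ ∃ m : ℤ, η i - η j = S.h a - S.h b + m)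
    {i j : Fin n} (hij : i ≠ j) : IsUnit (alpha η i - alpha η j) := by
  obtain ⟨a, b, hab, m, hm⟩ := hη i j hij
  have : alpha η i - alpha η j
      = S.h a - S.h b + ((m + (n - 1 - (i : ℕ) : ℕ) - (n - 1 - (j : ℕ) : ℕ) : ℤ) : R) := by
    simp only [alpha, Int.cast_sub, Int.cast_add, Int.cast_natCast]
    linear_combination hm
  rw [this]
  exact S.isUnit_h a b _ hab

theorem isUnit_prod_alpha
    (hη : ∀ i j, i ≠ j → ∃ a b, a ≠ b ∧ ∃ m : ℤ, η i - η j = S.h a - S.h b + m) (j : Fin n) :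
    IsUnit (∏ k ∈ Finset.range j, (alpha η j - alphaNat η k)) := by
  rw [IsUnit.prod_iff]
  intro k hk
  have hk' : k < j := Finset.mem_range.1 hk
  have hkn : k < n := hk'.trans j.2
  have : alphaNat η k = alpha η ⟨k, hkn⟩ := alphaNat_val (η := η) ⟨k, hkn⟩
  rw [this]
  refine isUnit_alpha_sub hη fun h => ?_
  rw [h] at hk'
  exact lt_irrefl _ hk'

/-- The vector is the j-th component after j steps of the ladder, divided on the right by ∏_{k<j}
(α_j - α_k). A Cartan factor on the right preserves `Jp`, hence singularity. -/
theorem IsVec.exists_sing (hF : ∀ i j k l, F i j * F k l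
      = F k l * F i j + ((if j = k then F i l else 0) - (if l = i then F k j else 0)))
    (hη : ∀ i j, i ≠ j → ∃ a b, a ≠ b ∧ ∃ m : ℤ, η i - η j = S.h a - S.h b + m)
    (h : S.IsVec F η ψ) (X : Fin n → AddSubgroup B) (hJ : ∀ i, S.Jp ≤ X i)
    (hC : ∀ i, ∀ x ∈ X i, ∀ φ, x * S.C φ ∈ X i)
    (hX : ∀ i j, i < j → ∀ x ∈ X i, F j i * x ∈ X j) (hψ : ∀ i, ψ i ∈ X i)
    (Y : Fin n → AddSubgroup B) (hJY : ∀ i, S.Jp ≤ Y i)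
    (hCY : ∀ i, ∀ x ∈ Y i, ∀ φ, x * S.C φ ∈ Y i)
    (hXY : ∀ i j, i < j → ∀ x ∈ X i, F j i * x ∈ Y j) (j : Fin n) :
    ∃ b, (∀ k l, k < l → F k l * b ∈ S.Jp) ∧
      (∀ k, F k k * b = b * S.C (η k + if k = j then 1 else 0)) ∧ b ∈ X j ∧ b - ψ j ∈ Y j := by
  obtain ⟨u, hu⟩ := isUnit_prod_alpha hη j
  refine ⟨S.ladder F η ψ j j * S.C (u⁻¹ : Rˣ), fun k l hkl => ?_, fun k => ?_, ?_, ?_⟩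
  · rw [← mul_assoc]
    exact S.Jp_mul_C _ (ladder_self_raise hF h j k l hkl)
  · rw [← mul_assoc, (h.ladder hF _).wt, mul_assoc, mul_assoc, ← map_mul, ← map_mul, mul_comm]
  · exact hC _ _ (ladder_mem hF h X hJ hC hX hψ _ _) _
  · have h1 := hCY _ _ (ladder_sub_mem hF h X hJ hC hX hψ Y hJY hCY hXY j j) (u⁻¹ : Rˣ)
    rwa [← hu, sub_mul, mul_assoc, ← map_mul, Units.mul_inv, map_one, mul_one] at h1

end ExistsSing

/-! ### The two standard vector operators -/

variable (S) in
/-- The matrix of the dual vector operators. -/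
def dualE (i j : Fin n) : B := -S.E j.rev i.rev

variable (S) in
-- The negative transpose preserves the gl_n relations but exchanges raising and lowering. Reversing
-- the indices restores the order, so the ladder applies to the δ_j as well.
theorem dualE_comm (i j k l : Fin n) : S.dualE i j * S.dualE k l
      = S.dualE k l * S.dualE i j
        + ((if j = k then S.dualE i l else 0) - (if l = i then S.dualE k j else 0)) := by
  simp only [dualE, neg_mul_neg]
  rw [S.E_comm]
  congr 1
  simp only [Fin.rev_inj]
  by_cases h1 : j = k <;> by_cases h2 : l = i
  · subst h1; subst h2; simp; abel
  · subst h1; simp [h2, Ne.symm h2]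
  · subst h2; simp [h1, Ne.symm h1]
  · simp [h1, h2, Ne.symm h1, Ne.symm h2]

variable (S) in
/-- The Cartan eigenvalues of a vector operator obtained from a vector of weight `w`. -/
def vecEta (w : Fin n → ℤ) (k : Fin n) : R := S.h k + (w k : R)

variable (S) in
/-- The Cartan eigenvalues of a dual vector operator obtained from a vector of weight `w`. -/
def dualEta (w : Fin n → ℤ) (k : Fin n) : R := -(S.h k.rev + (w k.rev : R))

theorem Wt.E_mul {w : Fin n → ℤ} {x : B} (hx : S.Wt w x) (k : Fin n) :
    S.E k k * x = x * S.C (S.h k + (w k : R)) := by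
  rw [hx, map_add, S.C_h, map_intCast]

theorem isVec_Z {w : Fin n → ℤ} {x : B} (hx : S.Sing x) (hw : S.Wt w x) :
    S.IsVec S.E (S.vecEta w) (fun j => S.Z j * x) where
  raise k l j hkl := by
    have : S.E k l * (S.Z j * x) - (if l = j then S.Z k * x else 0) = S.Z j * (S.E k l * x) := by
      rw [← mul_assoc, S.E_Z, add_mul, mul_assoc]
      split_ifs <;> simp
    rw [this]
    exact S.mul_mem_Jp _ (hx k l hkl)
  wt k j := by
    rw [← mul_assoc, S.E_Z, add_mul, mul_assoc, hw.E_mul, vecEta, map_add S.C (_ + _), mul_add,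
      ← mul_assoc]
    by_cases h : k = j
    · subst h; simp
    · simp [h]

theorem isVec_D {w : Fin n → ℤ} {x : B} (hx : S.Sing x) (hw : S.Wt w x) :
    S.IsVec S.dualE (S.dualEta w) (fun j => S.D j.rev * x) where
  raise k l j hkl := by
    have : S.dualE k l * (S.D j.rev * x) - (if l = j then S.D k.rev * x else 0)
        = -(S.D j.rev * (S.E l.rev k.rev * x)) := by
      rw [dualE, ← mul_assoc, neg_mul, S.E_D, neg_mul, sub_mul, mul_assoc]
      by_cases h : l = j
      · simp [h]
      · simp [h]
    rw [this]
    exact neg_mem (S.mul_mem_Jp _ (hx _ _ (Fin.rev_lt_rev.2 hkl)))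
  wt k j := by
    rw [dualE, neg_mul, ← mul_assoc, S.E_D, sub_mul, mul_assoc, hw.E_mul, dualEta,
      map_add S.C (-_), map_neg, mul_add, ← mul_assoc, mul_neg]
    by_cases h : k = j
    · subst h; simp; abel
    · simp [h]

theorem vecEta_sub (w : Fin n → ℤ) (i j : Fin n) (hij : i ≠ j) :
    ∃ a b, a ≠ b ∧ ∃ m : ℤ, S.vecEta w i - S.vecEta w j = S.h a - S.h b + m :=
  ⟨i, j, hij, w i - w j, by simp only [vecEta, Int.cast_sub]; ring⟩

theorem dualEta_sub (w : Fin n → ℤ) (i j : Fin n) (hij : i ≠ j) :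
    ∃ a b, a ≠ b ∧ ∃ m : ℤ, S.dualEta w i - S.dualEta w j = S.h a - S.h b + m :=
  ⟨j.rev, i.rev, fun h => hij (Fin.rev_inj.1 h).symm, w j.rev - w i.rev, by
    simp only [dualEta, Int.cast_sub]; ring⟩

theorem wt_of_E_mul {w : Fin n → ℤ} {x : B}
    (h : ∀ k, S.E k k * x = x * S.C (S.h k + (w k : R))) : S.Wt w x := fun k => by
  rw [h, map_add, S.C_h, map_intCast]

/-- The singular vector with leading term `ζ^j x`. -/
theorem exists_sing_Z {w : Fin n → ℤ} {x : B} (hx : S.Sing x) (hw : S.Wt w x)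
    (X : Fin n → AddSubgroup B) (hJ : ∀ i, S.Jp ≤ X i)
    (hC : ∀ i, ∀ x ∈ X i, ∀ φ, x * S.C φ ∈ X i)
    (hX : ∀ i j, i < j → ∀ x ∈ X i, S.E j i * x ∈ X j) (hψ : ∀ i, S.Z i * x ∈ X i)
    (Y : Fin n → AddSubgroup B) (hJY : ∀ i, S.Jp ≤ Y i)
    (hCY : ∀ i, ∀ x ∈ Y i, ∀ φ, x * S.C φ ∈ Y i)
    (hXY : ∀ i j, i < j → ∀ x ∈ X i, S.E j i * x ∈ Y j) (j : Fin n) :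
    ∃ b, S.Sing b ∧ S.Wt (w + Pi.single j 1) b ∧ b ∈ X j ∧ b - S.Z j * x ∈ Y j := by
  obtain ⟨b, hb, hbw, hbX, hbY⟩ := (isVec_Z hx hw).exists_sing S.E_comm (vecEta_sub w) X hJ hC hX
    hψ Y hJY hCY hXY j
  refine ⟨b, hb, wt_of_E_mul fun k => ?_, hbX, hbY⟩
  rw [hbw, vecEta, add_assoc]
  congr 3
  by_cases h : k = j
  · subst h; simp
  · simp [h]

/-- The singular vector with leading term `δ_j x`. -/
theorem exists_sing_D {w : Fin n → ℤ} {x : B} (hx : S.Sing x) (hw : S.Wt w x)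
    (X : Fin n → AddSubgroup B) (hJ : ∀ i, S.Jp ≤ X i)
    (hC : ∀ i, ∀ x ∈ X i, ∀ φ, x * S.C φ ∈ X i)
    (hX : ∀ i j, i < j → ∀ x ∈ X j, S.E j i * x ∈ X i) (hψ : ∀ i, S.D i * x ∈ X i)
    (Y : Fin n → AddSubgroup B) (hJY : ∀ i, S.Jp ≤ Y i)
    (hCY : ∀ i, ∀ x ∈ Y i, ∀ φ, x * S.C φ ∈ Y i)
    (hXY : ∀ i j, i < j → ∀ x ∈ X j, S.E j i * x ∈ Y i) (j : Fin n) :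
    ∃ b, S.Sing b ∧ S.Wt (w - Pi.single j 1) b ∧ b ∈ X j ∧ b - S.D j * x ∈ Y j := by
  -- With reversed indices a lowering entry of `dualE` is, up to sign, a lowering operator E_ji with
  -- i < j, now leading from component j to component i.
  obtain ⟨b, hb, hbw, hbX, hbY⟩ := (isVec_D hx hw).exists_sing S.dualE_comm (dualEta_sub w)
    (fun i => X i.rev) (fun i => hJ _) (fun i => hC _)
    (fun i k hik y hy => by
      rw [dualE, neg_mul]
      exact neg_mem (hX _ _ (Fin.rev_lt_rev.2 hik) _ hy)) (fun i => hψ _)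
    (fun i => Y i.rev) (fun i => hJY _) (fun i => hCY _)
    (fun i k hik y hy => by
      rw [dualE, neg_mul]
      exact neg_mem (hXY _ _ (Fin.rev_lt_rev.2 hik) _ hy)) j.rev
  rw [Fin.rev_rev] at hbX hbY
  refine ⟨b, fun k l hkl => ?_, wt_of_E_mul fun k => ?_, hbX, hbY⟩
  · have := hb l.rev k.rev (Fin.rev_lt_rev.2 hkl)
    rwa [dualE, Fin.rev_rev, Fin.rev_rev, neg_mul, neg_mem_iff] at this
  · have := hbw k.rev
    rw [dualE, dualEta, Fin.rev_rev, neg_mul, neg_eq_iff_eq_neg, ← mul_neg, ← map_neg] at this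
    rw [this]
    congr 2
    by_cases h : k = j
    · subst h; simp; ring
    · simp [h]

/-! ### A filtration of the algebra -/

variable (S) in
/-- The filtration of the algebra by the number of odd generators, modulo raising operators. -/
inductive Filt : ℕ → B → Prop
  | jp {m : ℕ} {x : B} : x ∈ S.Jp → Filt m x
  | cartan {m : ℕ} (φ : R) : Filt m (S.C φ)
  | add {m : ℕ} {x y : B} : Filt m x → Filt m y → Filt m (x + y)
  | neg {m : ℕ} {x : B} : Filt m x → Filt m (-x)
  | lower {m : ℕ} {k l : Fin n} {x : B} : l < k → Filt m x → Filt m (S.E k l * x)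
  | zeta {m : ℕ} (j : Fin n) {x : B} : Filt m x → Filt (m + 1) (S.Z j * x)
  | delta {m : ℕ} (j : Fin n) {x : B} : Filt m x → Filt (m + 1) (S.D j * x)

variable (S) in
/-- The filtration as a family of additive subgroups. -/
def filt (m : ℕ) : AddSubgroup B where
  carrier := {x | S.Filt m x}
  add_mem' := Filt.add
  zero_mem' := Filt.jp (zero_mem _)
  neg_mem' := Filt.neg

theorem Filt.mul_C {m : ℕ} {x : B} (hx : S.Filt m x) (φ : R) : S.Filt m (x * S.C φ) := by
  induction hx with
  | jp h => exact .jp (S.Jp_mul_C _ h)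
  | cartan φ' => rw [← map_mul]; exact .cartan _
  | add _ _ hx hy => rw [add_mul]; exact hx.add hy
  | neg _ hx => rw [neg_mul]; exact hx.neg
  | lower h _ hx => rw [mul_assoc]; exact .lower h hx
  | zeta j _ hx => rw [mul_assoc]; exact .zeta j hx
  | delta j _ hx => rw [mul_assoc]; exact .delta j hx

theorem Filt.C_mul {m : ℕ} {x : B} (hx : S.Filt m x) (φ : R) : S.Filt m (S.C φ * x) := by
  induction hx generalizing φ with
  | jp h => exact .jp (S.mul_mem_Jp _ h)
  | cartan φ' => rw [← map_mul]; exact .cartan _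
  | add _ _ hx hy => rw [mul_add]; exact (hx φ).add (hy φ)
  | neg _ hx => rw [mul_neg]; exact (hx φ).neg
  | lower h _ hx => rw [← mul_assoc, (S.wt_E _ _).C_mul, mul_assoc]; exact .lower h (hx _)
  | zeta j _ hx => rw [← mul_assoc, (S.wt_Z _).C_mul, mul_assoc]; exact .zeta j (hx _)
  | delta j _ hx => rw [← mul_assoc, (S.wt_D _).C_mul, mul_assoc]; exact .delta j (hx _)

theorem Filt.sub {m : ℕ} {x y : B} (hx : S.Filt m x) (hy : S.Filt m y) : S.Filt m (x - y) :=
  sub_mem (S := AddSubgroup B) (H := S.filt m) hx hy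

/-- Commutators of E_kl with lowering operators and odd generators do not increase the number of odd
generators, and a raising operator that arrives at the right end falls into `Jp`. -/
theorem Filt.E_mul {m : ℕ} {x : B} (hx : S.Filt m x) (k l : Fin n) :
    S.Filt m (S.E k l * x) := by
  have hite : ∀ (p : Prop) [Decidable p] {m : ℕ} {a y : B}, S.Filt m (a * y) →
      S.Filt m ((if p then a else 0) * y) := by
    intro p _ m a y h
    split_ifs
    · exact h
    · rw [zero_mul]; exact .jp (zero_mem _)
  induction hx generalizing k l with
  | jp h => exact .jp (S.mul_mem_Jp _ h)
  | cartan φ =>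
    rcases lt_trichotomy k l with h | h | h
    · rw [(S.wt_E _ _).mul_C]; exact .jp (S.mul_E_mem_Jp _ h)
    · subst h; rw [← S.C_h, ← map_mul]; exact .cartan _
    · exact .lower h (.cartan _)
  | add _ _ hx hy => rw [mul_add]; exact (hx k l).add (hy k l)
  | neg _ hx => rw [mul_neg]; exact (hx k l).neg
  | lower h _ hx =>
    rw [← mul_assoc, S.E_comm, add_mul, sub_mul, mul_assoc]
    exact (Filt.lower h (hx k l)).add ((hite _ (hx _ _)).sub (hite _ (hx _ _)))
  | zeta j hx' hx =>
    rw [← mul_assoc, S.E_Z, add_mul, mul_assoc]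
    exact (Filt.zeta j (hx k l)).add (hite _ (.zeta _ hx'))
  | delta j hx' hx =>
    rw [← mul_assoc, S.E_D, sub_mul, mul_assoc]
    exact (Filt.delta j (hx k l)).sub (hite _ (.delta _ hx'))

theorem Filt.succ {m : ℕ} {x : B} (hx : S.Filt m x) : S.Filt (m + 1) x := by
  induction hx with
  | jp h => exact .jp h
  | cartan φ' => exact .cartan _
  | add _ _ hx hy => exact hx.add hy
  | neg _ hx => exact hx.neg
  | lower h _ hx => exact .lower h hx
  | zeta j _ hx => exact .zeta j hx
  | delta j _ hx => exact .delta j hx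

theorem Filt.mono {m m' : ℕ} {x : B} (hx : S.Filt m x) (h : m ≤ m') : S.Filt m' x := by
  induction h with
  | refl => exact hx
  | step _ ih => exact ih.succ

variable (S) in
theorem exists_filt (x : B) : ∃ m, S.Filt m x := by
  let T : AddSubgroup B :=
    { carrier := {x | ∃ m, S.Filt m x}
      add_mem' := fun ⟨m, hm⟩ ⟨m', hm'⟩ =>
        ⟨max m m', (hm.mono (le_max_left _ _)).add (hm'.mono (le_max_right _ _))⟩
      zero_mem' := ⟨0, .jp (zero_mem _)⟩
      neg_mem' := fun ⟨m, hm⟩ => ⟨m, hm.neg⟩ }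
  refine S.left_induction T ⟨0, ?_⟩ ?_ ?_ ?_ ?_ x
  · rw [← map_one S.C]; exact .cartan _
  · exact fun i x ⟨m, hm⟩ => ⟨m + 1, .zeta i hm⟩
  · exact fun i x ⟨m, hm⟩ => ⟨m + 1, .delta i hm⟩
  · exact fun k l _ x ⟨m, hm⟩ => ⟨m, hm.E_mul k l⟩
  · exact fun φ x ⟨m, hm⟩ => ⟨m, hm.C_mul φ⟩

variable (S) in
/-- The combinations of raising operators on the right and lowering operators on the left in the
filtration. -/
def low (m : ℕ) : AddSubgroup B :=
  AddSubgroup.closure ({x | ∃ k l y, l < k ∧ S.Filt m y ∧ x = S.E k l * y} ∪ S.Jp)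

variable (S) in
/-- The sums of singular weight vectors of the filtration and of elements of `low`. -/
def good (m : ℕ) : AddSubgroup B :=
  AddSubgroup.closure ({b | S.Sing b ∧ S.Filt m b ∧ ∃ w, S.Wt w b} ∪ S.low m)

theorem Jp_le_low (m : ℕ) : S.Jp ≤ S.low m := fun _ hx => AddSubgroup.subset_closure (Or.inr hx)

theorem low_le_good (m : ℕ) : S.low m ≤ S.good m :=
  fun _ hx => AddSubgroup.subset_closure (Or.inr hx)

theorem E_mul_mem_low {m : ℕ} {k l : Fin n} (h : l < k) {y : B} (hy : S.Filt m y) :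
    S.E k l * y ∈ S.low m := AddSubgroup.subset_closure (Or.inl ⟨k, l, y, h, hy, rfl⟩)

theorem low_mul_C {m : ℕ} (φ : R) {x : B} (hx : x ∈ S.low m) : x * S.C φ ∈ S.low m := by
  induction hx using AddSubgroup.closure_induction with
  | mem x hx =>
    rcases hx with ⟨k, l, y, h, hy, rfl⟩ | hx
    · rw [mul_assoc]; exact E_mul_mem_low h (hy.mul_C φ)
    · exact Jp_le_low _ (S.Jp_mul_C _ hx)
  | zero => simp
  | add x y _ _ hx hy => rw [add_mul]; exact add_mem hx hy
  | neg x _ hx => rw [neg_mul]; exact neg_mem hx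

theorem low_le (m : ℕ) : S.low m ≤ S.Jm ⊔ S.Jp := by
  refine (AddSubgroup.closure_le _).2 ?_
  rintro _ (⟨k, l, y, h, hy, rfl⟩ | hx)
  · exact AddSubgroup.mem_sup_left (S.E_mul_mem_Jm _ h)
  · exact AddSubgroup.mem_sup_right hx

/-- On a singular x the ladder corrects ζ^j x to a singular vector at the cost of an element of
`low`. On E_kl y with l < k, moving ζ^j inside leaves ζ^k y when l = j. As then k > j, the statement
is needed beforehand for larger indices, with arbitrary y in the filtration. -/
theorem good_le_of_Z {m : ℕ} (j : Fin n)
    (hj : ∀ k, j < k → ∀ x, S.Filt m x → S.Z k * x ∈ S.good (m + 1)) {x : B}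
    (hx : x ∈ S.good m) : S.Z j * x ∈ S.good (m + 1) := by
  induction hx using AddSubgroup.closure_induction with
  | mem x hx =>
    rcases hx with ⟨hx, hf, w, hw⟩ | hx
    · obtain ⟨b, hb, hbw, hbf, hbl⟩ := exists_sing_Z hx hw (fun _ => S.filt (m + 1))
        (fun _ _ h => Filt.jp h) (fun _ _ h φ => Filt.mul_C h φ)
        (fun _ _ hij _ hy => Filt.lower hij hy) (fun i => Filt.zeta i hf)
        (fun _ => S.low (m + 1)) (fun _ => Jp_le_low _) (fun _ _ h φ => low_mul_C φ h)
        (fun _ _ hij _ hy => E_mul_mem_low hij hy) j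
      have : S.Z j * x = b - (b - S.Z j * x) := by abel
      rw [this]
      exact sub_mem (AddSubgroup.subset_closure (Or.inl ⟨hb, hbf, _, hbw⟩)) (low_le_good _ hbl)
    · induction hx using AddSubgroup.closure_induction with
      | mem x hx =>
        rcases hx with ⟨k, l, y, hkl, hy, rfl⟩ | hx
        · rw [← mul_assoc, eq_sub_of_add_eq (S.E_Z k l j).symm, sub_mul, mul_assoc]
          refine sub_mem (low_le_good _ (E_mul_mem_low hkl (.zeta j hy))) ?_
          split_ifs with hlj
          · exact hj k (hlj ▸ hkl) y hy
          · rw [zero_mul]; exact zero_mem _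
        · exact low_le_good _ (Jp_le_low _ (S.mul_mem_Jp _ hx))
      | zero => simp
      | add x y _ _ hx hy => rw [mul_add]; exact add_mem hx hy
      | neg x _ hx => rw [mul_neg]; exact neg_mem hx
  | zero => simp
  | add x y _ _ hx hy => rw [mul_add]; exact add_mem hx hy
  | neg x _ hx => rw [mul_neg]; exact neg_mem hx

/-- The commutator with E_kl turns δ_k into δ_l with l < k, so here the smaller indices come first.
-/
theorem good_le_of_D {m : ℕ} (j : Fin n)
    (hj : ∀ k, k < j → ∀ x, S.Filt m x → S.D k * x ∈ S.good (m + 1)) {x : B}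
    (hx : x ∈ S.good m) : S.D j * x ∈ S.good (m + 1) := by
  induction hx using AddSubgroup.closure_induction with
  | mem x hx =>
    rcases hx with ⟨hx, hf, w, hw⟩ | hx
    · obtain ⟨b, hb, hbw, hbf, hbl⟩ := exists_sing_D hx hw (fun _ => S.filt (m + 1))
        (fun _ _ h => Filt.jp h) (fun _ _ h φ => Filt.mul_C h φ)
        (fun _ _ hij _ hy => Filt.lower hij hy) (fun i => Filt.delta i hf)
        (fun _ => S.low (m + 1)) (fun _ => Jp_le_low _) (fun _ _ h φ => low_mul_C φ h)
        (fun _ _ hij _ hy => E_mul_mem_low hij hy) j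
      have : S.D j * x = b - (b - S.D j * x) := by abel
      rw [this]
      exact sub_mem (AddSubgroup.subset_closure (Or.inl ⟨hb, hbf, _, hbw⟩)) (low_le_good _ hbl)
    · induction hx using AddSubgroup.closure_induction with
      | mem x hx =>
        rcases hx with ⟨k, l, y, hkl, hy, rfl⟩ | hx
        · rw [← mul_assoc, eq_add_of_sub_eq (S.E_D k l j).symm, add_mul, mul_assoc]
          refine add_mem (low_le_good _ (E_mul_mem_low hkl (.delta j hy))) ?_
          split_ifs with hlj
          · exact hj l (hlj ▸ hkl) y hy
          · rw [zero_mul]; exact zero_mem _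
        · exact low_le_good _ (Jp_le_low _ (S.mul_mem_Jp _ hx))
      | zero => simp
      | add x y _ _ hx hy => rw [mul_add]; exact add_mem hx hy
      | neg x _ hx => rw [mul_neg]; exact neg_mem hx
  | zero => simp
  | add x y _ _ hx hy => rw [mul_add]; exact add_mem hx hy
  | neg x _ hx => rw [mul_neg]; exact neg_mem hx

/-- The outer induction is on the number of odd generators. The inner one is on the index of the
leftmost odd generator, downwards for ζ and upwards for δ, against the direction in which
commutators move it. -/
theorem Filt.mem_good {m : ℕ} {x : B} (hx : S.Filt m x) : x ∈ S.good m := by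
  induction m generalizing x with
  | zero =>
    generalize hm : 0 = m at hx
    induction hx with
    | jp h => exact low_le_good _ (Jp_le_low _ h)
    | cartan φ => exact AddSubgroup.subset_closure (Or.inl ⟨S.sing_C φ, .cartan φ, 0, S.wt_C φ⟩)
    | add _ _ hx hy => exact add_mem (hx hm) (hy hm)
    | neg _ hx => exact neg_mem (hx hm)
    | lower h hx' hx => exact low_le_good _ (E_mul_mem_low h hx')
    | zeta => exact absurd hm (by omega)
    | delta => exact absurd hm (by omega)
  | succ m ih =>
    have hZ : ∀ j x, S.Filt m x → S.Z j * x ∈ S.good (m + 1) := by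
      intro j
      induction j using (wellFounded_gt (α := Fin n)).induction with
      | _ j ihj => exact fun x hx => good_le_of_Z j ihj (ih hx)
    have hD : ∀ j x, S.Filt m x → S.D j * x ∈ S.good (m + 1) := by
      intro j
      induction j using (wellFounded_lt (α := Fin n)).induction with
      | _ j ihj => exact fun x hx => good_le_of_D j ihj (ih hx)
    generalize hm : m + 1 = m' at hx
    induction hx with
    | jp h => exact low_le_good _ (Jp_le_low _ h)
    | cartan φ => exact AddSubgroup.subset_closure (Or.inl ⟨S.sing_C φ, .cartan φ, 0, S.wt_C φ⟩)
    | add _ _ hx hy => exact add_mem (hx hm) (hy hm)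
    | neg _ hx => exact neg_mem (hx hm)
    | lower h hx' hx => exact low_le_good _ (E_mul_mem_low h hx')
    | zeta j hx =>
      obtain rfl := Nat.succ_injective hm
      exact hZ j _ hx
    | delta j hx =>
      obtain rfl := Nat.succ_injective hm
      exact hD j _ hx

variable (S) in
/-- Every double coset has a representative which is singular. -/
theorem exists_sing_sub_mem (x : B) : ∃ b, S.Sing b ∧ x - b ∈ S.Jm ⊔ S.Jp := by
  obtain ⟨m, hm⟩ := S.exists_filt x
  have hg := hm.mem_good
  clear hm
  induction hg using AddSubgroup.closure_induction with
  | mem x hx =>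
    rcases hx with ⟨hx, -, -⟩ | hx
    · exact ⟨x, hx, by simp⟩
    · exact ⟨0, S.sing_of_mem_Jp (zero_mem _), by simpa using low_le m hx⟩
  | zero => exact ⟨0, S.sing_of_mem_Jp (zero_mem _), by simp⟩
  | add x y _ _ hx hy =>
    obtain ⟨b, hb, hb'⟩ := hx
    obtain ⟨c, hc, hc'⟩ := hy
    refine ⟨b + c, hb.add hc, ?_⟩
    rw [add_sub_add_comm]
    exact add_mem hb' hc'
  | neg x _ hx =>
    obtain ⟨b, hb, hb'⟩ := hx
    refine ⟨-b, hb.neg, ?_⟩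
    rw [← neg_sub']
    exact neg_mem hb'

end OddAlg
-- Well-definedness of the product and of the pairing
namespace OddAlg

variable {n : ℕ} {R B : Type*} [CommRing R] [Ring B] (S : OddAlg n R B)

/-! ### Independence of representatives -/

/-- The kernel of the projection to double cosets. -/
def Q : AddSubgroup B := S.Jm ⊔ S.Jp

theorem Jm_le_Q : S.Jm ≤ S.Q := le_sup_left

theorem Jp_le_Q : S.Jp ≤ S.Q := le_sup_right

/-- The anti-involution as an additive homomorphism. -/
def epsAdd : B →+ B := AddMonoidHom.mk' S.eps S.eps_add

theorem eps_sub (x y : B) : S.eps (x - y) = S.eps x - S.eps y := map_sub S.epsAdd x y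

theorem eps_neg (x : B) : S.eps (-x) = -S.eps x := map_neg S.epsAdd x

theorem eps_zero : S.eps 0 = 0 := map_zero S.epsAdd

theorem eps_one : S.eps 1 = 1 := by
  rw [← map_one S.C, S.eps_C]

theorem eps_mem_Jm {x : B} (hx : x ∈ S.Jp) : S.eps x ∈ S.Jm := by
  induction hx using AddSubgroup.closure_induction with
  | mem x hx =>
    obtain ⟨a, i, j, hij, rfl⟩ := hx
    rw [S.eps_mul, S.eps_E]; exact S.E_mul_mem_Jm _ hij
  | zero => rw [S.eps_zero]; exact zero_mem _
  | add x y _ _ hx hy => rw [S.eps_add]; exact add_mem hx hy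
  | neg x _ hx => rw [S.eps_neg]; exact neg_mem hx

theorem eps_mem_Jp {x : B} (hx : x ∈ S.Jm) : S.eps x ∈ S.Jp := by
  induction hx using AddSubgroup.closure_induction with
  | mem x hx =>
    obtain ⟨a, i, j, hij, rfl⟩ := hx
    rw [S.eps_mul, S.eps_E]; exact S.mul_E_mem_Jp _ hij
  | zero => rw [S.eps_zero]; exact zero_mem _
  | add x y _ _ hx hy => rw [S.eps_add]; exact add_mem hx hy
  | neg x _ hx => rw [S.eps_neg]; exact neg_mem hx

theorem eps_mem_Q {x : B} (hx : x ∈ S.Q) : S.eps x ∈ S.Q := by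
  obtain ⟨y, hy, z, hz, rfl⟩ := AddSubgroup.mem_sup.1 hx
  rw [S.eps_add]
  exact add_mem (S.Jp_le_Q (S.eps_mem_Jp hy)) (S.Jm_le_Q (S.eps_mem_Jm hz))

theorem C_mul_Q (φ : R) {x : B} (hx : x ∈ S.Q) : S.C φ * x ∈ S.Q := by
  obtain ⟨y, hy, z, hz, rfl⟩ := AddSubgroup.mem_sup.1 hx
  rw [mul_add]
  exact add_mem (S.Jm_le_Q (S.C_mul_Jm φ hy)) (S.Jp_le_Q (S.mul_mem_Jp _ hz))

variable {S}

theorem Sing.Q_mul {b : B} (hb : S.Sing b) {x : B} (hx : x ∈ S.Q) : x * b ∈ S.Q := by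
  obtain ⟨y, hy, z, hz, rfl⟩ := AddSubgroup.mem_sup.1 hx
  rw [add_mul]
  exact add_mem (S.Jm_le_Q (S.Jm_mul_mem b hy)) (S.Jp_le_Q (hb.Jp_mul hz))

/-- This is the image of `Sing.Q_mul` under ε, which preserves `Q` by exchanging its two summands.
-/
theorem Sing.eps_mul_Q {b : B} (hb : S.Sing b) {x : B} (hx : x ∈ S.Q) : S.eps b * x ∈ S.Q := by
  have h := S.eps_mem_Q (hb.Q_mul (S.eps_mem_Q hx))
  rwa [S.eps_mul, S.eps_eps] at h

/-- Since `Q` is not a left ideal, membership of c alone is not enough. Modulo `Q` the factor a may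
be replaced by ε(b) with b singular: the difference times c lies in `Q` because c is singular, and
ε(b) maps `Q` into itself. -/
theorem Sing.mul_mem_Q {c : B} (hc : S.Sing c) (hcQ : c ∈ S.Q) (a : B) : a * c ∈ S.Q := by
  obtain ⟨b, hb, hab⟩ := S.exists_sing_sub_mem (S.eps a)
  have h1 := S.eps_mem_Q hab
  rw [S.eps_sub, S.eps_eps] at h1
  have : a * c = (a - S.eps b) * c + S.eps b * c := by rw [sub_mul]; abel
  rw [this]
  exact add_mem (hc.Q_mul h1) (hb.eps_mul_Q hcQ)

theorem Sing.mul_sub_mem_Q {b c : B} (hb : S.Sing b) (hc : S.Sing c) (h : b - c ∈ S.Q) (a : B) :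
    a * b - a * c ∈ S.Q := by
  rw [← mul_sub]
  refine Sing.mul_mem_Q ?_ h a
  rw [sub_eq_add_neg]
  exact hb.add hc.neg

/-! ### The one-sided ideals of odd generators -/

variable (S) in
/-- The preimage of the left ideal of the reduction algebra generated by the odd derivatives. -/
def Idel : AddSubgroup B :=
  AddSubgroup.closure {x | ∃ a b i, S.Sing b ∧ S.D i - b ∈ S.Q ∧ x = a * b} ⊔ S.Q

variable (S) in
/-- The preimage of the right ideal of the reduction algebra generated by the odd coordinates. -/
def Izet : AddSubgroup B :=
  AddSubgroup.closure {x | ∃ b i, S.Sing b ∧ x = S.Z i * b} ⊔ S.Q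

variable (S) in
/-- The left ideal generated by raising operators and odd derivatives. -/
def Lideal : AddSubgroup B := AddSubgroup.closure {x | ∃ a i, x = a * S.D i} ⊔ S.Jp

variable (S) in
/-- The right ideal generated by lowering operators and odd coordinates. -/
def Rideal : AddSubgroup B := AddSubgroup.closure {x | ∃ a i, x = S.Z i * a} ⊔ S.Jm

variable (S) in
/-- The left ideal generated by raising operators and the odd derivatives `δ_k` with `k ≥ i`. -/
def tailIdeal (i : ℕ) : AddSubgroup B :=
  AddSubgroup.closure {x | ∃ a, ∃ k : Fin n, i ≤ k ∧ x = a * S.D k} ⊔ S.Jp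

theorem mul_D_mem_tailIdeal {i : ℕ} (a : B) {k : Fin n} (h : i ≤ k) :
    a * S.D k ∈ S.tailIdeal i :=
  AddSubgroup.mem_sup_left (AddSubgroup.subset_closure ⟨a, k, h, rfl⟩)

theorem tailIdeal_induction {i : ℕ} {T : AddSubgroup B} (f : B →+ B)
    (h1 : ∀ (a : B) (k : Fin n), i ≤ k → f (a * S.D k) ∈ T) (h2 : ∀ x ∈ S.Jp, f x ∈ T)
    {x : B} (hx : x ∈ S.tailIdeal i) : f x ∈ T := by
  have : S.tailIdeal i ≤ T.comap f := by
    refine sup_le ((AddSubgroup.closure_le _).2 ?_) h2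
    rintro _ ⟨a, k, hk, rfl⟩
    exact h1 a k hk
  exact this hx

theorem tailIdeal_anti {i j : ℕ} (h : i ≤ j) : S.tailIdeal j ≤ S.tailIdeal i := fun _ hx =>
  tailIdeal_induction (AddMonoidHom.id B) (fun a _ hk => mul_D_mem_tailIdeal a (h.trans hk))
    (fun _ hx => AddSubgroup.mem_sup_right hx) hx

theorem mul_mem_tailIdeal {i : ℕ} (c : B) {x : B} (hx : x ∈ S.tailIdeal i) :
    c * x ∈ S.tailIdeal i :=
  tailIdeal_induction (AddMonoidHom.mulLeft c)
    (fun a k hk => by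
      change c * (a * S.D k) ∈ _
      rw [← mul_assoc]; exact mul_D_mem_tailIdeal _ hk)
    (fun x hx => AddSubgroup.mem_sup_right (S.mul_mem_Jp c hx)) hx

theorem tailIdeal_mul_C {i : ℕ} (φ : R) {x : B} (hx : x ∈ S.tailIdeal i) :
    x * S.C φ ∈ S.tailIdeal i :=
  tailIdeal_induction (AddMonoidHom.mulRight (S.C φ))
    (fun a k hk => by
      change a * S.D k * S.C φ ∈ _
      rw [mul_assoc, (S.wt_D k).mul_C, ← mul_assoc]; exact mul_D_mem_tailIdeal _ hk)
    (fun x hx => AddSubgroup.mem_sup_right (S.Jp_mul_C φ hx)) hx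

theorem mul_D_mem_Lideal (a : B) (i : Fin n) : a * S.D i ∈ S.Lideal :=
  AddSubgroup.mem_sup_left (AddSubgroup.subset_closure ⟨a, i, rfl⟩)

theorem tailIdeal_le_Lideal (i : ℕ) : S.tailIdeal i ≤ S.Lideal :=
  fun _ hx => tailIdeal_induction (AddMonoidHom.id B)
    (fun a k _ => mul_D_mem_Lideal a k)
    (fun _ hx => AddSubgroup.mem_sup_right hx) hx

variable (S) in
-- The ladder is applied with x = 1. Modulo `Jp`, its corrections to δ_j are sums of E_kj y with k >
-- j and y in the left ideal of the δ's from k on. The lowering factor puts them in `Q`, and the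
-- position of y puts them in the tail after j.
theorem exists_sing_delta (j : Fin n) : ∃ b, S.Sing b ∧ S.D j - b ∈ S.Q ∧
    b ∈ S.tailIdeal j ∧ b - S.D j ∈ S.tailIdeal (j + 1) := by
  let Y : Fin n → AddSubgroup B := fun i => AddSubgroup.closure
    {x | ∃ j y, i < j ∧ y ∈ S.tailIdeal (j : ℕ) ∧ x = S.E j i * y} ⊔ S.Jp
  have hYC : ∀ i, ∀ x ∈ Y i, ∀ φ, x * S.C φ ∈ Y i := by
    intro i x hx φ
    have : Y i ≤ (Y i).comap (AddMonoidHom.mulRight (S.C φ)) := by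
      refine sup_le ((AddSubgroup.closure_le _).2 ?_)
        (fun x hx => AddSubgroup.mem_sup_right (S.Jp_mul_C φ hx))
      rintro _ ⟨j, y, hij, hy, rfl⟩
      refine AddSubgroup.mem_sup_left (AddSubgroup.subset_closure ⟨j, y * S.C φ, hij,
        tailIdeal_mul_C φ hy, ?_⟩)
      exact mul_assoc _ _ _
    exact this hx
  have hEY : ∀ i j : Fin n, i < j → ∀ x ∈ S.tailIdeal (j : ℕ), S.E j i * x ∈ Y i := fun i j hij x hx =>
    AddSubgroup.mem_sup_left (AddSubgroup.subset_closure ⟨j, x, hij, hx, rfl⟩)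
  obtain ⟨b, hb, -, hbX, hbY⟩ := exists_sing_D (by simpa using S.sing_C 1 : S.Sing 1) S.wt_one
    (fun i => S.tailIdeal i) (fun _ _ h => AddSubgroup.mem_sup_right h)
    (fun _ _ h φ => tailIdeal_mul_C φ h)
    (fun i j hij x hx => mul_mem_tailIdeal _ (tailIdeal_anti (le_of_lt hij) hx))
    (fun i => by rw [mul_one, ← one_mul (S.D i)]; exact mul_D_mem_tailIdeal _ le_rfl)
    Y (fun _ _ h => AddSubgroup.mem_sup_right h) hYC hEY j
  rw [mul_one] at hbY
  refine ⟨b, hb, ?_, hbX, ?_⟩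
  · rw [← neg_sub]
    refine neg_mem ((sup_le ((AddSubgroup.closure_le _).2 ?_) S.Jp_le_Q : Y j ≤ S.Q) hbY)
    rintro _ ⟨k, y, hk, -, rfl⟩
    exact S.Jm_le_Q (S.E_mul_mem_Jm _ hk)
  · refine (sup_le ((AddSubgroup.closure_le _).2 ?_) (fun x h => AddSubgroup.mem_sup_right h) :
      Y j ≤ S.tailIdeal (j + 1)) hbY
    rintro _ ⟨k, y, hk, hy, rfl⟩
    exact mul_mem_tailIdeal _ (tailIdeal_anti (Nat.succ_le_of_lt hk) hy)

variable (S) in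
/-- The left ideal generated by raising operators and singular representatives of the odd
derivatives. -/
def singIdeal : AddSubgroup B :=
  AddSubgroup.closure {x | ∃ a b i, S.Sing b ∧ S.D i - b ∈ S.Q ∧ x = a * b} ⊔ S.Jp

/-- The passage from the δ_i to their singular representatives is unitriangular, hence invertible by
descending induction on i. -/
theorem mul_D_mem_singIdeal (a : B) (i : Fin n) : a * S.D i ∈ S.singIdeal := by
  induction i using (wellFounded_gt (α := Fin n)).induction generalizing a with
  | _ i ih =>
    obtain ⟨b, hb, hbQ, -, hbt⟩ := S.exists_sing_delta i
    have : a * S.D i = a * b - a * (b - S.D i) := by rw [mul_sub]; abel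
    rw [this]
    refine sub_mem (AddSubgroup.mem_sup_left (AddSubgroup.subset_closure ⟨a, b, i, hb, hbQ, rfl⟩))
      (tailIdeal_induction (AddMonoidHom.mulLeft a) (fun c k hk => ?_) (fun x hx => ?_) hbt)
    · change a * (c * S.D k) ∈ _
      rw [← mul_assoc]
      exact ih k (Nat.lt_of_succ_le hk) _
    · exact AddSubgroup.mem_sup_right (S.mul_mem_Jp a hx)

theorem singIdeal_le_Idel : S.singIdeal ≤ S.Idel := sup_le_sup le_rfl S.Jp_le_Q

theorem Lideal_le_Idel : S.Lideal ≤ S.Idel := by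
  refine sup_le ((AddSubgroup.closure_le _).2 ?_) (S.Jp_le_Q.trans le_sup_right)
  rintro _ ⟨a, i, rfl⟩
  exact singIdeal_le_Idel (mul_D_mem_singIdeal a i)

/-- Left multiplication by ε(b) preserves `Q`, so w may be replaced by a singular v; then, as v is
singular, ε(b) may be replaced by ζ^i. -/
theorem Sing.eps_mul_mem_Izet {b : B} (hb : S.Sing b) {i : Fin n} (hbi : S.D i - b ∈ S.Q) (w : B) :
    S.eps b * w ∈ S.Izet := by
  obtain ⟨v, hv, hwv⟩ := S.exists_sing_sub_mem w
  have h1 := S.eps_mem_Q hbi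
  rw [S.eps_sub, S.eps_D] at h1
  have : S.eps b * w = S.eps b * (w - v) - (S.Z i - S.eps b) * v + S.Z i * v := by
    rw [mul_sub, sub_mul]; abel
  rw [this]
  exact add_mem (AddSubgroup.mem_sup_right (sub_mem (hb.eps_mul_Q hwv) (hv.Q_mul h1)))
    (AddSubgroup.mem_sup_left (AddSubgroup.subset_closure ⟨v, i, hv, rfl⟩))

theorem eps_mul_mem_Izet_of_singIdeal {x : B} (hx : x ∈ S.singIdeal) (w : B) :
    S.eps x * w ∈ S.Izet := by
  have : S.singIdeal ≤ S.Izet.comap ((AddMonoidHom.mulRight w).comp S.epsAdd) := by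
    refine sup_le ((AddSubgroup.closure_le _).2 ?_) fun x hx => ?_
    · rintro _ ⟨a, b, i, hb, hbi, rfl⟩
      change S.eps (a * b) * w ∈ S.Izet
      rw [S.eps_mul, mul_assoc]
      exact hb.eps_mul_mem_Izet hbi _
    · exact AddSubgroup.mem_sup_right (S.Jm_le_Q (S.Jm_mul_mem w (S.eps_mem_Jm hx)))
  exact this hx

/-- This removes the singularity condition on the right factor in I_ζ. The element δ_i expands in
singular representatives, and ε of such an expansion tolerates any right factor. -/
theorem Rideal_le_Izet : S.Rideal ≤ S.Izet := by
  refine sup_le ((AddSubgroup.closure_le _).2 ?_) (S.Jm_le_Q.trans le_sup_right)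
  rintro _ ⟨a, i, rfl⟩
  have := eps_mul_mem_Izet_of_singIdeal (mul_D_mem_singIdeal (S := S) 1 i) a
  rwa [one_mul, S.eps_D] at this

theorem Izet_le : S.Izet ≤ S.Lideal ⊔ S.Rideal := by
  refine sup_le ((AddSubgroup.closure_le _).2 ?_) (sup_le (le_sup_right.trans le_sup_right)
    (le_sup_right.trans le_sup_left))
  rintro _ ⟨b, i, -, rfl⟩
  exact AddSubgroup.mem_sup_right (AddSubgroup.mem_sup_left
    (AddSubgroup.subset_closure ⟨b, i, rfl⟩))

theorem Q_le : S.Q ≤ S.Lideal ⊔ S.Rideal := le_sup_right.trans Izet_le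

theorem Idel_le : S.Idel ≤ S.Lideal ⊔ S.Rideal := by
  refine sup_le ((AddSubgroup.closure_le _).2 ?_) Q_le
  rintro _ ⟨a, b, i, hb, hbi, rfl⟩
  -- The representative `b` is arbitrary. It is exchanged, modulo `Q`, for the one from the ladder,
  -- which is known to lie in the left ideal of the δ's.
  obtain ⟨c, hc, hci, hct, -⟩ := S.exists_sing_delta i
  have h1 : b - c ∈ S.Q := by
    have := sub_mem hci hbi
    rwa [sub_sub_sub_cancel_left] at this
  have : a * b = (a * b - a * c) + a * c := by abel
  rw [this]
  exact add_mem (Q_le (hb.mul_sub_mem_Q hc h1 a))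
    (AddSubgroup.mem_sup_left (tailIdeal_le_Lideal _ (mul_mem_tailIdeal a hct)))

/-- The kernel of the Harish-Chandra projection is thus described by one-sided ideals of the
localized algebra, with no mention of ⋄ or of singular representatives. -/
theorem Idel_sup_Izet : S.Idel ⊔ S.Izet = S.Lideal ⊔ S.Rideal :=
  le_antisymm (sup_le Idel_le Izet_le) (sup_le_sup Lideal_le_Idel Rideal_le_Izet)

/-! ### The contravariant pairing -/

/-- Independence of the first argument of the form: ε turns the left ideal I_δ into the right ideal
I_ζ. -/
theorem eps_mul_mem_of_mem_Idel {x : B} (hx : x ∈ S.Idel) {b : B} (hb : S.Sing b) :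
    S.eps x * b ∈ S.Izet := by
  have : S.Idel ≤ S.Izet.comap ((AddMonoidHom.mulRight b).comp S.epsAdd) := by
    refine sup_le ((AddSubgroup.closure_le _).2 ?_) fun x hx => ?_
    · rintro _ ⟨a, c, i, hc, hci, rfl⟩
      change S.eps (a * c) * b ∈ S.Izet
      rw [S.eps_mul, mul_assoc]
      exact hc.eps_mul_mem_Izet hci _
    · exact AddSubgroup.mem_sup_right (hb.Q_mul (S.eps_mem_Q hx))
  exact this hx

/-- For the second argument: the left factor of each generator of I_δ may itself be taken singular.
The resulting representative is singular and still ends in singular representatives of the δ_i, so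
any left multiple of it stays in I_δ. -/
theorem exists_sing_of_mem_Idel {y : B} (hy : y ∈ S.Idel) :
    ∃ b, S.Sing b ∧ y - b ∈ S.Q ∧ ∀ a, a * b ∈ S.Idel := by
  obtain ⟨y, hy', q, hq, rfl⟩ := AddSubgroup.mem_sup.1 hy
  suffices ∃ b, S.Sing b ∧ y - b ∈ S.Q ∧ ∀ a, a * b ∈ S.Idel by
    obtain ⟨b, hb, hyb, h⟩ := this
    refine ⟨b, hb, ?_, h⟩
    rw [add_sub_right_comm]
    exact add_mem hyb hq
  clear hy hq q
  induction hy' using AddSubgroup.closure_induction with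
  | mem x hx =>
    obtain ⟨a, b, i, hb, hbi, rfl⟩ := hx
    obtain ⟨c, hc, hac⟩ := S.exists_sing_sub_mem a
    refine ⟨c * b, hc.mul hb, ?_, fun d => ?_⟩
    · rw [← sub_mul]; exact hb.Q_mul hac
    · rw [← mul_assoc]
      exact AddSubgroup.mem_sup_left (AddSubgroup.subset_closure ⟨_, b, i, hb, hbi, rfl⟩)
  | zero => exact ⟨0, S.sing_of_mem_Jp (zero_mem _), by simp, by simp⟩
  | add x y _ _ hx hy =>
    obtain ⟨b, hb, hb', hb''⟩ := hx
    obtain ⟨c, hc, hc', hc''⟩ := hy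
    refine ⟨b + c, hb.add hc, ?_, fun a => ?_⟩
    · rw [add_sub_add_comm]
      exact add_mem hb' hc'
    · rw [mul_add]; exact add_mem (hb'' a) (hc'' a)
  | neg x _ hx =>
    obtain ⟨b, hb, hb', hb''⟩ := hx
    refine ⟨-b, hb.neg, ?_, fun a => ?_⟩
    · rw [← neg_sub']
      exact neg_mem hb'
    · rw [mul_neg]; exact neg_mem (hb'' a)

theorem Sing.mul_mem_Idel {b : B} (hb : S.Sing b) (hbI : b ∈ S.Idel) (a : B) : a * b ∈ S.Idel := by
  obtain ⟨c, hc, hbc, h⟩ := exists_sing_of_mem_Idel hbI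
  have : a * b = (a * b - a * c) + a * c := by abel
  rw [this]
  exact add_mem (AddSubgroup.mem_sup_right (hb.mul_sub_mem_Q hc hbc a)) (h a)

/-! ### The triangular decomposition -/

theorem mul_mem_Lideal (c : B) {x : B} (hx : x ∈ S.Lideal) : c * x ∈ S.Lideal := by
  have : S.Lideal ≤ S.Lideal.comap (AddMonoidHom.mulLeft c) := by
    refine sup_le ((AddSubgroup.closure_le _).2 ?_)
      fun x hx => AddSubgroup.mem_sup_right (S.mul_mem_Jp c hx)
    rintro _ ⟨a, i, rfl⟩
    exact AddSubgroup.mem_sup_left (AddSubgroup.subset_closure ⟨c * a, i, (mul_assoc _ _ _).symm⟩)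
  exact this hx

theorem Z_mul_mem_Rideal (a : B) (i : Fin n) : S.Z i * a ∈ S.Rideal :=
  AddSubgroup.mem_sup_left (AddSubgroup.subset_closure ⟨a, i, rfl⟩)

variable (S) in
/-- The additive subgroup generated by the left ideal of raising operators and odd derivatives and
by the Cartan part, under lowering operators and odd coordinates. -/
inductive Tri : B → Prop
  | left {x : B} : x ∈ S.Lideal → Tri x
  | cartan (φ : R) : Tri (S.C φ)
  | add {x y : B} : Tri x → Tri y → Tri (x + y)
  | neg {x : B} : Tri x → Tri (-x)
  | lower {k l : Fin n} {x : B} : l < k → Tri x → Tri (S.E k l * x)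
  | zeta (j : Fin n) {x : B} : Tri x → Tri (S.Z j * x)

theorem Tri.zero : S.Tri 0 := .left (zero_mem _)

theorem Tri.sub {x y : B} (hx : S.Tri x) (hy : S.Tri y) : S.Tri (x - y) := by
  rw [sub_eq_add_neg]; exact hx.add hy.neg

theorem Tri.ite_mul {p : Prop} [Decidable p] {a y : B} (h : S.Tri (a * y)) :
    S.Tri ((if p then a else 0) * y) := by
  split_ifs
  · exact h
  · rw [zero_mul]; exact .zero

theorem Tri.C_mul {x : B} (hx : S.Tri x) (φ : R) : S.Tri (S.C φ * x) := by
  induction hx generalizing φ with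
  | left h => exact .left (mul_mem_Lideal _ h)
  | cartan φ' => rw [← map_mul]; exact .cartan _
  | add _ _ hx hy => rw [mul_add]; exact (hx φ).add (hy φ)
  | neg _ hx => rw [mul_neg]; exact (hx φ).neg
  | lower h _ hx => rw [← mul_assoc, (S.wt_E _ _).C_mul, mul_assoc]; exact .lower h (hx _)
  | zeta j _ hx => rw [← mul_assoc, (S.wt_Z _).C_mul, mul_assoc]; exact .zeta j (hx _)

theorem Tri.E_mul {x : B} (hx : S.Tri x) (k l : Fin n) : S.Tri (S.E k l * x) := by
  induction hx generalizing k l with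
  | left h => exact .left (mul_mem_Lideal _ h)
  | cartan φ =>
    rcases lt_trichotomy k l with h | h | h
    · rw [(S.wt_E _ _).mul_C]
      exact .left (AddSubgroup.mem_sup_right (S.mul_E_mem_Jp _ h))
    · subst h; rw [← S.C_h, ← map_mul]; exact .cartan _
    · exact .lower h (.cartan _)
  | add _ _ hx hy => rw [mul_add]; exact (hx k l).add (hy k l)
  | neg _ hx => rw [mul_neg]; exact (hx k l).neg
  | lower h _ hx =>
    rw [← mul_assoc, S.E_comm, add_mul, sub_mul, mul_assoc]
    exact (Tri.lower h (hx k l)).add ((hx _ _).ite_mul.sub (hx _ _).ite_mul)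
  | zeta j hx' hx =>
    rw [← mul_assoc, S.E_Z, add_mul, mul_assoc]
    exact (Tri.zeta j (hx k l)).add (Tri.zeta _ hx').ite_mul

theorem Tri.D_mul {x : B} (hx : S.Tri x) (j : Fin n) : S.Tri (S.D j * x) := by
  induction hx generalizing j with
  | left h => exact .left (mul_mem_Lideal _ h)
  | cartan φ => rw [(S.wt_D j).mul_C]; exact .left (mul_D_mem_Lideal _ _)
  | add _ _ hx hy => rw [mul_add]; exact (hx j).add (hy j)
  | neg _ hx => rw [mul_neg]; exact (hx j).neg
  | @lower k l x h _ hx =>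
    rw [← mul_assoc, eq_add_of_sub_eq (S.E_D k l j).symm, add_mul, mul_assoc]
    exact (Tri.lower h (hx j)).add (hx _).ite_mul
  | zeta i hx' hx =>
    rw [← mul_assoc, S.D_Z, sub_mul, mul_assoc]
    refine Tri.sub (Tri.ite_mul ?_) (.zeta i (hx j))
    rwa [one_mul]

variable (S) in
-- Normal ordering: lowering operators and ζ^i go to the left, raising operators and δ_i to the
-- right, Cartan elements remain between.
theorem tri (x : B) : S.Tri x :=
  S.left_induction
    { carrier := {x | S.Tri x}
      add_mem' := Tri.add
      zero_mem' := .zero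
      neg_mem' := Tri.neg } (by simpa using Tri.cartan (S := S) 1)
    (fun i _ hx => Tri.zeta i hx) (fun i _ hx => Tri.D_mul hx i)
    (fun k l _ _ hx => Tri.E_mul hx k l) (fun φ _ hx => Tri.C_mul hx φ) x

variable (S) in
-- In a normally ordered element every term with an odd generator, a raising or a lowering operator
-- lies in one of the two ideals.
theorem exists_sub_C_mem (x : B) : ∃ φ, x - S.C φ ∈ S.Lideal ⊔ S.Rideal := by
  induction S.tri x with
  | left h => exact ⟨0, by simpa using AddSubgroup.mem_sup_left h⟩
  | cartan φ => exact ⟨φ, by simp⟩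
  | add _ _ hx hy =>
    obtain ⟨φ, hφ⟩ := hx
    obtain ⟨ψ, hψ⟩ := hy
    refine ⟨φ + ψ, ?_⟩
    rw [map_add, add_sub_add_comm]
    exact add_mem hφ hψ
  | neg _ hx =>
    obtain ⟨φ, hφ⟩ := hx
    refine ⟨-φ, ?_⟩
    rw [map_neg, ← neg_sub']
    exact neg_mem hφ
  | lower h _ _ =>
    refine ⟨0, ?_⟩
    rw [map_zero, sub_zero]
    exact Q_le (S.Jm_le_Q (S.E_mul_mem_Jm _ h))
  | zeta j _ _ =>
    refine ⟨0, ?_⟩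
    rw [map_zero, sub_zero]
    exact AddSubgroup.mem_sup_right (Z_mul_mem_Rideal _ _)

end OddAlg
-- Scalar squares of the monomials
namespace OddAlg

variable {n : ℕ} {R B : Type*} [CommRing R] [Ring B] {S : OddAlg n R B}

variable (S) in
/-- The kernel of the projection to the Cartan part. -/
def M : AddSubgroup B := S.Lideal ⊔ S.Rideal

theorem Jp_le_M : S.Jp ≤ S.M := S.Jp_le_Q.trans Q_le

theorem Jm_le_M : S.Jm ≤ S.M := S.Jm_le_Q.trans Q_le

theorem Z_mul_mem_M (a : B) (i : Fin n) : S.Z i * a ∈ S.M :=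
  AddSubgroup.mem_sup_right (Z_mul_mem_Rideal a i)

theorem M_mul_C {x : B} (hx : x ∈ S.M) (φ : R) : x * S.C φ ∈ S.M := by
  have : S.M ≤ S.M.comap (AddMonoidHom.mulRight (S.C φ)) := by
    refine sup_le (sup_le ((AddSubgroup.closure_le _).2 ?_) fun x hx => ?_)
      (sup_le ((AddSubgroup.closure_le _).2 ?_) fun x hx => ?_)
    · rintro _ ⟨a, i, rfl⟩
      change a * S.D i * S.C φ ∈ S.M
      rw [mul_assoc, (S.wt_D i).mul_C, ← mul_assoc]
      exact AddSubgroup.mem_sup_left (mul_D_mem_Lideal _ _)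
    · exact Jp_le_M (S.Jp_mul_C φ hx)
    · rintro _ ⟨a, i, rfl⟩
      change S.Z i * a * S.C φ ∈ S.M
      rw [mul_assoc]
      exact Z_mul_mem_M _ _
    · exact Jm_le_M (S.Jm_mul_mem _ hx)
  exact this hx

theorem C_mul_M {x : B} (hx : x ∈ S.M) (φ : R) : S.C φ * x ∈ S.M := by
  have : S.M ≤ S.M.comap (AddMonoidHom.mulLeft (S.C φ)) := by
    refine sup_le (fun x hx => AddSubgroup.mem_sup_left (mul_mem_Lideal _ hx))
      (sup_le ((AddSubgroup.closure_le _).2 ?_) fun x hx => ?_)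
    · rintro _ ⟨a, i, rfl⟩
      change S.C φ * (S.Z i * a) ∈ S.M
      rw [← mul_assoc, (S.wt_Z i).C_mul, mul_assoc]
      exact Z_mul_mem_M _ _
    · exact Jm_le_M (S.C_mul_Jm φ hx)
  exact this hx

/-! ### Matrix coefficients along the ladder -/

section Coefficients

variable {η : Fin n → R} {ψ : Fin n → B} {d : B} {p : Fin n} {s : Finset (Fin n)}

/-- For i < j one has δ_j E_ji = E_ji δ_j + δ_i. The first term, once E_ji has passed d, begins with
a lowering operator and lies in `M`; the second leaves d δ_i ψ_i, which vanishes for i ∈ s. The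
entries with i ≥ j are covered by `sum_sub_mem`. Multiplication of ψ by E therefore acts on the
coefficients d δ_j ψ_j by a triangular matrix over the Cartan part. -/
theorem coeff_step (hv : S.IsVec S.E η ψ) {j : Fin n}
    (hdE : ∀ i, d * S.E j i = S.E j i * d) (hd : ∀ i ∈ s, i < j → d * S.D i = 0) :
    d * S.D j * (∑ i, S.E j i * ψ i)
      - (∑ i ∈ (Finset.Iio j).filter (· ∉ s), d * S.D i * ψ i
        + d * S.D j * ψ j * S.C (alpha η j)) ∈ S.M := by
  have h1 := Jp_le_M (S.mul_mem_Jp (d * S.D j) (hv.sum_sub_mem j))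
  have h2 : d * S.D j * (∑ i ∈ Finset.Iio j, S.E j i * ψ i)
      = ∑ i ∈ Finset.Iio j, S.E j i * (d * S.D j * ψ i)
        + ∑ i ∈ (Finset.Iio j).filter (· ∉ s), d * S.D i * ψ i := by
    rw [Finset.sum_filter_of_ne, Finset.mul_sum, ← Finset.sum_add_distrib]
    · refine Finset.sum_congr rfl fun i _ => ?_
      have := S.E_D j i j
      rw [if_pos rfl] at this
      rw [← mul_assoc, mul_assoc d, ← add_eq_of_eq_sub this, mul_add, ← mul_assoc, hdE, add_mul]
      simp only [mul_assoc]
    · intro i hi hne hs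
      rw [hd i hs (Finset.mem_Iio.1 hi), zero_mul] at hne
      exact hne rfl
  rw [mul_sub, mul_add, h2, ← mul_assoc (d * S.D j) (ψ j)] at h1
  have h3 : ∑ i ∈ Finset.Iio j, S.E j i * (d * S.D j * ψ i) ∈ S.M :=
    sum_mem fun i hi => Jm_le_M (S.E_mul_mem_Jm _ (Finset.mem_Iio.1 hi))
  have := add_mem h1 h3
  refine (congrArg (· ∈ S.M) ?_).mp this
  abel

variable (S d) in
/-- A combination of matrix coefficients of a vector operator. -/
def coeffSum (y : Fin n → R) (c : Finset (Fin n)) (ψ : Fin n → B) : B :=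
  ∑ j ∈ c, d * S.D j * ψ j * S.C (y j)

/-- The condition `hy` says that y is a left eigenvector, with eigenvalue α_p, of the triangular
matrix found in `coeff_step`. -/
theorem coeffSum_step (hv : S.IsVec S.E η ψ) (y : Fin n → R)
    (hdE : ∀ j, (j ∈ insert p ((Finset.Iio p).filter (· ∉ s))) → ∀ i, d * S.E j i = S.E j i * d)
    (hd : ∀ i ∈ s, i < p → d * S.D i = 0)
    (hy : ∀ i ∈ insert p ((Finset.Iio p).filter (· ∉ s)),
      ∑ j ∈ (insert p ((Finset.Iio p).filter (· ∉ s))).filter (i < ·), y j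
        = y i * (alpha η p - alpha η i)) (c : R) :
    S.coeffSum d y (insert p ((Finset.Iio p).filter (· ∉ s))) (S.step S.E c ψ)
      - S.coeffSum d y (insert p ((Finset.Iio p).filter (· ∉ s))) ψ * S.C (alpha η p - c)
        ∈ S.M := by
  set I := insert p ((Finset.Iio p).filter (· ∉ s)) with hI
  have hle : ∀ j ∈ I, j ≤ p := by
    intro j hj
    rw [hI, Finset.mem_insert, Finset.mem_filter, Finset.mem_Iio] at hj
    rcases hj with rfl | h
    · exact le_rfl
    · exact h.1.le
  have h1 : ∑ j ∈ I, (d * S.D j * (∑ i, S.E j i * ψ i)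
      - (∑ i ∈ (Finset.Iio j).filter (· ∉ s), d * S.D i * ψ i
        + d * S.D j * ψ j * S.C (alpha η j))) * S.C (y j) ∈ S.M :=
    sum_mem fun j hj => M_mul_C (coeff_step hv (hdE j hj)
      fun i hi hij => hd i hi (hij.trans_le (hle j hj))) _
  have hfil : ∀ j ∈ I, (Finset.Iio j).filter (· ∉ s) = I.filter (· < j) := by
    intro j hj
    ext i
    simp only [hI, Finset.mem_filter, Finset.mem_Iio, Finset.mem_insert]
    constructor
    · rintro ⟨hij, his⟩
      exact ⟨Or.inr ⟨hij.trans_le (hle j hj), his⟩, hij⟩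
    · rintro ⟨rfl | ⟨-, his⟩, hij⟩
      · exact absurd (hle j hj) (not_le.2 hij)
      · exact ⟨hij, his⟩
  -- After the summations are exchanged, index i collects the y_j with j > i, and `hy` evaluates
  -- their sum.
  have h2 : ∑ j ∈ I, (∑ i ∈ (Finset.Iio j).filter (· ∉ s), d * S.D i * ψ i) * S.C (y j)
      = ∑ i ∈ I, d * S.D i * ψ i * S.C (y i * (alpha η p - alpha η i)) := by
    calc _ = ∑ j ∈ I, ∑ i ∈ I, if i < j then d * S.D i * ψ i * S.C (y j) else 0 := by
          refine Finset.sum_congr rfl fun j hj => ?_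
          rw [hfil j hj, Finset.sum_mul, Finset.sum_filter]
      _ = ∑ i ∈ I, ∑ j ∈ I, if i < j then d * S.D i * ψ i * S.C (y j) else 0 :=
          Finset.sum_comm
      _ = _ := by
          refine Finset.sum_congr rfl fun i hi => ?_
          rw [← Finset.sum_filter, ← Finset.mul_sum, ← map_sum, hy i hi]
  refine (congrArg (· ∈ S.M) ?_).mp h1
  simp only [coeffSum, step, sub_mul, add_mul, mul_sub, Finset.sum_sub_distrib,
    Finset.sum_add_distrib]
  have h3 : ∑ i ∈ I, d * S.D i * ψ i * S.C (y i * (alpha η p - alpha η i))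
      = ∑ i ∈ I, d * S.D i * ψ i * S.C (y i) * S.C (alpha η p)
        - ∑ i ∈ I, d * S.D i * ψ i * S.C (alpha η i) * S.C (y i) := by
    rw [← Finset.sum_sub_distrib]
    refine Finset.sum_congr rfl fun i _ => ?_
    simp only [mul_assoc, ← mul_sub, ← map_mul, ← map_sub]
    congr 4
    ring
  have h4 : ∑ i ∈ I, d * S.D i * (ψ i * S.C c) * S.C (y i)
      = ∑ i ∈ I, d * S.D i * ψ i * S.C (y i) * S.C c := by
    refine Finset.sum_congr rfl fun i _ => ?_
    simp only [mul_assoc, ← map_mul]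
    rw [mul_comm]
  rw [h2, h3, h4]
  simp only [map_sub, mul_sub, Finset.sum_mul]
  abel

theorem coeffSum_ladder (hv : S.IsVec S.E η ψ) (y : Fin n → R)
    (hdE : ∀ j, (j ∈ insert p ((Finset.Iio p).filter (· ∉ s))) → ∀ i, d * S.E j i = S.E j i * d)
    (hd : ∀ i ∈ s, i < p → d * S.D i = 0)
    (hy : ∀ i ∈ insert p ((Finset.Iio p).filter (· ∉ s)),
      ∑ j ∈ (insert p ((Finset.Iio p).filter (· ∉ s))).filter (i < ·), y j
        = y i * (alpha η p - alpha η i)) (q : ℕ) :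
    S.coeffSum d y (insert p ((Finset.Iio p).filter (· ∉ s))) (S.ladder S.E η ψ q)
      - S.coeffSum d y (insert p ((Finset.Iio p).filter (· ∉ s))) ψ
        * S.C (∏ k ∈ Finset.range q, (alpha η p - alphaNat η k)) ∈ S.M := by
  induction q with
  | zero => simp [ladder]
  | succ q ih =>
    have h1 := coeffSum_step (hv.ladder S.E_comm q) y hdE hd hy (alphaNat η q)
    have h2 := add_mem h1 (M_mul_C ih (alpha η p - alphaNat η q))
    rwa [sub_mul, sub_add_sub_cancel, mul_assoc, ← map_mul, ← Finset.prod_range_succ] at h2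

/-- The products over the indices beyond i telescope: each new factor 1 + g_i adds g_i times the
product already present. -/
theorem prod_one_add_eq (t : Finset (Fin n)) (g : Fin n → R) :
    ∏ i ∈ t, (1 + g i) = 1 + ∑ i ∈ t, g i * ∏ j ∈ t with i < j, (1 + g j) := by
  have := Finset.prod_add_ordered t (fun i => 1 + g i) (fun i => -g i)
  simp only [add_neg_cancel_right, Finset.prod_const_one, mul_one, neg_mul,
    Finset.sum_neg_distrib] at this
  linear_combination -this

variable (η p s) in
-- The eigenvector equation gives y_i as the sum of the later y_j divided by α_p - α_i, so including
-- index i multiplies the partial sum by 1 + 1/(α_p - α_i). Starting from y_p = 1, the total is the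
-- product.
theorem exists_coeff (hu : ∀ i, i < p → i ∉ s → IsUnit (alpha η p - alpha η i)) :
    ∃ y : Fin n → R, y p = 1 ∧ (∀ i ∈ insert p ((Finset.Iio p).filter (· ∉ s)),
      ∑ j ∈ (insert p ((Finset.Iio p).filter (· ∉ s))).filter (i < ·), y j
        = y i * (alpha η p - alpha η i)) ∧
      ∑ j ∈ insert p ((Finset.Iio p).filter (· ∉ s)), y j
        = ∏ i ∈ (Finset.Iio p).filter (· ∉ s), (1 + Ring.inverse (alpha η p - alpha η i)) := by
  set t := (Finset.Iio p).filter (· ∉ s) with ht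
  set g : Fin n → R := fun i => Ring.inverse (alpha η p - alpha η i) with hg
  have hpt : p ∉ t := by simp [ht]
  have hlt : ∀ i ∈ t, i < p := fun i hi => Finset.mem_Iio.1 (Finset.mem_filter.1 hi).1
  let y : Fin n → R := fun i => if i = p then 1 else g i * ∏ j ∈ t with i < j, (1 + g j)
  have hyt : ∀ i ∈ t, y i = g i * ∏ j ∈ t with i < j, (1 + g j) := fun i hi =>
    if_neg (hlt i hi).ne
  have hyp : y p = 1 := if_pos rfl
  refine ⟨y, hyp, fun i hi => ?_, ?_⟩
  · rcases Finset.mem_insert.1 hi with rfl | hi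
    · rw [sub_self, mul_zero, Finset.filter_eq_empty_iff.2, Finset.sum_empty]
      intro j hj
      rcases Finset.mem_insert.1 hj with rfl | hj
      · exact lt_irrefl _
      · exact (hlt j hj).not_gt
    · rw [Finset.filter_insert, if_pos (hlt i hi), Finset.sum_insert (fun h =>
        hpt (Finset.mem_filter.1 h).1), hyp, hyt i hi, mul_right_comm,
        Ring.inverse_mul_cancel _ (hu i (hlt i hi) (Finset.mem_filter.1 hi).2), one_mul,
        prod_one_add_eq]
      congr 1
      refine Finset.sum_congr rfl fun j hj => ?_
      obtain ⟨hj, hij⟩ := Finset.mem_filter.1 hj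
      rw [hyt j hj]
      congr 2
      ext k
      simp only [Finset.mem_filter]
      exact ⟨fun h => ⟨⟨h.1, hij.trans h.2⟩, h.2⟩, fun h => ⟨h.1.1, h.2⟩⟩
  · rw [Finset.sum_insert hpt, hyp, prod_one_add_eq]
    congr 1
    exact Finset.sum_congr rfl hyt

end Coefficients

/-! ### Monomials in the odd coordinates -/

variable (S) in
/-- The factor with index `q` of a monomial in the odd coordinates. -/
def monFactor (s : Finset (Fin n)) (q : ℕ) : B :=
  if h : q < n then if (⟨q, h⟩ : Fin n) ∈ s then S.Z ⟨q, h⟩ else 1 else 1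

variable (S) in
/-- The product of the `ζ^i` with `i ∈ s` and `i < q`. -/
def mon (s : Finset (Fin n)) : ℕ → B
  | 0 => 1
  | q + 1 => mon s q * S.monFactor s q

variable (s : Finset (Fin n))

theorem monFactor_of_mem {p : Fin n} (hp : p ∈ s) : S.monFactor s p = S.Z p := by
  simp [monFactor, hp]

theorem monFactor_of_notMem {p : Fin n} (hp : p ∉ s) : S.monFactor s p = 1 := by
  simp [monFactor, hp]

theorem monFactor_cases (q : ℕ) :
    S.monFactor s q = 1 ∨ ∃ p : Fin n, p ∈ s ∧ q = p ∧ S.monFactor s q = S.Z p := by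
  unfold monFactor
  split_ifs with h1 h2
  · exact Or.inr ⟨⟨q, h1⟩, h2, rfl, rfl⟩
  · exact Or.inl rfl
  · exact Or.inl rfl

variable (S) in
theorem Z_mul_mon (q : ℕ) : (∀ j, S.Z j * S.mon s q = S.mon s q * S.Z j) ∨
    (∀ j, S.Z j * S.mon s q = -(S.mon s q * S.Z j)) := by
  induction q with
  | zero => left; simp [mon]
  | succ q ih =>
    rcases monFactor_cases (S := S) s q with h | ⟨p, -, -, h⟩
    · simpa only [mon, h, mul_one] using ih
    · simp only [mon, h]
      rcases ih with ih | ih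
      · right; intro j
        rw [← mul_assoc, ih, mul_assoc, S.Z_Z, mul_neg, ← mul_assoc]
      · left; intro j
        rw [← mul_assoc, ih, neg_mul, mul_assoc, S.Z_Z, mul_neg, neg_neg, ← mul_assoc]

theorem Z_mul_mon_of_mem {q : ℕ} {k : Fin n} (hk : k ∈ s) (hkq : (k : ℕ) < q) :
    S.Z k * S.mon s q = 0 := by
  induction q with
  | zero => exact absurd hkq (Nat.not_lt_zero _)
  | succ q ih =>
    rcases Nat.lt_succ_iff_lt_or_eq.1 hkq with h | h
    · rw [mon, ← mul_assoc, ih h, zero_mul]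
    · rw [mon, ← h, monFactor_of_mem s hk]
      rcases S.Z_mul_mon s k with h | h <;> rw [← mul_assoc, h] <;>
        simp [mul_assoc, S.Z_self]

theorem E_mul_mon {q : ℕ} (i j : Fin n) (hj : j ∈ s → q ≤ j) :
    S.E i j * S.mon s q = S.mon s q * S.E i j := by
  induction q with
  | zero => simp [mon]
  | succ q ih =>
    rcases monFactor_cases (S := S) s q with h | ⟨p, hp, hq, h⟩
    · simpa only [mon, h, mul_one] using ih fun hs => (Nat.le_succ q).trans (hj hs)
    · have hjp : j ≠ p := by
        rintro rfl
        have := hj hp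
        omega
      rw [mon, h, ← mul_assoc, ih fun hs => (Nat.le_succ q).trans (hj hs), mul_assoc, S.E_Z,
        if_neg hjp, add_zero, mul_assoc]

/-- Under ε this says that ε(ζ^s) ζ^j begins with ζ^j, so it lies in the right ideal. It holds since
δ_j anticommutes with every factor other than ζ^j, and that factor is absent. -/
theorem D_mul_mon {q : ℕ} (j : Fin n) (hj : j ∈ s → q ≤ j) :
    ∃ a, S.D j * S.mon s q = a * S.D j := by
  induction q with
  | zero => exact ⟨1, by simp [mon]⟩
  | succ q ih =>
    obtain ⟨a, ha⟩ := ih fun hs => (Nat.le_succ q).trans (hj hs)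
    rcases monFactor_cases (S := S) s q with h | ⟨p, hp, hq, h⟩
    · exact ⟨a, by rw [mon, h, mul_one, ha]⟩
    · have hjp : p ≠ j := by
        rintro rfl
        have := hj hp
        omega
      refine ⟨-(a * S.Z p), ?_⟩
      rw [mon, h, ← mul_assoc, ha, mul_assoc, S.D_Z, if_neg hjp, zero_sub, mul_neg, neg_mul,
        mul_assoc]

/-- The weight of a monomial in the odd coordinates. -/
def monWt (q : ℕ) (i : Fin n) : ℤ := if i ∈ s ∧ (i : ℕ) < q then 1 else 0

theorem wt_mon (q : ℕ) (hq : q ≤ n) : S.Wt (monWt s q) (S.mon s q) := by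
  induction q with
  | zero =>
    have : monWt s 0 = 0 := by ext; simp [monWt]
    rw [this]; exact S.wt_one
  | succ q ih =>
    have hq' : q < n := hq
    have key : ∀ w, S.Wt w (S.monFactor s q) → monWt s (q + 1) = monWt s q + w →
        S.Wt (monWt s (q + 1)) (S.mon s (q + 1)) := by
      intro w hw h
      rw [h]; exact (ih hq'.le).mul hw
    by_cases hs : (⟨q, hq'⟩ : Fin n) ∈ s
    · refine key (Pi.single ⟨q, hq'⟩ 1) ?_ ?_
      · rw [show S.monFactor s q = S.Z ⟨q, hq'⟩ from monFactor_of_mem s hs]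
        exact S.wt_Z _
      · ext i
        simp only [monWt, Pi.add_apply, Pi.single_apply, Fin.ext_iff]
        by_cases hi : (i : ℕ) = q
        · have : i = ⟨q, hq'⟩ := Fin.ext hi
          simp [this, hs]
        · have : (i : ℕ) < q + 1 ↔ (i : ℕ) < q := by omega
          simp [this, hi]
    · refine key 0 ?_ ?_
      · rw [show S.monFactor s q = 1 from monFactor_of_notMem (p := ⟨q, hq'⟩) s hs]
        exact S.wt_one
      · ext i
        simp only [monWt, Pi.add_apply, Pi.zero_apply, add_zero]
        by_cases hi : (i : ℕ) = q
        · have : i = ⟨q, hq'⟩ := Fin.ext hi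
          simp [this, hs]
        · have : (i : ℕ) < q + 1 ↔ (i : ℕ) < q := by omega
          simp [this]

variable (S) in
/-- The span of the right ideals of the lowering operators with row index below `q`, modulo raising
operators. -/
def lowTo (q : ℕ) : AddSubgroup B :=
  AddSubgroup.closure {x | ∃ (k l : Fin n) (y : B), l < k ∧ (k : ℕ) < q ∧ x = S.E k l * y} ⊔ S.Jp

theorem lowTo_mono {q q' : ℕ} (h : q ≤ q') : S.lowTo q ≤ S.lowTo q' := by
  refine sup_le_sup (AddSubgroup.closure_mono ?_) le_rfl
  rintro _ ⟨k, l, y, hkl, hk, rfl⟩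
  exact ⟨k, l, y, hkl, hk.trans_le h, rfl⟩

theorem lowTo_le_Q (q : ℕ) : S.lowTo q ≤ S.Q := by
  refine sup_le ((AddSubgroup.closure_le _).2 ?_) S.Jp_le_Q
  rintro _ ⟨k, l, y, hkl, hk, rfl⟩
  exact S.Jm_le_Q (S.E_mul_mem_Jm _ hkl)

/-- Left multiplication by ζ^p need not preserve `Q`, but ζ^p commutes with E_kl when l < k < p. The
bound on the row index is kept for this reason. -/
theorem Z_mul_lowTo {p : Fin n} {x : B} (hx : x ∈ S.lowTo p) : S.Z p * x ∈ S.lowTo p := by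
  have : S.lowTo p ≤ (S.lowTo p).comap (AddMonoidHom.mulLeft (S.Z p)) := by
    refine sup_le ((AddSubgroup.closure_le _).2 ?_)
      fun x hx => AddSubgroup.mem_sup_right (S.mul_mem_Jp _ hx)
    rintro _ ⟨k, l, y, hkl, hk, rfl⟩
    change S.Z p * (S.E k l * y) ∈ S.lowTo p
    have hlp : l ≠ p := by
      rintro rfl
      exact absurd hk (not_lt.2 (le_of_lt hkl))
    have := S.E_Z k l p
    rw [if_neg hlp, add_zero] at this
    rw [← mul_assoc, ← this, mul_assoc]
    exact AddSubgroup.mem_sup_left (AddSubgroup.subset_closure ⟨k, l, _, hkl, hk, rfl⟩)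
  exact this hx

variable (S) in
/-- The element `h̊_{ij}`. -/
def hr (i j : Fin n) : R := S.h i - S.h j + ((j : ℤ) - (i : ℤ) : ℤ)

theorem isUnit_hr {i j : Fin n} (hij : i ≠ j) : IsUnit (S.hr i j) := S.isUnit_h i j _ hij

/-- Neither ζ^p nor ζ^i is present in the monomial truncated at p, so the weight contributes
nothing; the counts n - 1 - p and n - 1 - i supply the integer shift in h̊. -/
theorem alpha_sub {p i : Fin n} (hi : i < p) (his : i ∉ s) :
    alpha (S.vecEta (monWt s p)) p - alpha (S.vecEta (monWt s p)) i = -S.hr i p := by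
  have h1 : ((n - 1 - (p : ℕ) : ℕ) : R) - ((n - 1 - (i : ℕ) : ℕ) : R) = (i : R) - (p : R) := by
    have hp := p.2
    have hi' : (i : ℕ) < p := hi
    have : (n - 1 - (p : ℕ)) + (p : ℕ) = (n - 1 - (i : ℕ)) + (i : ℕ) := by omega
    have h := congrArg (Nat.cast : ℕ → R) this
    push_cast at h
    linear_combination h
  simp only [alpha, vecEta, monWt, hr, his, lt_irrefl, and_false, false_and, if_false,
    Int.cast_zero, Int.cast_sub, Int.cast_natCast]
  linear_combination h1

variable (S) in
/-- The scalar square of a monomial. -/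
noncomputable def monNorm (q : ℕ) : R :=
  ∏ j ∈ s.filter (fun j : Fin n => (j : ℕ) < q), ∏ i ∈ (Finset.Iio j).filter (· ∉ s),
    (1 - Ring.inverse (S.hr i j))

theorem monNorm_succ_of_mem {p : Fin n} (hp : p ∈ s) : S.monNorm s (p + 1) = S.monNorm s p
    * ∏ i ∈ (Finset.Iio p).filter (· ∉ s), (1 - Ring.inverse (S.hr i p)) := by
  have : s.filter (fun j : Fin n => (j : ℕ) < p + 1) = insert p (s.filter (fun j : Fin n => (j : ℕ) < p)) := by
    ext j
    simp only [Finset.mem_filter, Finset.mem_insert]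
    constructor
    · rintro ⟨h1, h2⟩
      rcases Nat.lt_succ_iff_lt_or_eq.1 h2 with h | h
      · exact Or.inr ⟨h1, h⟩
      · exact Or.inl (Fin.ext h)
    · rintro (rfl | ⟨h1, h2⟩)
      · exact ⟨hp, Nat.lt_succ_self _⟩
      · exact ⟨h1, h2.trans (Nat.lt_succ_self _)⟩
  rw [monNorm, this, Finset.prod_insert (by simp), mul_comm, monNorm]

theorem monNorm_succ_of_notMem {p : Fin n} (hp : p ∉ s) :
    S.monNorm s (p + 1) = S.monNorm s p := by
  have : s.filter (fun j : Fin n => (j : ℕ) < p + 1) = s.filter (fun j : Fin n => (j : ℕ) < p) := by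
    refine Finset.filter_congr fun j hj => ?_
    have : (j : ℕ) ≠ p := fun h => hp (Fin.ext h ▸ hj)
    omega
  rw [monNorm, this, monNorm]

theorem monWt_succ_of_mem {p : Fin n} (hp : p ∈ s) :
    monWt s (p + 1) = monWt s p + Pi.single p 1 := by
  ext i
  simp only [monWt, Pi.add_apply, Pi.single_apply, Fin.ext_iff]
  by_cases hi : (i : ℕ) = p
  · have : i = p := Fin.ext hi
    simp [this, hp]
  · have : (i : ℕ) < p + 1 ↔ (i : ℕ) < p := by omega
    simp [this, hi]

theorem monWt_succ_of_notMem {p : Fin n} (hp : p ∉ s) : monWt s (p + 1) = monWt s p := by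
  ext i
  simp only [monWt]
  by_cases hi : (i : ℕ) = p
  · have : i = p := Fin.ext hi
    simp [this, hp]
  · have : (i : ℕ) < p + 1 ↔ (i : ℕ) < p := by omega
    simp [this]

/-- The combination `coeffSum` is evaluated at both ends of the ladder. At the start every
coefficient d δ_j ζ^j w is congruent to c, so the value is c ∑ y_j. At the end the components before
p lie in `Jp` and only d δ_p L remains. The ladder multiplies by u = ∏_{k<p} (α_p - α_k), which is
exactly the factor divided out to normalize the singular vector. -/
theorem exists_sing_Z_mon {p : Fin n} {w : B} (hw : S.Sing w) (hww : S.Wt (monWt s p) w)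
    (hwm : w - S.mon s p ∈ S.lowTo p) {c : R} (hc : S.eps (S.mon s p) * w - S.C c ∈ S.M) :
    ∃ b, S.Sing b ∧ S.Wt (monWt s p + Pi.single p 1) b ∧
      b - S.Z p * S.mon s p ∈ S.lowTo (p + 1) ∧
      S.eps (S.mon s p) * S.D p * b
        - S.C (c * ∏ i ∈ (Finset.Iio p).filter (· ∉ s), (1 - Ring.inverse (S.hr i p))) ∈ S.M := by
  have hv := isVec_Z hw hww
  set η := S.vecEta (monWt s p) with hη
  set d := S.eps (S.mon s p) with hd
  set I := insert p ((Finset.Iio p).filter (· ∉ s)) with hI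
  have hIs : ∀ j ∈ I, j ∈ s → (p : ℕ) ≤ j := by
    intro j hj hjs
    rcases Finset.mem_insert.1 hj with rfl | hj
    · exact le_rfl
    · exact absurd hjs (Finset.mem_filter.1 hj).2
  have hdE : ∀ j ∈ I, ∀ i, d * S.E j i = S.E j i * d := by
    intro j hj i
    have := congrArg S.eps (E_mul_mon (S := S) s i j (hIs j hj))
    rwa [S.eps_mul, S.eps_mul, S.eps_E] at this
  have hdD : ∀ i ∈ s, i < p → d * S.D i = 0 := by
    intro i hi hip
    have := congrArg S.eps (Z_mul_mon_of_mem (S := S) s hi hip)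
    rwa [S.eps_mul, S.eps_Z, S.eps_zero] at this
  have hdZ : ∀ j ∈ I, ∀ x, d * S.Z j * x ∈ S.M := by
    intro j hj x
    obtain ⟨a, ha⟩ := D_mul_mon (S := S) s j (hIs j hj)
    have := congrArg S.eps ha
    rw [S.eps_mul, S.eps_mul, S.eps_D] at this
    rw [this, mul_assoc]
    exact Z_mul_mem_M _ _
  have hu : ∀ i, i < p → i ∉ s → IsUnit (alpha η p - alpha η i) := by
    intro i hi his
    rw [alpha_sub s hi his]
    exact (isUnit_hr hi.ne).neg
  obtain ⟨y, hyp, hy, hysum⟩ := exists_coeff η p s hu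
  obtain ⟨u, hu'⟩ := isUnit_prod_alpha (S := S) (vecEta_sub (monWt s p)) p
  rw [← hη] at hu'
  set L := S.ladder S.E η (fun j => S.Z j * w) p p with hL
  have hprod : ∏ i ∈ (Finset.Iio p).filter (· ∉ s), (1 - Ring.inverse (S.hr i p))
      = ∑ j ∈ I, y j := by
    rw [hysum]
    refine Finset.prod_congr rfl fun i hi => ?_
    obtain ⟨hi, his⟩ := Finset.mem_filter.1 hi
    rw [alpha_sub s (Finset.mem_Iio.1 hi) his]
    obtain ⟨v, hv⟩ := isUnit_hr (S := S) (Finset.mem_Iio.1 hi).ne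
    rw [← hv, Ring.inverse_unit, ← Units.val_neg, Ring.inverse_unit, sub_eq_add_neg]
    simp
  refine ⟨L * S.C (u⁻¹ : Rˣ), fun k l hkl => ?_, ?_, ?_, ?_⟩
  · rw [← mul_assoc]
    exact S.Jp_mul_C _ (ladder_self_raise S.E_comm hv p k l hkl)
  · refine wt_of_E_mul fun k => ?_
    rw [← mul_assoc, (hv.ladder S.E_comm _).wt, mul_assoc, mul_assoc, ← map_mul, ← map_mul,
      mul_comm]
    congr 3
    rw [hη, vecEta, add_assoc]
    congr 1
    by_cases h : k = p
    · subst h; simp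
    · simp [h]
  -- The lowering operators that enter component j have row index exactly j; hence the corrections
  -- to component p stay in `lowTo (p + 1)`.
  · let Y : Fin n → AddSubgroup B := fun j =>
      AddSubgroup.closure {x | ∃ l y, l < j ∧ x = S.E j l * y} ⊔ S.Jp
    have hYC : ∀ i, ∀ x ∈ Y i, ∀ φ, x * S.C φ ∈ Y i := by
      intro i x hx φ
      have : Y i ≤ (Y i).comap (AddMonoidHom.mulRight (S.C φ)) := by
        refine sup_le ((AddSubgroup.closure_le _).2 ?_)
          (fun x hx => AddSubgroup.mem_sup_right (S.Jp_mul_C φ hx))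
        rintro _ ⟨l, y, hl, rfl⟩
        exact AddSubgroup.mem_sup_left (AddSubgroup.subset_closure ⟨l, y * S.C φ, hl,
          mul_assoc _ _ _⟩)
      exact this hx
    have h1 := ladder_sub_mem S.E_comm hv (fun _ => ⊤) (fun _ => le_top)
      (fun _ _ _ _ => trivial) (fun _ _ _ _ _ => trivial) (fun _ => trivial) Y
      (fun _ _ h => AddSubgroup.mem_sup_right h) hYC
      (fun i j hij x _ => AddSubgroup.mem_sup_left (AddSubgroup.subset_closure ⟨i, x, hij, rfl⟩))
      p p
    have h2 := hYC _ _ h1 (u⁻¹ : Rˣ)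
    rw [← hu', sub_mul, mul_assoc (S.Z p * w), ← map_mul, Units.mul_inv, map_one, mul_one] at h2
    have h3 : Y p ≤ S.lowTo (p + 1) := by
      refine sup_le ((AddSubgroup.closure_le _).2 ?_) le_sup_right
      rintro _ ⟨l, y, hl, rfl⟩
      exact AddSubgroup.mem_sup_left (AddSubgroup.subset_closure
        ⟨p, l, y, hl, Nat.lt_succ_self _, rfl⟩)
    have h4 := lowTo_mono (Nat.le_succ p) (Z_mul_lowTo hwm)
    have h5 := add_mem (h3 h2) h4
    rwa [mul_sub, sub_add_sub_cancel] at h5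
  · have h1 := coeffSum_ladder hv y hdE hdD hy p
    rw [← hu', ← hI] at h1
    -- Only the index p, where y is 1, survives the p steps.
    have h2 : S.coeffSum d y I (S.ladder S.E η (fun j => S.Z j * w) p) - d * S.D p * L ∈ S.M := by
      rw [coeffSum, hI, Finset.sum_insert (by simp), hyp, map_one, mul_one, add_sub_cancel_left]
      refine sum_mem fun i hi => M_mul_C (Jp_le_M (S.mul_mem_Jp _ ?_)) _
      have hip : i < p := Finset.mem_Iio.1 (Finset.mem_filter.1 hi).1
      exact ladder_mem_Jp S.E_comm hv hip
    -- Here δ_j ζ^j = 1 - ζ^j δ_j, and the second term drops out because d ζ^j begins with ζ^j by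
    -- `D_mul_mon`.
    have h3 : S.coeffSum d y I (fun j => S.Z j * w) - S.C (c * ∑ j ∈ I, y j) ∈ S.M := by
      rw [coeffSum, Finset.mul_sum, map_sum, ← Finset.sum_sub_distrib]
      refine sum_mem fun j hj => ?_
      have h4 := S.D_Z j j
      rw [if_pos rfl] at h4
      have h5 : d * S.D j * (S.Z j * w) * S.C (y j) - S.C (c * y j)
          = (d * w - S.C c) * S.C (y j) - d * S.Z j * (S.D j * w) * S.C (y j) := by
        rw [map_mul, sub_mul, ← mul_assoc, mul_assoc d, h4]
        noncomm_ring
      rw [h5]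
      exact sub_mem (M_mul_C hc _) (M_mul_C (hdZ j hj _) _)
    rw [hprod]
    have h6 := M_mul_C (add_mem (sub_mem h1 h2) (M_mul_C h3 (u : R))) (u⁻¹ : Rˣ)
    refine (congrArg (· ∈ S.M) ?_).mp h6
    have hC : S.C (u : R) * S.C (u⁻¹ : Rˣ) = 1 := by rw [← map_mul, Units.mul_inv, map_one]
    simp only [sub_mul, add_mul, mul_assoc, hC, mul_one]
    abel

theorem exists_sing_mon (q : ℕ) (hq : q ≤ n) : ∃ w, S.Sing w ∧ S.Wt (monWt s q) w ∧
    w - S.mon s q ∈ S.lowTo q ∧ S.eps (S.mon s q) * w - S.C (S.monNorm s q) ∈ S.M := by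
  induction q with
  | zero =>
    refine ⟨1, by simpa using S.sing_C 1, ?_, by simp [mon], ?_⟩
    · have : monWt s 0 = 0 := by ext; simp [monWt]
      rw [this]; exact S.wt_one
    · simp [mon, S.eps_one, monNorm]
  | succ q ih =>
    obtain ⟨w, hw, hww, hwm, hc⟩ := ih (Nat.le_of_succ_le hq)
    obtain ⟨p, rfl⟩ : ∃ p : Fin n, q = p := ⟨⟨q, hq⟩, rfl⟩
    by_cases hp : p ∈ s
    · obtain ⟨b, hb, hbw, hbm, hbc⟩ := exists_sing_Z_mon s hw hww hwm hc
      rw [monWt_succ_of_mem s hp, mon, monFactor_of_mem s hp, monNorm_succ_of_mem s hp]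
      rw [← S.eps_Z, ← S.eps_mul] at hbc
      -- The ladder puts ζ^p on the left of the monomial, whereas the ordered monomial has it on the
      -- right. A sign, if any, occurs in both arguments of the pairing and cancels.
      rcases S.Z_mul_mon s p with h | h
      · rw [h] at hbm hbc
        exact ⟨b, hb, hbw, hbm, hbc⟩
      · rw [h] at hbm hbc
        refine ⟨-b, hb.neg, hbw.neg, ?_, ?_⟩
        · have := neg_mem hbm
          rwa [neg_sub', neg_neg] at this
        · rwa [S.eps_neg, neg_mul, ← mul_neg] at hbc
    · rw [monWt_succ_of_notMem s hp, mon, monFactor_of_notMem s hp, mul_one,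
        monNorm_succ_of_notMem s hp]
      exact ⟨w, hw, hww, lowTo_mono (Nat.le_succ _) hwm, hc⟩

/-- Elements of nonzero weight have no Cartan part. -/
theorem Wt.mem_M {w : Fin n → ℤ} {x : B} (hx : S.Wt w x) {i : Fin n}
    (hi : IsUnit ((w i : ℤ) : R)) : x ∈ S.M := by
  obtain ⟨φ, hφ⟩ := S.exists_sub_C_mem x
  -- The commutator with h_i annihilates the Cartan part φ and multiplies x by the integer w_i,
  -- which is invertible by assumption.
  have h1 := sub_mem (C_mul_M hφ (S.h i)) (M_mul_C hφ (S.h i))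
  have h2 : S.C (S.h i) * (x - S.C φ) - (x - S.C φ) * S.C (S.h i) = x * S.C (w i : R) := by
    rw [mul_sub, sub_mul, ← map_mul, ← map_mul, mul_comm φ, S.C_h, hx, mul_add, map_intCast]
    abel
  rw [h2] at h1
  obtain ⟨u, hu⟩ := hi
  have h3 := M_mul_C h1 (u⁻¹ : Rˣ)
  rwa [mul_assoc, ← map_mul, ← hu, Units.mul_inv, map_one, mul_one] at h3

end OddAlg
-- Functionals that separate the Cartan part
section HighestWeight

attribute [local instance] LieRing.ofAssociativeRing
attribute [local instance] LieAlgebra.ofAssociativeAlgebra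

/-! ### The Fock representation -/

/-- The coordinate vector space underlying the Fock space. -/
abbrev FockVec (n : ℕ) : Type := Fin n → ℂ

/-- The Fock representation of `GDiff(n)` on the exterior algebra. -/
noncomputable def fockRep (n : ℕ) :
    GDiff n →ₐ[ℂ] Module.End ℂ (ExteriorAlgebra ℂ (FockVec n)) :=
  GDiff.lift
    (FreeAlgebra.lift ℂ (Sum.elim
      (fun i => LinearMap.mulLeft ℂ (ExteriorAlgebra.ι ℂ (Pi.single i 1 : FockVec n)))
      (fun i => CliffordAlgebra.contractLeft (Q := (0 : QuadraticForm ℂ (FockVec n)))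
        (LinearMap.proj i : FockVec n →ₗ[ℂ] ℂ)))) (by
    intro x y h
    cases h with
    | zeta_zeta i j =>
      simp only [map_add, map_mul, map_zero, FreeAlgebra.lift_ι_apply, Sum.elim_inl]
      refine LinearMap.ext fun v => ?_
      simp only [LinearMap.add_apply, Module.End.mul_apply, LinearMap.mulLeft_apply,
        LinearMap.zero_apply, ← mul_assoc, ← add_mul]
      rw [ExteriorAlgebra.ι_add_mul_swap, zero_mul]
    | delta_delta i j =>
      simp only [map_add, map_mul, map_zero, FreeAlgebra.lift_ι_apply, Sum.elim_inr]
      refine LinearMap.ext fun v => ?_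
      simp only [LinearMap.add_apply, Module.End.mul_apply, LinearMap.zero_apply]
      rw [CliffordAlgebra.contractLeft_comm, neg_add_cancel]
    | zeta_delta i j =>
      rw [apply_ite (FreeAlgebra.lift ℂ _), map_one, map_zero]
      simp only [map_add, map_mul, FreeAlgebra.lift_ι_apply, Sum.elim_inr, Sum.elim_inl]
      refine LinearMap.ext fun v => ?_
      simp only [LinearMap.add_apply, Module.End.mul_apply, LinearMap.mulLeft_apply]
      have := CliffordAlgebra.contractLeft_ι_mul (Q := (0 : QuadraticForm ℂ (FockVec n)))
        (d := (LinearMap.proj j : FockVec n →ₗ[ℂ] ℂ)) (Pi.single i 1) v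
      change _ + CliffordAlgebra.contractLeft _ (CliffordAlgebra.ι _ _ * v) = _
      rw [this]
      change CliffordAlgebra.ι _ _ * _ + _ = _
      rw [add_sub_cancel]
      by_cases h : i = j
      · subst h; simp
      · simp [h, Ne.symm h])

theorem fockRep_zeta {n : ℕ} (i : Fin n) (v : ExteriorAlgebra ℂ (FockVec n)) :
    fockRep n (zeta i) v = ExteriorAlgebra.ι ℂ (Pi.single i 1 : FockVec n) * v := by
  rw [fockRep, zeta, GDiff.lift_mk, FreeAlgebra.lift_ι_apply]; rfl

theorem fockRep_delta_one {n : ℕ} (i : Fin n) : fockRep n (delta i) 1 = 0 := by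
  rw [fockRep, delta, GDiff.lift_mk, FreeAlgebra.lift_ι_apply]
  exact CliffordAlgebra.contractLeft_one (Q := (0 : QuadraticForm ℂ (FockVec n)))
    (d := (LinearMap.proj i : FockVec n →ₗ[ℂ] ℂ))

/-- The vacuum expectation on `GDiff(n)`. -/
noncomputable def vac (n : ℕ) : GDiff n →ₗ[ℂ] ℂ where
  toFun x := ExteriorAlgebra.algebraMapInv (fockRep n x 1)
  map_add' x y := by rw [map_add, LinearMap.add_apply, map_add]
  map_smul' c x := by rw [map_smul, LinearMap.smul_apply, map_smul, RingHom.id_apply]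

theorem vac_apply {n : ℕ} (x : GDiff n) :
    vac n x = ExteriorAlgebra.algebraMapInv (fockRep n x 1) := rfl

theorem vac_one {n : ℕ} : vac n 1 = 1 := by
  rw [vac_apply, map_one (fockRep n), Module.End.one_apply, map_one]

theorem vac_mul_delta {n : ℕ} (x : GDiff n) (i : Fin n) : vac n (x * delta i) = 0 := by
  rw [vac_apply, map_mul, Module.End.mul_apply, fockRep_delta_one, map_zero, map_zero]

theorem vac_zeta_mul {n : ℕ} (x : GDiff n) (i : Fin n) : vac n (zeta i * x) = 0 := by
  rw [vac_apply, map_mul, Module.End.mul_apply, fockRep_zeta, map_mul]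
  have : ExteriorAlgebra.algebraMapInv (ExteriorAlgebra.ι ℂ (Pi.single i 1 : FockVec n))
      = (0 : ℂ) := by
    simp [ExteriorAlgebra.algebraMapInv]
  rw [this, zero_mul]

/-! ### Functionals filling the first modes -/

/-- The expectation in the state in which the first `k` modes are filled. -/
noncomputable def filled (n : ℕ) : ℕ → (GDiff n →ₗ[ℂ] ℂ)
  | 0 => vac n
  | k + 1 => if h : k < n then
      filled n k ∘ₗ LinearMap.mulLeft ℂ (delta ⟨k, h⟩) ∘ₗ LinearMap.mulRight ℂ (zeta ⟨k, h⟩)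
    else filled n k

theorem filled_succ {n k : ℕ} (h : k < n) (x : GDiff n) :
    filled n (k + 1) x = filled n k (delta ⟨k, h⟩ * (x * zeta ⟨k, h⟩)) := by
  rw [filled, dif_pos h]; rfl

theorem delta_mul_zeta {n : ℕ} (j i : Fin n) :
    (delta j * zeta i : GDiff n) = (if i = j then 1 else 0) - zeta i * delta j :=
  eq_sub_of_add_eq' (zeta_delta i j)

theorem delta_mul_self {n : ℕ} (i : Fin n) : (delta i * delta i : GDiff n) = 0 := by
  have h := delta_delta i i
  rw [← two_smul ℂ] at h
  exact (smul_eq_zero.1 h).resolve_left two_ne_zero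

/-- Filling a mode exchanges the roles of ζ and δ in that mode. The other modes only acquire signs
when moved past δ_k and ζ^k, which does not affect vanishing. -/
theorem filled_spec {n : ℕ} (k : ℕ) (hk : k ≤ n) :
    filled n k 1 = 1 ∧
    (∀ (x : GDiff n) (j : Fin n), k ≤ j →
      filled n k (x * delta j) = 0 ∧ filled n k (zeta j * x) = 0) ∧
    (∀ (x : GDiff n) (j : Fin n), (j : ℕ) < k →
      filled n k (x * zeta j) = 0 ∧ filled n k (delta j * x) = 0) := by
  induction k with
  | zero =>
    exact ⟨vac_one, fun x j _ => ⟨vac_mul_delta x j, vac_zeta_mul x j⟩,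
      fun x j h => absurd h (Nat.not_lt_zero _)⟩
  | succ k ih =>
    obtain ⟨h1, h2, h3⟩ := ih (Nat.le_of_succ_le hk)
    have hn : k < n := hk
    set m : Fin n := ⟨k, hn⟩ with hm
    have hc : ∀ x, filled n (k + 1) x = filled n k (delta m * (x * zeta m)) := filled_succ hn
    refine ⟨?_, fun x j hj => ?_, fun x j hj => ?_⟩
    · rw [hc, one_mul, delta_mul_zeta, if_pos rfl, map_sub, h1, (h2 _ m le_rfl).1, sub_zero]
    · have hne : m ≠ j := by
        intro h; rw [← h] at hj; simp [hm] at hj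
      rw [hc, hc]
      constructor
      · rw [mul_assoc x, delta_mul_zeta, if_neg hne, zero_sub, mul_neg, mul_neg, map_neg,
          ← mul_assoc x, ← mul_assoc (delta m), (h2 _ j (by omega)).1, neg_zero]
      · rw [← mul_assoc, ← mul_assoc, delta_mul_zeta, if_neg hne.symm, zero_sub, neg_mul, neg_mul,
          map_neg, mul_assoc, mul_assoc, (h2 _ j (by omega)).2, neg_zero]
    · rw [hc, hc]
      by_cases hjm : j = m
      · subst hjm
        constructor
        · rw [mul_assoc x, zeta_mul_self, mul_zero, mul_zero, map_zero]
        · rw [mul_assoc, ← mul_assoc, delta_mul_self, zero_mul, map_zero]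
      · have hlt : (j : ℕ) < k := by
          have : (j : ℕ) ≠ k := fun h => hjm (Fin.ext h)
          omega
        constructor
        · rw [mul_assoc x, eq_neg_of_add_eq_zero_left (zeta_zeta j m), mul_neg, mul_neg, map_neg,
            ← mul_assoc x, ← mul_assoc (delta m), (h3 _ j hlt).1, neg_zero]
        · rw [mul_assoc (delta j), ← mul_assoc (delta m),
            eq_neg_of_add_eq_zero_left (delta_delta m j), neg_mul, map_neg, mul_assoc,
            (h3 _ j hlt).2, neg_zero]

/-! ### Highest weight functionals on the enveloping algebra -/

/-- `f` is the matrix coefficient of a highest weight vector of weight `lam`. -/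
structure IsHighest {n : ℕ} (lam : Fin n → ℂ) (f : Ugl n →ₗ[ℂ] ℂ) : Prop where
  one : f 1 = 1
  mul_upper : ∀ (u : Ugl n) (i j : Fin n), i < j → f (u * e i j) = 0
  lower_mul : ∀ (u : Ugl n) (i j : Fin n), j < i → f (e i j * u) = 0
  cartan_mul : ∀ (u : Ugl n) (i : Fin n), f (e i i * u) = lam i * f u

/-- The linear map `e_{ij} ↦ ζ^i δ_j`. -/
noncomputable def oscillatorLin (n : ℕ) : gl n →ₗ[ℂ] GDiff n :=
  ∑ i, ∑ j, (Matrix.entryLinearMap ℂ ℂ i j).smulRight (zeta i * delta j : GDiff n)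

theorem oscillatorLin_single {n : ℕ} (i j : Fin n) (c : ℂ) :
    oscillatorLin n (Matrix.single i j c) = c • (zeta i * delta j) := by
  simp only [oscillatorLin, LinearMap.sum_apply, LinearMap.smulRight_apply,
    Matrix.entryLinearMap_apply]
  rw [Finset.sum_eq_single i, Finset.sum_eq_single j]
  · simp
  · intro b _ hb
    rw [Matrix.single_apply_of_col_ne _ _ hb.symm, zero_smul]
  · simp
  · intro b _ hb
    refine Finset.sum_eq_zero fun k _ => ?_
    rw [Matrix.single_apply_of_row_ne hb.symm, zero_smul]
  · simp

theorem oscillator_comm {n : ℕ} (i j k l : Fin n) :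
    (zeta i * delta j * (zeta k * delta l) : GDiff n) - zeta k * delta l * (zeta i * delta j)
      = (if j = k then zeta i * delta l else 0) - (if l = i then zeta k * delta j else 0) := by
  have h1 : (zeta i * delta j * (zeta k * delta l) : GDiff n)
      = (if j = k then zeta i * delta l else 0) - zeta i * zeta k * (delta j * delta l) := by
    rw [mul_assoc, ← mul_assoc (delta j), delta_mul_zeta, sub_mul, mul_sub]
    by_cases h : j = k
    · simp [h, mul_assoc]
    · simp [h, Ne.symm h, mul_assoc]
  have h2 : (zeta k * delta l * (zeta i * delta j) : GDiff n)
      = (if l = i then zeta k * delta j else 0) - zeta k * zeta i * (delta l * delta j) := by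
    rw [mul_assoc, ← mul_assoc (delta l), delta_mul_zeta, sub_mul, mul_sub]
    by_cases h : l = i
    · simp [h, mul_assoc]
    · simp [h, Ne.symm h, mul_assoc]
  rw [h1, h2, eq_neg_of_add_eq_zero_left (zeta_zeta i k),
    eq_neg_of_add_eq_zero_left (delta_delta j l), neg_mul_neg]
  abel

theorem oscillatorLin_lie {n : ℕ} (x y : gl n) : oscillatorLin n (x * y - y * x)
    = oscillatorLin n x * oscillatorLin n y - oscillatorLin n y * oscillatorLin n x := by
  induction x using Matrix.induction_on' with
  | h_zero => simp
  | h_add p q hp hq =>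
    have : (p + q) * y - y * (p + q) = (p * y - y * p) + (q * y - y * q) := by noncomm_ring
    rw [this, map_add, hp, hq, map_add]; noncomm_ring
  | h_std_basis i j c =>
    induction y using Matrix.induction_on' with
    | h_zero => simp
    | h_add p q hp hq =>
      have : Matrix.single i j c * (p + q) - (p + q) * Matrix.single i j c
        = (Matrix.single i j c * p - p * Matrix.single i j c)
          + (Matrix.single i j c * q - q * Matrix.single i j c) := by noncomm_ring
      rw [this, map_add, hp, hq, map_add]; noncomm_ring
    | h_std_basis k l d =>
      have h := oscillator_comm i j k l
      have h1 : Matrix.single i j c * Matrix.single k l d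
          = if j = k then Matrix.single i l (c * d) else 0 := by
        split_ifs with h
        · subst h; simp
        · simp [h]
      have h2 : Matrix.single k l d * Matrix.single i j c
          = if l = i then Matrix.single k j (c * d) else 0 := by
        split_ifs with h
        · subst h; simp [mul_comm]
        · simp [h]
      rw [h1, h2, oscillatorLin_single, oscillatorLin_single, smul_mul_smul_comm,
        smul_mul_smul_comm, mul_comm d c, ← smul_sub, h, map_sub, apply_ite (oscillatorLin n),
        apply_ite (oscillatorLin n), oscillatorLin_single, oscillatorLin_single, map_zero, smul_sub,
        smul_ite, smul_ite, smul_zero]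

/-- The homomorphism `e_{ij} ↦ ζ^i δ_j`. -/
noncomputable def oscillator (n : ℕ) : Ugl n →ₐ[ℂ] GDiff n :=
  UniversalEnvelopingAlgebra.lift ℂ
    { oscillatorLin n with
      map_lie' := fun {x y} => by
        rw [LieRing.of_associative_ring_bracket, LieRing.of_associative_ring_bracket]
        exact oscillatorLin_lie x y }

theorem oscillator_e {n : ℕ} (i j : Fin n) : oscillator n (e i j) = zeta i * delta j := by
  rw [oscillator, e, UniversalEnvelopingAlgebra.lift_ι_apply]
  change oscillatorLin n _ = _
  rw [oscillatorLin_single, one_smul]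

/-- Under e_ij ↦ ζ^i δ_j the state with the first k modes filled is a highest weight vector of the
k-th fundamental weight (1,…,1,0,…,0). -/
theorem isHighest_filled {n : ℕ} (k : ℕ) (hk : k ≤ n) :
    IsHighest (fun i => if (i : ℕ) < k then 1 else 0)
      (filled n k ∘ₗ (oscillator n).toLinearMap) := by
  obtain ⟨h1, h2, h3⟩ := filled_spec k hk
  refine ⟨?_, fun u i j hij => ?_, fun u i j hij => ?_, fun u i => ?_⟩
  · change filled n k (oscillator n 1) = 1
    rw [map_one, h1]
  · change filled n k (oscillator n (u * e i j)) = 0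
    rw [map_mul, oscillator_e]
    by_cases hj : k ≤ j
    · rw [← mul_assoc, (h2 _ j hj).1]
    · have hi : (i : ℕ) < k := by have : (i : ℕ) < j := hij; omega
      -- Both modes are filled here. As i ≠ j the two factors anticommute, which puts ζ^i, fatal on
      -- a filled mode, at the right end.
      have : (zeta i * delta j : GDiff n) = -(delta j * zeta i) := by
        rw [delta_mul_zeta, if_neg hij.ne, zero_sub, neg_neg]
      rw [this, mul_neg, map_neg, ← mul_assoc, (h3 _ i hi).1, neg_zero]
  · change filled n k (oscillator n (e i j * u)) = 0
    rw [map_mul, oscillator_e]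
    by_cases hi : k ≤ i
    · rw [mul_assoc, (h2 _ i hi).2]
    · have hj : (j : ℕ) < k := by have : (j : ℕ) < i := hij; omega
      have : (zeta i * delta j : GDiff n) = -(delta j * zeta i) := by
        rw [delta_mul_zeta, if_neg hij.ne', zero_sub, neg_neg]
      rw [this, neg_mul, map_neg, mul_assoc, (h3 _ j hj).2, neg_zero]
  · change filled n k (oscillator n (e i i * u)) = _ * filled n k (oscillator n u)
    rw [map_mul, oscillator_e]
    by_cases hi : k ≤ i
    · rw [mul_assoc, (h2 _ i hi).2, if_neg (not_lt.2 hi), zero_mul]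
    · have hi' : (i : ℕ) < k := not_le.1 hi
      have : (zeta i * delta i : GDiff n) = 1 - delta i * zeta i := by
        rw [delta_mul_zeta, if_pos rfl, sub_sub_cancel]
      rw [this, sub_mul, map_sub, mul_assoc, (h3 _ i hi').2, if_pos hi', sub_zero, one_mul, one_mul]

theorem isHighest_zero {n : ℕ} : ∃ f : Ugl n →ₗ[ℂ] ℂ, IsHighest 0 f := by
  let g : Ugl n →ₐ[ℂ] ℂ := UniversalEnvelopingAlgebra.lift ℂ (0 : gl n →ₗ⁅ℂ⁆ ℂ)
  have hg : ∀ i j, g (e i j) = 0 := fun i j => by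
    simp only [g, e, UniversalEnvelopingAlgebra.lift_ι_apply]; rfl
  refine ⟨g.toLinearMap, ?_, fun u i j _ => ?_, fun u i j _ => ?_, fun u i => ?_⟩
  · exact map_one g
  · change g (u * e i j) = 0
    rw [map_mul, hg, mul_zero]
  · change g (e i j * u) = 0
    rw [map_mul, hg, zero_mul]
  · change g (e i i * u) = 0 * g u
    rw [map_mul, hg]

/-- The coproduct of the enveloping algebra. -/
noncomputable def coproduct (n : ℕ) : Ugl n →ₐ[ℂ] Ugl n ⊗[ℂ] Ugl n :=
  UniversalEnvelopingAlgebra.lift ℂ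
    { toFun := fun x => UniversalEnvelopingAlgebra.ι ℂ x ⊗ₜ 1
        + 1 ⊗ₜ UniversalEnvelopingAlgebra.ι ℂ x
      map_add' := fun x y => by
        rw [map_add, TensorProduct.add_tmul, TensorProduct.tmul_add]; abel
      map_smul' := fun r x => by
        rw [map_smul, RingHom.id_apply, smul_add, TensorProduct.smul_tmul', TensorProduct.tmul_smul]
      map_lie' := fun {x y} => by
        have h := (UniversalEnvelopingAlgebra.ι ℂ (L := gl n)).map_lie x y
        rw [LieRing.of_associative_ring_bracket (A := Ugl n)] at h
        rw [h, LieRing.of_associative_ring_bracket]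
        simp only [add_mul, mul_add, Algebra.TensorProduct.tmul_mul_tmul, one_mul, mul_one,
          TensorProduct.sub_tmul, TensorProduct.tmul_sub]
        abel }

theorem coproduct_e {n : ℕ} (i j : Fin n) :
    coproduct n (e i j) = e i j ⊗ₜ 1 + 1 ⊗ₜ e i j := by
  rw [coproduct, e, UniversalEnvelopingAlgebra.lift_ι_apply]; rfl

/-- The tensor product of two highest weight vectors is again one; on functionals this is the
product f ⊗ g composed with the coproduct. -/
theorem IsHighest.add {n : ℕ} {lam mu : Fin n → ℂ} {f g : Ugl n →ₗ[ℂ] ℂ}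
    (hf : IsHighest lam f) (hg : IsHighest mu g) : ∃ h : Ugl n →ₗ[ℂ] ℂ, IsHighest (lam + mu) h := by
  let F : Ugl n ⊗[ℂ] Ugl n →ₗ[ℂ] ℂ := LinearMap.mul' ℂ ℂ ∘ₗ TensorProduct.map f g
  have hF : ∀ x y, F (x ⊗ₜ y) = f x * g y := fun x y => rfl
  have h1 : ∀ (t : Ugl n ⊗[ℂ] Ugl n) (i j : Fin n), i < j →
      F (t * (e i j ⊗ₜ 1 + 1 ⊗ₜ e i j)) = 0 := by
    intro t i j hij
    induction t using TensorProduct.induction_on with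
    | zero => simp
    | add x y hx hy => rw [add_mul, map_add, hx, hy, add_zero]
    | tmul x y =>
      rw [mul_add, map_add, Algebra.TensorProduct.tmul_mul_tmul,
        Algebra.TensorProduct.tmul_mul_tmul, hF, hF, hf.mul_upper _ _ _ hij,
        hg.mul_upper _ _ _ hij, zero_mul, mul_zero, add_zero]
  have h2 : ∀ (t : Ugl n ⊗[ℂ] Ugl n) (i j : Fin n), j < i →
      F ((e i j ⊗ₜ 1 + 1 ⊗ₜ e i j) * t) = 0 := by
    intro t i j hij
    induction t using TensorProduct.induction_on with
    | zero => simp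
    | add x y hx hy => rw [mul_add, map_add, hx, hy, add_zero]
    | tmul x y =>
      rw [add_mul, map_add, Algebra.TensorProduct.tmul_mul_tmul,
        Algebra.TensorProduct.tmul_mul_tmul, hF, hF, hf.lower_mul _ _ _ hij,
        hg.lower_mul _ _ _ hij, zero_mul, mul_zero, add_zero]
  have h3 : ∀ (t : Ugl n ⊗[ℂ] Ugl n) (i : Fin n),
      F ((e i i ⊗ₜ 1 + 1 ⊗ₜ e i i) * t) = (lam + mu) i * F t := by
    intro t i
    induction t using TensorProduct.induction_on with
    | zero => simp
    | add x y hx hy => rw [mul_add, map_add, hx, hy, map_add, mul_add]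
    | tmul x y =>
      rw [add_mul, map_add, Algebra.TensorProduct.tmul_mul_tmul,
        Algebra.TensorProduct.tmul_mul_tmul, hF, hF, hf.cartan_mul, hg.cartan_mul, one_mul, one_mul,
        hF, Pi.add_apply]
      ring
  refine ⟨F ∘ₗ (coproduct n).toLinearMap, ?_, fun u i j hij => ?_, fun u i j hij => ?_,
    fun u i => ?_⟩
  · change F (coproduct n 1) = 1
    rw [map_one, Algebra.TensorProduct.one_def, hF, hf.one, hg.one, mul_one]
  · change F (coproduct n (u * e i j)) = 0
    rw [map_mul, coproduct_e, h1 _ _ _ hij]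
  · change F (coproduct n (e i j * u)) = 0
    rw [map_mul, coproduct_e, h2 _ _ _ hij]
  · change F (coproduct n (e i i * u)) = _ * F (coproduct n u)
    rw [map_mul, coproduct_e, h3]

/-- The dominant weight with fundamental coordinates `a`. -/
def dominantWeight {n : ℕ} (a : Fin n → ℕ) : Fin n → ℂ :=
  fun i => ∑ k ∈ Finset.Ici i, (a k : ℂ)

/-- The weight is the sum of the fundamental weights with multiplicities a_k, so it is reached by
repeated tensor products. -/
theorem exists_isHighest {n : ℕ} (a : Fin n → ℕ) :
    ∃ f : Ugl n →ₗ[ℂ] ℂ, IsHighest (dominantWeight a) f := by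
  have hsum : ∀ s : Finset (Fin n), ∃ f : Ugl n →ₗ[ℂ] ℂ,
      IsHighest (∑ k ∈ s, a k • fun i : Fin n => if (i : ℕ) < k + 1 then (1 : ℂ) else 0) f := by
    intro s
    induction s using Finset.induction_on with
    | empty => simpa using isHighest_zero
    | insert k s hk ih =>
      rw [Finset.sum_insert hk]
      have hm : ∀ m : ℕ, ∃ f : Ugl n →ₗ[ℂ] ℂ,
          IsHighest (m • fun i : Fin n => if (i : ℕ) < k + 1 then (1 : ℂ) else 0) f := by
        intro m
        induction m with
        | zero => simpa using isHighest_zero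
        | succ m ihm =>
          obtain ⟨f, hf⟩ := ihm
          rw [succ_nsmul]
          exact hf.add (isHighest_filled _ k.2)
      obtain ⟨f, hf⟩ := ih
      obtain ⟨g, hg⟩ := hm (a k)
      exact hg.add hf
  convert hsum Finset.univ using 3
  funext i
  rw [Finset.sum_apply, dominantWeight]
  simp only [Pi.smul_apply, nsmul_eq_mul, mul_ite, mul_one, mul_zero, Finset.sum_ite,
    Finset.sum_const_zero, add_zero]
  refine Finset.sum_congr ?_ fun _ _ => rfl
  ext k
  simp

/-! ### Functionals on `A` -/

/-- `χ` vanishes on the left ideal generated by the `δ_i` and by `n₊`, and on the right ideal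
generated by the `ζ^i` and `n₋`; the Cartan elements act from the left by the weight `lam`. -/
structure IsVacuum {n : ℕ} (lam : Fin n → ℂ) (χ : A n →ₗ[ℂ] ℂ) : Prop where
  one : χ 1 = 1
  mul_upper : ∀ (a : A n) (i j : Fin n), i < j → χ (a * E i j) = 0
  lower_mul : ∀ (a : A n) (i j : Fin n), j < i → χ (E i j * a) = 0
  mul_delta : ∀ (a : A n) (i : Fin n), χ (a * (delta i ⊗ₜ 1)) = 0
  zeta_mul : ∀ (a : A n) (i : Fin n), χ ((zeta i ⊗ₜ 1) * a) = 0
  cartan_mul : ∀ (p : Uh n) (a : A n), χ (cartan n p * a) = MvPolynomial.eval lam p * χ a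

/-- The functional is the vacuum expectation tensored with a highest weight functional. The vacuum
expectation kills any product that begins or ends with ζ^i δ_j, so the diagonal E_ij acts through
e_ij alone and its weight is that of the second factor. -/
theorem exists_isVacuum {n : ℕ} (a : Fin n → ℕ) :
    ∃ χ : A n →ₗ[ℂ] ℂ, IsVacuum (dominantWeight a) χ := by
  obtain ⟨f, hf⟩ := exists_isHighest a
  let F : A n →ₗ[ℂ] ℂ := LinearMap.mul' ℂ ℂ ∘ₗ TensorProduct.map (vac n) f
  have hF : ∀ x y, F (x ⊗ₜ y) = vac n x * f y := fun x y => rfl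
  have hE : ∀ (t : A n) (i : Fin n), F (E i i * t) = dominantWeight a i * F t := by
    intro t i
    induction t using TensorProduct.induction_on with
    | zero => simp
    | add x y hx hy => rw [mul_add, map_add, hx, hy, map_add, mul_add]
    | tmul x y =>
      rw [E, add_mul, map_add, Algebra.TensorProduct.tmul_mul_tmul,
        Algebra.TensorProduct.tmul_mul_tmul, hF, hF, hF, hf.cartan_mul, mul_assoc, vac_zeta_mul,
        one_mul, one_mul]
      ring
  refine ⟨F, ?_, fun t i j hij => ?_, fun t i j hij => ?_, fun t i => ?_, fun t i => ?_,
    fun p t => ?_⟩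
  · rw [Algebra.TensorProduct.one_def, hF, vac_one, hf.one, mul_one]
  · induction t using TensorProduct.induction_on with
    | zero => simp
    | add x y hx hy => rw [add_mul, map_add, hx, hy, add_zero]
    | tmul x y =>
      rw [E, mul_add, map_add, Algebra.TensorProduct.tmul_mul_tmul,
        Algebra.TensorProduct.tmul_mul_tmul, hF, hF, hf.mul_upper _ _ _ hij, ← mul_assoc,
        vac_mul_delta, zero_mul, mul_zero, add_zero]
  · induction t using TensorProduct.induction_on with
    | zero => simp
    | add x y hx hy => rw [mul_add, map_add, hx, hy, add_zero]
    | tmul x y =>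
      rw [E, add_mul, map_add, Algebra.TensorProduct.tmul_mul_tmul,
        Algebra.TensorProduct.tmul_mul_tmul, hF, hF, hf.lower_mul _ _ _ hij, mul_assoc,
        vac_zeta_mul, zero_mul, mul_zero, add_zero]
  · induction t using TensorProduct.induction_on with
    | zero => simp
    | add x y hx hy => rw [add_mul, map_add, hx, hy, add_zero]
    | tmul x y => rw [Algebra.TensorProduct.tmul_mul_tmul, hF, vac_mul_delta, zero_mul]
  · induction t using TensorProduct.induction_on with
    | zero => simp
    | add x y hx hy => rw [mul_add, map_add, hx, hy, add_zero]
    | tmul x y => rw [Algebra.TensorProduct.tmul_mul_tmul, hF, vac_zeta_mul, zero_mul]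
  · induction p using MvPolynomial.induction_on generalizing t with
    | C r =>
      rw [← MvPolynomial.algebraMap_eq, AlgHom.commutes, ← Algebra.smul_def, map_smul,
        MvPolynomial.algebraMap_eq, MvPolynomial.eval_C, smul_eq_mul]
    | add p q hp hq => rw [map_add, add_mul, map_add, hp, hq, map_add, add_mul]
    | mul_X p i hp =>
      rw [map_mul (cartan n), mul_assoc, hp, cartan_X, hE, map_mul (MvPolynomial.eval _),
        MvPolynomial.eval_X, mul_assoc]

/-- The entries of a weight depend on its fundamental coordinates by a linear bijection, inverted by
taking successive differences, and a polynomial that vanishes on ℕ^n is zero. -/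
theorem eq_zero_of_eval_dominantWeight {n : ℕ} (p : Uh n)
    (h : ∀ a : Fin n → ℕ, MvPolynomial.eval (dominantWeight a) p = 0) : p = 0 := by
  let L : (Fin n → ℂ) → (Fin n → ℂ) := fun b i => ∑ k ∈ Finset.Ici i, b k
  have hL : ∀ v : Fin n → ℂ, ∃ b, L b = v := by
    intro v
    let w : ℕ → ℂ := fun m => if h : m < n then v ⟨m, h⟩ else 0
    have hw : ∀ i : Fin n, w i = v i := fun i => dif_pos i.2
    refine ⟨fun i => w i - w (i + 1), funext fun i => ?_⟩
    have h1 : ∑ k ∈ (Finset.Ici i).map Fin.valEmbedding, (w k - w (k + 1)) = v i := by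
      have h2 := Finset.sum_Ico_sub (fun k => -w k) i.2.le
      simp only [neg_sub_neg] at h2
      rw [Fin.map_valEmbedding_Ici, h2, hw]
      simp [w]
    rwa [Finset.sum_map] at h1
  let q : Uh n := MvPolynomial.bind₁
    (fun i => ∑ k ∈ Finset.Ici i, MvPolynomial.X k) p
  have hq : ∀ b, MvPolynomial.eval b q = MvPolynomial.eval (L b) p := by
    intro b
    simp only [q, L, MvPolynomial.eval, MvPolynomial.eval₂Hom_bind₁, map_sum,
      MvPolynomial.eval₂Hom_X']
  have hq0 : q = 0 := by
    refine MvPolynomial.funext_set (fun _ => Set.range ((↑) : ℕ → ℂ))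
      (fun _ => Set.infinite_range_of_injective Nat.cast_injective) fun b hb => ?_
    choose a ha using fun i => hb i (Set.mem_univ i)
    have hb' : b = fun i => (a i : ℂ) := funext fun i => (ha i).symm
    rw [hq, map_zero, hb']
    exact h a
  refine MvPolynomial.funext fun v => ?_
  obtain ⟨b, rfl⟩ := hL v
  rw [← hq, hq0, map_zero, map_zero]

end HighestWeight
/-! ### The localized algebra -/

theorem isUnit_hvar_sub {n : ℕ} (i j : Fin n) (k : ℤ) (hij : i ≠ j) :
    IsUnit (hvar i - hvar j + (k : UhBar n)) := by
  have h : IsUnit (algebraMap (Uh n) (UhBar n)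
      (MvPolynomial.X i - MvPolynomial.X j + MvPolynomial.C (k : ℂ))) :=
    IsLocalization.map_units (UhBar n) (⟨_, Submonoid.subset_closure ⟨i, j, k, hij, rfl⟩⟩ : K n)
  rw [← MvPolynomial.algebraMap_eq, map_intCast] at h
  simpa only [hvar, map_add, map_sub, map_intCast] using h

/-- The localized algebra as an instance of the abstract structure. -/
noncomputable def oddAlg (n : ℕ) : OddAlg n (UhBar n) (ABar n) where
  E := Eb
  Z := Zb
  D := Db
  C := cartanBar n
  h := hvar
  shift := shiftBar
  eps := eps
  E_comm := Eb_comm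
  E_Z := Eb_mul_Zb
  E_D := Eb_mul_Db
  Z_Z := Zb_mul_Zb
  D_Z := Db_mul_Zb
  Z_self := Zb_mul_self
  C_h := cartanBar_hvar
  C_mul := fun _ _ h φ => IsWt.cartanBar_mul h φ
  shift_neg := shiftBar_neg
  isUnit_h := isUnit_hvar_sub
  eps_add := eps_add
  eps_mul := eps_mul
  eps_E := eps_Eb
  eps_Z := eps_Zb
  eps_D := eps_Db
  eps_C := eps_cartanBar
  eps_eps := eps_eps
  left_induction := left_induction

/-! ### The Cartan part is unique -/

theorem toBar_eq_toBar {n : ℕ} {a b : A n} (h : toBar n a = toBar n b) :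
    ∃ p ∈ K n, cartan n p * a = cartan n p * b := by
  change a /ₒ (1 : KA n) = b /ₒ (1 : KA n) at h
  obtain ⟨⟨_, p, hp, rfl⟩, v, h1, h2⟩ := OreLocalization.oreDiv_eq_iff.1 h
  refine ⟨p, hp, ?_⟩
  simp only [OneMemClass.coe_one, mul_one] at h2
  rw [← h2] at h1
  exact h1.symm

theorem toBar_cartan_mul_cartanBar_mk' {n : ℕ} (f : Uh n) (s : K n) :
    toBar n (cartan n s) * cartanBar n (IsLocalization.mk' (UhBar n) f s)
      = toBar n (cartan n f) := by
  rw [← cartanBar_algebraMap, ← cartanBar_algebraMap, ← map_mul, mul_comm, IsLocalization.mk'_spec]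

theorem E_weight {n : ℕ} (k l i : Fin n) : (E i i * E k l : A n)
    = E k l * (E i i + (((Pi.single k 1 - Pi.single l 1 : Fin n → ℤ) i : ℤ) : A n)) := by
  rw [E_comm, mul_add]
  congr 1
  simp only [Pi.sub_apply, Pi.single_apply]
  by_cases h : i = k <;> by_cases h' : i = l
  · subst h; subst h'; simp
  · subst h; simp [h', Ne.symm h']
  · subst h'; simp [h]
  · simp [h, h', Ne.symm h']

theorem zeta_weight {n : ℕ} (k i : Fin n) : (E i i * (zeta k ⊗ₜ 1) : A n)
    = (zeta k ⊗ₜ 1) * (E i i + (((Pi.single k 1 : Fin n → ℤ) i : ℤ) : A n)) := by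
  rw [H_zeta]
  by_cases h : i = k <;> simp [h]

theorem mul_neg_eq_neg {B : Type*} [Ring B] {u x v : B} (h : u * x = v) : u * -x = -v := by
  rw [mul_neg, h]

/-- The elements whose numerators are annihilated by all the vacuum functionals. -/
def vacuumKernel (n : ℕ) : AddSubgroup (ABar n) where
  carrier := {x | ∃ p ∈ K n, ∃ a : A n, toBar n (cartan n p) * x = toBar n a ∧
    ∀ lam χ, IsVacuum lam χ → χ a = 0}
  zero_mem' := ⟨1, one_mem _, 0, by rw [mul_zero, map_zero], fun _ χ _ => map_zero χ⟩
  add_mem' := by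
    rintro x y ⟨p, hp, a, ha, hχa⟩ ⟨q, hq, b, hb, hχb⟩
    refine ⟨p * q, mul_mem hp hq, cartan n q * a + cartan n p * b, ?_, fun lam χ hχ => ?_⟩
    · rw [map_add, map_mul (toBar n), map_mul (toBar n), ← ha, ← hb, ← mul_assoc, ← mul_assoc,
        ← map_mul (toBar n), ← map_mul (toBar n), ← map_mul, ← map_mul, mul_comm q, mul_add]
    · rw [map_add, hχ.cartan_mul, hχ.cartan_mul, hχa _ _ hχ, hχb _ _ hχ, mul_zero, mul_zero,
        add_zero]
  neg_mem' := by
    rintro x ⟨p, hp, a, ha, hχa⟩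
    refine ⟨p, hp, -a, ?_, fun lam χ hχ => ?_⟩
    · exact (mul_neg_eq_neg ha).trans (map_neg (toBar n) a).symm
    · rw [map_neg, hχa _ _ hχ, neg_zero]

theorem mul_toBar_mem_vacuumKernel {n : ℕ} (x : ABar n) {b : A n}
    (hb : ∀ lam χ, IsVacuum lam χ → ∀ a, χ (a * b) = 0) :
    x * toBar n b ∈ vacuumKernel n := by
  obtain ⟨a, p, hp, h⟩ := oreDiv_eq x
  refine ⟨p, hp, a * b, ?_, fun lam χ hχ => hb lam χ hχ a⟩
  rw [← mul_assoc, h, map_mul]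

/-- Since b is a weight vector, the denominator of x can be carried to its left after a shift. -/
theorem toBar_mul_mem_vacuumKernel {n : ℕ} (x : ABar n) {b : A n} {w : Fin n → ℤ}
    (hw : ∀ i, E i i * b = b * (E i i + (w i : A n)))
    (hb : ∀ lam χ, IsVacuum lam χ → ∀ a, χ (b * a) = 0) :
    toBar n b * x ∈ vacuumKernel n := by
  obtain ⟨a, p, hp, h⟩ := oreDiv_eq x
  refine ⟨shift (-w) p, shift_mem _ hp, b * a, ?_, fun lam χ hχ => hb lam χ hχ a⟩
  rw [← mul_assoc, ← map_mul, HGrassmann.cartan_mul hw, shift_neg, map_mul, mul_assoc, h, map_mul]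

theorem M_le_vacuumKernel {n : ℕ} : (oddAlg n).M ≤ vacuumKernel n := by
  refine sup_le (sup_le ((AddSubgroup.closure_le _).2 ?_) ((AddSubgroup.closure_le _).2 ?_))
    (sup_le ((AddSubgroup.closure_le _).2 ?_) ((AddSubgroup.closure_le _).2 ?_))
  · rintro _ ⟨a, i, rfl⟩
    exact mul_toBar_mem_vacuumKernel a fun lam χ hχ t => hχ.mul_delta t i
  · rintro _ ⟨a, i, j, hij, rfl⟩
    exact mul_toBar_mem_vacuumKernel a fun lam χ hχ t => hχ.mul_upper t i j hij
  · rintro _ ⟨a, i, rfl⟩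
    exact toBar_mul_mem_vacuumKernel a (zeta_weight i) fun lam χ hχ t => hχ.zeta_mul t i
  · rintro _ ⟨a, i, j, hij, rfl⟩
    exact toBar_mul_mem_vacuumKernel a (E_weight i j) fun lam χ hχ t => hχ.lower_mul t i j hij

theorem K_le_nonZeroDivisors (n : ℕ) : K n ≤ nonZeroDivisors (Uh n) := by
  refine (Submonoid.closure_le).2 ?_
  rintro _ ⟨i, j, k, hij, rfl⟩
  refine mem_nonZeroDivisors_of_ne_zero fun h => ?_
  -- At h_i = 1 - k, with all other variables zero, the generator h_i - h_j + k takes the value 1.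
  have h1 := congrArg (MvPolynomial.eval (Pi.single i (1 - k : ℂ))) h
  simp [hij.symm] at h1

/-- After denominators are cleared, the vacuum functionals show that the numerator of c times two
elements of `K` vanishes at every dominant weight. It is therefore zero, and the denominators are
nonzero in a domain. -/
theorem eq_zero_of_cartanBar_mem_M {n : ℕ} {c : UhBar n} (hc : cartanBar n c ∈ (oddAlg n).M) :
    c = 0 := by
  obtain ⟨p, hp, a, ha, hχ⟩ := M_le_vacuumKernel hc
  obtain ⟨f, s, rfl⟩ := IsLocalization.exists_mk'_eq (K n) c
  have h1 : toBar n (cartan n (p * f)) = toBar n (cartan n s * a) := by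
    rw [map_mul (toBar n), ← ha, map_mul, map_mul, ← toBar_cartan_mul_cartanBar_mk' f s,
      ← mul_assoc, ← mul_assoc, ← map_mul, ← map_mul, ← map_mul, ← map_mul, mul_comm p]
  obtain ⟨r, hr, h2⟩ := toBar_eq_toBar h1
  have h3 : r * (p * f) = 0 := by
    refine eq_zero_of_eval_dominantWeight _ fun b => ?_
    obtain ⟨χ, hv⟩ := exists_isVacuum b
    have h4 := congrArg χ h2
    rwa [← map_mul, ← mul_one (cartan n (r * (p * f))), hv.cartan_mul, hv.one, mul_one,
      hv.cartan_mul, hv.cartan_mul, hχ _ _ hv, mul_zero, mul_zero] at h4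
  have hr0 := nonZeroDivisors.ne_zero (K_le_nonZeroDivisors n hr)
  have hp0 := nonZeroDivisors.ne_zero (K_le_nonZeroDivisors n hp)
  have hf : f = 0 := ((mul_eq_zero.1 h3).resolve_left hr0 |> mul_eq_zero.1).resolve_left hp0
  rw [hf, IsLocalization.mk'_zero]

namespace OddAlg

variable {n : ℕ} {R B : Type*} [CommRing R] [Ring B] {S : OddAlg n R B}

theorem Sing.sub {b c : B} (hb : S.Sing b) (hc : S.Sing c) : S.Sing (b - c) := by
  rw [sub_eq_add_neg]; exact hb.add hc.neg

theorem Wt.eps {w : Fin n → ℤ} {x : B} (hx : S.Wt w x) : S.Wt (-w) (S.eps x) := by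
  intro i
  have h := congrArg S.eps (hx i)
  have hw : S.eps (w i : B) = (w i : B) := by rw [← map_intCast S.C, S.eps_C]
  rw [S.eps_mul, S.eps_mul, S.eps_add, S.eps_E, hw, add_mul, Int.cast_comm (w i)] at h
  rw [mul_add, h, Pi.neg_apply, Int.cast_neg, mul_neg, add_neg_cancel_right]

end OddAlg

/-! ### The reduction algebra -/

/-- Complex scalars are Cartan elements; this reconciles the ℂ-spans in the definitions of the
ideals with the additive subgroups of the abstract setting. -/
theorem smul_eq_cartanBar_mul {n : ℕ} (r : ℂ) (x : ABar n) :
    r • x = cartanBar n (algebraMap (Uh n) (UhBar n) (MvPolynomial.C r)) * x := by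
  rw [cartanBar_algebraMap, ← MvPolynomial.algebraMap_eq, AlgHom.commutes, Algebra.smul_def]
  rfl

theorem smul_eq_mul_cartanBar {n : ℕ} (r : ℂ) (x : ABar n) :
    r • x = x * cartanBar n (algebraMap (Uh n) (UhBar n) (MvPolynomial.C r)) := by
  rw [cartanBar_algebraMap, ← MvPolynomial.algebraMap_eq, AlgHom.commutes, Algebra.smul_def,
    Algebra.commutes]
  rfl

theorem mem_Jplus {n : ℕ} {x : ABar n} : x ∈ Jplus n ↔ x ∈ (oddAlg n).Jp := by
  constructor
  · intro hx
    induction hx using Submodule.span_induction with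
    | mem x hx => exact AddSubgroup.subset_closure hx
    | zero => exact zero_mem _
    | add x y _ _ hx hy => exact add_mem hx hy
    | smul r x _ hx => rw [smul_eq_cartanBar_mul]; exact (oddAlg n).mul_mem_Jp _ hx
  · intro hx
    exact (AddSubgroup.closure_le (Jplus n).toAddSubgroup).2 Submodule.subset_span hx

theorem mem_Jminus {n : ℕ} {x : ABar n} : x ∈ Jminus n ↔ x ∈ (oddAlg n).Jm := by
  constructor
  · intro hx
    induction hx using Submodule.span_induction with
    | mem x hx => exact AddSubgroup.subset_closure hx
    | zero => exact zero_mem _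
    | add x y _ _ hx hy => exact add_mem hx hy
    | smul r x _ hx => rw [smul_eq_mul_cartanBar]; exact (oddAlg n).Jm_mul_mem _ hx
  · intro hx
    exact (AddSubgroup.closure_le (Jminus n).toAddSubgroup).2 Submodule.subset_span hx

theorem cls_eq_zero {n : ℕ} {x : ABar n} : cls x = 0 ↔ x ∈ (oddAlg n).Q := by
  rw [cls, Submodule.mkQ_apply, Submodule.Quotient.mk_eq_zero, Submodule.mem_sup]
  constructor
  · rintro ⟨y, hy, z, hz, rfl⟩
    exact AddSubgroup.mem_sup.2 ⟨y, mem_Jminus.1 hy, z, mem_Jplus.1 hz, rfl⟩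
  · intro h
    obtain ⟨y, hy, z, hz, rfl⟩ := AddSubgroup.mem_sup.1 h
    exact ⟨y, mem_Jminus.2 hy, z, mem_Jplus.2 hz, rfl⟩

theorem cls_eq_cls {n : ℕ} {x y : ABar n} : cls x = cls y ↔ x - y ∈ (oddAlg n).Q := by
  rw [← cls_eq_zero, map_sub]
  exact sub_eq_zero.symm

theorem cls_surjective {n : ℕ} : Function.Surjective (cls : ABar n →ₗ[ℂ] ZBar n) :=
  Submodule.mkQ_surjective _

theorem isNormalizing_iff {n : ℕ} {b : ABar n} : IsNormalizing b ↔ (oddAlg n).Sing b := by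
  constructor
  · intro h k l hkl
    exact mem_Jplus.1 (h _ (Submodule.subset_span ⟨1, k, l, hkl, (one_mul _).symm⟩))
  · intro h a ha
    exact mem_Jplus.2 (h.Jp_mul (mem_Jplus.1 ha))

theorem exists_sing_cls_eq {n : ℕ} (y : ZBar n) : ∃ b, (oddAlg n).Sing b ∧ cls b = y := by
  obtain ⟨x, rfl⟩ := cls_surjective y
  obtain ⟨b, hb, h⟩ := (oddAlg n).exists_sing_sub_mem x
  exact ⟨b, hb, (cls_eq_cls.2 h).symm⟩

/-- The representative picked in `diamond` and the given `b` are both singular and differ by an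
element of `Q`, so the products with `a` have the same double coset. -/
theorem diamond_cls {n : ℕ} (a : ABar n) {b : ABar n} (hb : (oddAlg n).Sing b) :
    diamond (cls a) (cls b) = cls (a * b) := by
  have h : ∃ c : ABar n, IsNormalizing c ∧ cls c = cls b := ⟨b, isNormalizing_iff.2 hb, rfl⟩
  rw [diamond, dif_pos h, rightMul_cls, cls_eq_cls]
  exact (isNormalizing_iff.1 h.choose_spec.1).mul_sub_mem_Q hb (cls_eq_cls.1 h.choose_spec.2) a

theorem smul_mem_Idel {n : ℕ} (r : ℂ) {x : ABar n} (hx : x ∈ (oddAlg n).Idel) :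
    r • x ∈ (oddAlg n).Idel := by
  rw [smul_eq_cartanBar_mul]
  set φ := algebraMap (Uh n) (UhBar n) (MvPolynomial.C r)
  have : (oddAlg n).Idel ≤ (oddAlg n).Idel.comap (AddMonoidHom.mulLeft (cartanBar n φ)) := by
    refine sup_le ((AddSubgroup.closure_le _).2 ?_)
      fun x hx => AddSubgroup.mem_sup_right ((oddAlg n).C_mul_Q φ hx)
    rintro _ ⟨a, b, i, hb, hi, rfl⟩
    exact AddSubgroup.mem_sup_left (AddSubgroup.subset_closure
      ⟨cartanBar n φ * a, b, i, hb, hi, (mul_assoc _ _ _).symm⟩)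
  exact this hx

theorem smul_mem_Izet {n : ℕ} (r : ℂ) {x : ABar n} (hx : x ∈ (oddAlg n).Izet) :
    r • x ∈ (oddAlg n).Izet := by
  rw [smul_eq_mul_cartanBar]
  set φ := algebraMap (Uh n) (UhBar n) (MvPolynomial.C r)
  have : (oddAlg n).Izet ≤ (oddAlg n).Izet.comap (AddMonoidHom.mulRight (cartanBar n φ)) := by
    refine sup_le ((AddSubgroup.closure_le _).2 ?_)
      fun x hx => AddSubgroup.mem_sup_right (((oddAlg n).sing_C φ).Q_mul hx)
    rintro _ ⟨b, i, hb, rfl⟩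
    exact AddSubgroup.mem_sup_left (AddSubgroup.subset_closure
      ⟨b * cartanBar n φ, i, hb.mul ((oddAlg n).sing_C φ), mul_assoc _ _ _⟩)
  exact this hx

theorem cls_mem_span {n : ℕ} {s : Set (ZBar n)} {H : AddSubgroup (ABar n)}
    (hQ : (oddAlg n).Q ≤ H) (hsmul : ∀ (r : ℂ), ∀ x ∈ H, r • x ∈ H)
    (hs : ∀ w ∈ s, ∃ x ∈ H, cls x = w) {x : ABar n} (hx : cls x ∈ Submodule.span ℂ s) : x ∈ H := by
  have key : ∀ w ∈ Submodule.span ℂ s, ∃ x ∈ H, cls x = w := by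
    intro w hw
    induction hw using Submodule.span_induction with
    | mem w hw => exact hs w hw
    | zero => exact ⟨0, zero_mem _, map_zero _⟩
    | add w v _ _ hw hv =>
      obtain ⟨x, hx, rfl⟩ := hw
      obtain ⟨y, hy, rfl⟩ := hv
      exact ⟨x + y, add_mem hx hy, map_add _ _ _⟩
    | smul r w _ hw =>
      obtain ⟨x, hx, rfl⟩ := hw
      exact ⟨r • x, hsmul r x hx, map_smul _ _ _⟩
  obtain ⟨y, hy, h⟩ := key _ hx
  exact mem_of_sub_mem (hQ (cls_eq_cls.1 h.symm)) hy

theorem cls_mem_Idelta {n : ℕ} {x : ABar n} : cls x ∈ Idelta n ↔ x ∈ (oddAlg n).Idel := by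
  constructor
  · refine cls_mem_span le_sup_right (fun r x hx => smul_mem_Idel r hx) ?_
    rintro _ ⟨z, i, rfl⟩
    obtain ⟨a, rfl⟩ := cls_surjective z
    obtain ⟨b, hb, h⟩ := exists_sing_cls_eq (image (delta i : GDiff n))
    rw [← h, diamond_cls a hb]
    exact ⟨a * b, AddSubgroup.mem_sup_left (AddSubgroup.subset_closure
      ⟨a, b, i, hb, cls_eq_cls.1 h.symm, rfl⟩), rfl⟩
  · intro hx
    have : (oddAlg n).Idel ≤ ((Idelta n).comap cls).toAddSubgroup := by
      refine sup_le ((AddSubgroup.closure_le _).2 ?_) fun x hx => ?_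
      · rintro _ ⟨a, b, i, hb, hi, rfl⟩
        change cls (a * b) ∈ Idelta n
        rw [← diamond_cls a hb, ← cls_eq_cls.2 hi]
        exact Submodule.subset_span ⟨_, i, rfl⟩
      · change cls x ∈ Idelta n
        rw [cls_eq_zero.2 hx]
        exact zero_mem _
    exact this hx

theorem cls_mem_Izeta {n : ℕ} {x : ABar n} : cls x ∈ Izeta n ↔ x ∈ (oddAlg n).Izet := by
  constructor
  · refine cls_mem_span le_sup_right (fun r x hx => smul_mem_Izet r hx) ?_
    rintro _ ⟨z, i, rfl⟩
    obtain ⟨b, hb, rfl⟩ := exists_sing_cls_eq z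
    rw [image, diamond_cls _ hb]
    exact ⟨_, AddSubgroup.mem_sup_left (AddSubgroup.subset_closure ⟨b, i, hb, rfl⟩), rfl⟩
  · intro hx
    have : (oddAlg n).Izet ≤ ((Izeta n).comap cls).toAddSubgroup := by
      refine sup_le ((AddSubgroup.closure_le _).2 ?_) fun x hx => ?_
      · rintro _ ⟨b, i, hb, rfl⟩
        change cls (Zb i * b) ∈ Izeta n
        rw [← diamond_cls _ hb]
        exact Submodule.subset_span ⟨_, i, rfl⟩
      · change cls x ∈ Izeta n
        rw [cls_eq_zero.2 hx]
        exact zero_mem _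
    exact this hx

theorem cls_mem_sup {n : ℕ} {x : ABar n} : cls x ∈ Idelta n ⊔ Izeta n ↔ x ∈ (oddAlg n).M := by
  rw [OddAlg.M, ← OddAlg.Idel_sup_Izet, Submodule.mem_sup]
  constructor
  · rintro ⟨u, hu, v, hv, h⟩
    obtain ⟨y, rfl⟩ := cls_surjective u
    obtain ⟨z, rfl⟩ := cls_surjective v
    rw [← map_add] at h
    exact mem_of_sub_mem (AddSubgroup.mem_sup_left (AddSubgroup.mem_sup_right
      (cls_eq_cls.1 h.symm)))
      (AddSubgroup.mem_sup.2 ⟨y, cls_mem_Idelta.1 hu, z, cls_mem_Izeta.1 hv, rfl⟩)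
  · intro hx
    obtain ⟨y, hy, z, hz, rfl⟩ := AddSubgroup.mem_sup.1 hx
    exact ⟨_, cls_mem_Idelta.2 hy, _, cls_mem_Izeta.2 hz, (map_add _ _ _).symm⟩

theorem eq_of_sub_cartanBar_mem_M {n : ℕ} {x : ABar n} {c c' : UhBar n}
    (h : x - cartanBar n c ∈ (oddAlg n).M) (h' : x - cartanBar n c' ∈ (oddAlg n).M) : c' = c := by
  have h1 := sub_mem h h'
  rw [sub_sub_sub_cancel_left, ← map_sub] at h1
  exact sub_eq_zero.1 (eq_zero_of_cartanBar_mem_M h1)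

theorem harishChandra_cls {n : ℕ} {x : ABar n} {c : UhBar n}
    (h : x - cartanBar n c ∈ (oddAlg n).M) : HarishChandra (cls x) c := by
  intro c'
  rw [← map_sub, cls_mem_sup]
  exact ⟨fun h' => eq_of_sub_cartanBar_mem_M h h', fun h' => h' ▸ h⟩

theorem toGH_cls_eq {n : ℕ} {x y : ABar n} :
    toGH (cls x) = toGH (cls y) ↔ x - y ∈ (oddAlg n).Idel := by
  rw [← cls_mem_Idelta, map_sub, toGH, Submodule.mkQ_apply, Submodule.mkQ_apply,
    Submodule.Quotient.eq]

/-! ### The contravariant form -/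

/-- Changing x within its class alters the product by an element of I_ζ, and changing the singular b
alters it by an element of I_δ; both lie in the kernel of the projection. -/
theorem exists_pairing {n : ℕ} (X Y : GH n) : ∃ c : UhBar n, ∀ x b : ABar n,
    toGH (cls x) = X → (oddAlg n).Sing b → toGH (cls b) = Y →
      eps x * b - cartanBar n c ∈ (oddAlg n).M := by
  obtain ⟨X, rfl⟩ := Submodule.mkQ_surjective _ X
  obtain ⟨x₀, rfl⟩ := cls_surjective X
  obtain ⟨Y, rfl⟩ := Submodule.mkQ_surjective _ Y
  obtain ⟨b₀, hb₀, rfl⟩ := exists_sing_cls_eq Y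
  obtain ⟨c, hc⟩ := OddAlg.exists_sub_C_mem (S := oddAlg n) (eps x₀ * b₀)
  refine ⟨c, fun x b hx hb hbY => ?_⟩
  have h1 := OddAlg.eps_mul_mem_of_mem_Idel (toGH_cls_eq.1 hx) hb
  have h2 := OddAlg.Sing.mul_mem_Idel (hb.sub hb₀) (toGH_cls_eq.1 hbY) (eps x₀)
  have h3 : eps x * b - cartanBar n c
      = (eps (x - x₀) * b + eps x₀ * (b - b₀)) + (eps x₀ * b₀ - cartanBar n c) := by
    rw [eps_sub, sub_mul, mul_sub]
    abel
  rw [h3]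
  refine add_mem (add_mem ?_ ?_) hc
  · rw [OddAlg.M, ← OddAlg.Idel_sup_Izet]; exact AddSubgroup.mem_sup_right h1
  · rw [OddAlg.M, ← OddAlg.Idel_sup_Izet]; exact AddSubgroup.mem_sup_left h2

/-- The contravariant form. -/
noncomputable def contravariantForm {n : ℕ} (X Y : GH n) : UhBar n := (exists_pairing X Y).choose

theorem sub_contravariantForm_mem {n : ℕ} (x : ABar n) {b : ABar n} (hb : (oddAlg n).Sing b) :
    eps x * b - cartanBar n (contravariantForm (toGH (cls x)) (toGH (cls b))) ∈ (oddAlg n).M :=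
  (exists_pairing (toGH (cls x)) (toGH (cls b))).choose_spec x b rfl hb rfl

theorem isContravariantForm {n : ℕ} :
    IsContravariantForm (contravariantForm : GH n → GH n → UhBar n) := by
  intro x y
  obtain ⟨b, hb, h⟩ := exists_sing_cls_eq (cls y)
  rw [← h, diamond_cls _ hb]
  exact harishChandra_cls (sub_contravariantForm_mem x hb)

/-! ### Monomials -/

/-- The support of an exponent. -/
def support {n : ℕ} (ν : Fin n → ℕ) : Finset (Fin n) := Finset.univ.filter fun i => ν i = 1

theorem mem_support {n : ℕ} {ν : Fin n → ℕ} {i : Fin n} : i ∈ support ν ↔ ν i = 1 := by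
  simp [support]

theorem toBar_ofFn_prod {n : ℕ} {ν : Fin n → ℕ} (hν : ∀ i, ν i ≤ 1) (q : ℕ) (hq : q ≤ n) :
    toBar n ((List.ofFn fun i : Fin q => zeta (i.castLE hq) ^ ν (i.castLE hq)).prod ⊗ₜ 1)
      = (oddAlg n).mon (support ν) q := by
  induction q with
  | zero => simp [OddAlg.mon, ← Algebra.TensorProduct.one_def]
  | succ q ih =>
    have h1 : toBar n ((zeta (⟨q, hq⟩ : Fin n) ^ ν ⟨q, hq⟩) ⊗ₜ 1)
        = (oddAlg n).monFactor (support ν) q := by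
      by_cases h : ν ⟨q, hq⟩ = 1
      · rw [OddAlg.monFactor_of_mem (p := ⟨q, hq⟩) _ (mem_support.2 h), h, pow_one]; rfl
      · have h0 : ν ⟨q, hq⟩ = 0 := by have := hν ⟨q, hq⟩; omega
        rw [OddAlg.monFactor_of_notMem (p := ⟨q, hq⟩) _ (fun h' => h (mem_support.1 h')), h0,
          pow_zero, ← Algebra.TensorProduct.one_def, map_one]
    rw [OddAlg.mon, ← ih (Nat.le_of_succ_le hq), ← h1, ← map_mul,
      Algebra.TensorProduct.tmul_mul_tmul, one_mul, List.ofFn_succ', List.concat_eq_append,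
      List.prod_append, List.prod_singleton]
    rfl

theorem monomial_eq {n : ℕ} {ν : Fin n → ℕ} (hν : ∀ i, ν i ≤ 1) :
    monomial ν = toGH (cls ((oddAlg n).mon (support ν) n)) := by
  rw [← toBar_ofFn_prod hν n le_rfl]
  rfl

/-- The second monomial is replaced by its singular representative. If ν ≠ ν' the product has
nonzero weight, hence no Cartan part; otherwise the Cartan part was found in `exists_sing_mon`. -/
theorem contravariantForm_monomial {n : ℕ} {ν ν' : Fin n → ℕ} (hν : ∀ i, ν i ≤ 1)
    (hν' : ∀ i, ν' i ≤ 1) : contravariantForm (monomial ν) (monomial ν')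
      = if ν = ν' then (oddAlg n).monNorm (support ν) n else 0 := by
  obtain ⟨w, hw, hwt, hlow, hnorm⟩ := (oddAlg n).exists_sing_mon (support ν') n le_rfl
  have hcls : toGH (cls w) = monomial ν' := by
    rw [monomial_eq hν', cls_eq_cls.2 (OddAlg.lowTo_le_Q _ hlow)]
  have h1 := sub_contravariantForm_mem ((oddAlg n).mon (support ν) n) hw
  rw [hcls, ← monomial_eq hν] at h1
  refine (eq_of_sub_cartanBar_mem_M ?_ h1)
  split_ifs with h
  · subst h; exact hnorm
  · rw [map_zero, sub_zero]
    obtain ⟨i, hi⟩ := Function.ne_iff.1 h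
    have hwt2 := ((oddAlg n).wt_mon (support ν) n le_rfl).eps.mul hwt
    refine OddAlg.Wt.mem_M hwt2 (i := i) ?_
    have hne : (-OddAlg.monWt (support ν) n + OddAlg.monWt (support ν') n) i ≠ 0 := by
      have a := hν i
      have b := hν' i
      simp only [Pi.add_apply, Pi.neg_apply, OddAlg.monWt, mem_support, i.2, and_true]
      split_ifs <;> omega
    -- A nonzero integer is invertible in the localized Cartan algebra because it is a nonzero
    -- complex scalar.
    have : (((-OddAlg.monWt (support ν) n + OddAlg.monWt (support ν') n) i : ℤ) : UhBar n)
        = algebraMap ℂ (UhBar n) (((-OddAlg.monWt (support ν) n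
          + OddAlg.monWt (support ν') n) i : ℤ) : ℂ) := by rw [map_intCast]
    rw [this]
    exact (IsUnit.mk0 _ (Int.cast_ne_zero.2 hne)).map _

theorem hr_eq_hring {n : ℕ} (i j : Fin n) : (oddAlg n).hr i j = hring i j := by
  rw [OddAlg.hr, hring]
  have : (MvPolynomial.X i - MvPolynomial.C (i : ℂ)) - (MvPolynomial.X j - MvPolynomial.C (j : ℂ))
      = MvPolynomial.X i - MvPolynomial.X j + (((j : ℤ) - (i : ℤ) : ℤ) : Uh n) := by
    simp only [map_natCast]
    push_cast
    ring
  rw [this, map_add, map_sub, map_intCast]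
  rfl

theorem monNorm_eq {n : ℕ} (s : Finset (Fin n)) : (oddAlg n).monNorm s n
    = ∏ i : Fin n, ∏ j ∈ Finset.Ioi i,
      if i ∉ s ∧ j ∈ s then 1 - Ring.inverse (hring i j) else 1 := by
  have h1 : s.filter (fun j : Fin n => (j : ℕ) < n) = Finset.univ.filter (· ∈ s) := by
    ext j; simp
  rw [OddAlg.monNorm, h1, Finset.prod_filter, Finset.prod_comm' (s' := fun j => Finset.Iio j)
    (t' := Finset.univ) (by simp)]
  refine Finset.prod_congr rfl fun j _ => ?_
  split_ifs with hj
  · rw [Finset.prod_filter]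
    exact Finset.prod_congr rfl fun i _ => by simp [hj, hr_eq_hring]
  · exact (Finset.prod_eq_one fun i _ => by simp [hj]).symm

/-- The exponents are 0 or 1. In three of the four cases both sides equal 1, and for ν_i = 0, ν_j =
1 both are (h̊_ij - 1)/h̊_ij. -/
theorem norm_factor_left {n : ℕ} {ν : Fin n → ℕ} (hν : ∀ i, ν i ≤ 1) {i j : Fin n} (hij : i < j) :
    (if i ∉ support ν ∧ j ∈ support ν then 1 - Ring.inverse (hring i j) else 1)
      = (hring i j - (ν j : UhBar n)) ^ (1 - ν i) * Ring.inverse (hring i j ^ (1 - ν i)) := by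
  have hu := Ring.mul_inverse_cancel _ (isUnit_hring hij.ne)
  have hi := hν i
  have hj := hν j
  simp only [mem_support]
  interval_cases h1 : ν i <;> interval_cases h2 : ν j <;> simp [sub_mul, hu]

theorem norm_factor_right {n : ℕ} {ν : Fin n → ℕ} (hν : ∀ i, ν i ≤ 1) {i j : Fin n}
    (hij : i < j) :
    (if i ∉ support ν ∧ j ∈ support ν then 1 - Ring.inverse (hring i j) else 1)
      = (hring i j - 1 + (ν i : UhBar n)) ^ ν j * Ring.inverse (hring i j ^ ν j) := by
  have hu := Ring.mul_inverse_cancel _ (isUnit_hring hij.ne)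
  have hi := hν i
  have hj := hν j
  simp only [mem_support]
  interval_cases h1 : ν i <;> interval_cases h2 : ν j <;> simp [sub_mul, hu]

end HGrassmann

theorem proposition3p4 (n : ℕ) :
    ∃ B : HGrassmann.GH n → HGrassmann.GH n → HGrassmann.UhBar n, HGrassmann.IsContravariantForm B ∧
      ∀ ν ν' : Fin n → ℕ, (∀ i, ν i ≤ 1) → (∀ i, ν' i ≤ 1) →
        B (HGrassmann.monomial ν) (HGrassmann.monomial ν') =
            (if ν = ν' then
              ∏ i : Fin n, ∏ j ∈ Finset.Ioi i,
                (HGrassmann.hring i j - (ν j : HGrassmann.UhBar n)) ^ (1 - ν i) * Ring.inverse (HGrassmann.hring i j ^ (1 - ν i))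
            else 0) ∧
        B (HGrassmann.monomial ν) (HGrassmann.monomial ν') =
            (if ν = ν' then
              ∏ i : Fin n, ∏ j ∈ Finset.Ioi i,
                (HGrassmann.hring i j - 1 + (ν i : HGrassmann.UhBar n)) ^ ν j * Ring.inverse (HGrassmann.hring i j ^ ν j)
            else 0) := by
  refine ⟨HGrassmann.contravariantForm, HGrassmann.isContravariantForm, fun ν ν' hν hν' => ?_⟩
  rw [HGrassmann.contravariantForm_monomial hν hν']
  constructor <;> split_ifs
  · rw [HGrassmann.monNorm_eq]
    exact Finset.prod_congr rfl fun i _ => Finset.prod_congr rfl fun j hj =>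
      HGrassmann.norm_factor_left hν (Finset.mem_Ioi.1 hj)
  · rfl
  · rw [HGrassmann.monNorm_eq]
    exact Finset.prod_congr rfl fun i _ => Finset.prod_congr rfl fun j hj =>
      HGrassmann.norm_factor_right hν (Finset.mem_Ioi.1 hj)
  · rfl
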